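/- Let $\theta=(\theta_0,\theta_1,\theta_t,\theta_\infty)\in\mathbb{C}^*\times\mathbb{C}^*\times\mathbb{C}^*\times(\mathbb{C}\setminus\{1\})$ and, for $q\in\mathbb{C}$, $\Theta_i(q)=1+\frac{q-1}{2}\theta_i$. Let $\mathbb{F}_2$ be the second Hirzebruch surface, with its four charts $\mathbb{C}^2$ of coordinates $(u_0,v_0)=(u,v)$, $(u_1,v_1)=(u,1/v)$, $(u_2,v_2)=(1/u,v/u^2)$, $(u_3,v_3)=(1/u,u^2/v)$. Put $\mathcal H=\{v_1=0\}\cup\{v_3=0\}$, $\mathcal D_c=\{u_0=c\}\cup\{u_1=c\}$ for $c\in\mathbb{C}$, $\mathcal D_\infty=\{u_2=0\}\cup\{u_3=0\}$ and $$\mathcal C(q)=\{(u-1)(u-t)=(1-q)v\}\cup\{(u_1-1)(u_1-t)v_1=1-q\}\cup\{(1-u_3)(1-tu_3)v_3=1-q\}.$$ *Okamoto's space.* For $t\in\mathbb{C}\setminus\{0,1\}$, let $\mathrm{Oka}_t$ be the blow-up of $\mathbb{F}_2$ at the eight points $(u,v)=(0,\pm\frac{t\theta_0}{2})$, $(1,\pm\frac{(t-1)\theta_1}{2})$,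 $(t,\pm\frac{t(t-1)\theta_t}{2})$ and $(u_2,v_2)=(0,\frac{\theta_\infty-2}{2})$, $(0,-\frac{\theta_\infty}{2})$, minus the strict transforms of $\mathcal D_0,\mathcal D_1,\mathcal D_t,\mathcal D_\infty,\mathcal H$. *The modified $q$-Okamoto space.* For $q\in\mathbb{C}\setminus\{0,1\}$, $\Theta\in(\mathbb{C}^*)^4$ and $t\in\mathbb{C}^*$, let $q\text{-}\widetilde{\mathrm{Oka}}_t$ be the blow-up of $\mathbb{F}_2$ at the eight points $(u,v)=\left(0,\frac{t(\Theta_0^{\pm1}-1)}{q-1}\right)$, $\left(\Theta_1^{\pm1},\frac{(\Theta_1^{\pm1}-1)(t-\Theta_1^{\pm1})}{q-1}\right)$, $\left(t\Theta_t^{\mp1},-\frac{t(\Theta_t^{\mp1}-1)(t\Theta_t^{\mp1}-1)}{q-1}\right)$ and $(u_2,v_2)=\left(0,\frac{\Theta_\infty-q}{q(q-1)}\right)$, $\left(0,\frac{\Theta_\infty^{-1}-1}{q-1}\right)$, minus the strict transforms of $\mathcal H,\mathcal D_0,\mathcal D_\infty,\mathcal C(q)$. *The family.* For $t\in\mathbb{C}^*$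 consider the eight curves $q\mapsto\beta_i^\pm(q)\in\mathbb{F}_2$, $i\in\{0,1,t,\infty\}$, given by $$\beta_0^+:(u,v)=\left(0,\tfrac{t\theta_0}{2}\right),\qquad \beta_0^-:(u,v)=\left(0,\tfrac{-t\theta_0/2}{\Theta_0(q)}\right),$$ $$\beta_1^+:(u,v)=\left(\Theta_1(q),\tfrac{\theta_1(t-\Theta_1(q))}{2}\right),\qquad \beta_1^-:(u,v)=\left(\tfrac1{\Theta_1(q)},\tfrac{-\frac{\theta_1}{2}\left(t-\frac{1}{\Theta_1(q)}\right)}{\Theta_1(q)}\right),$$ $$\beta_t^+:(u,v)=\left(\tfrac{t}{\Theta_t(q)},\tfrac{t(t-\Theta_t(q))\theta_t/2}{\Theta_t(q)^2}\right),\qquad \beta_t^-:(u,v)=\left(t\Theta_t(q),-\tfrac{t\theta_t}{2}(t\Theta_t(q)-1)\right),$$ $$\beta_\infty^+:(u_2,v_2)=\left(0,\tfrac{\theta_\infty/2-1}{q}\right),\qquad \beta_\infty^-:(u_2,v_2)=\left(0,\tfrac{-\theta_\infty/2}{\Theta_\infty(q)}\right).$$ Let $U_t\subset\mathbb{C}^*$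 be the set of those $q$ with $\Theta_i(q)\neq0$ for all $i$ for which these eight points are pairwise distinct. Let $\Omega_t$ be the blow-up of $U_t\times\mathbb{F}_2$ along the eight disjoint curves $\{(q,\beta_i^\pm(q))\}$, minus the strict transforms of the four surfaces $U_t\times\mathcal H$, $U_t\times\mathcal D_0$, $U_t\times\mathcal D_\infty$ and $\mathcal C=\{(q,x)\mid x\in\mathcal C(q)\}$. All blow-ups at eight points, respectively along eight curves, are realised as closures of graphs in $\mathbb{F}_2\times P^8$, respectively $U_t\times\mathbb{F}_2\times P^8$, by means of the linear projections from the points $\beta_i^\pm$ in a fixed projective embedding of $\mathbb{F}_2$ ($P$ a fixed projective space), so that fibres of $\Omega_t$ over points of $U_t$ and Okamoto spaces are subspaces of the same complex manifold. Then: 1. $\Omega_t|_{q=1}=\mathrm{Oka}_t$ for all $t\in\mathbb{C}\setminus\{0,1\}$. 2. $\Omega_t|_{q=q_0}=q\text{-}\widetilde{\mathrm{Oka}}_t$, formed with $q=q_0$ and $\Theta=\Theta(q_0)$, for all $t\in\mathbb{C}^*$ and $q_0\in\mathbb{C}\setminus\{0,1\}$ such that, for $\Theta=\Theta(q_0)$: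 all $\Theta_i\ne0$; $\Theta_0^2,\Theta_1^2,\Theta_t^2\neq1$ and $\Theta_\infty^2\neq q_0$; and $t\notin S_{q_0}:=\{\Theta_1^{\varepsilon_1}\Theta_t^{\varepsilon_t},\ \Theta_0^{\varepsilon_0}\Theta_\infty^{\varepsilon_\infty}\mid\varepsilon_0,\varepsilon_1,\varepsilon_t,\varepsilon_\infty\in\{\pm1\}\}\cdot q_0^{\mathbb{Z}}$. 3. For all $t\in\mathbb{C}\setminus\{0,1\}$, the surface $\mathcal C$ degenerates at $q=1$: $\mathcal C(1)=\mathcal H\cup\mathcal D_1\cup\mathcal D_t$, and $\mathcal H,\mathcal D_1,\mathcal D_t$ are precisely the three irreducible components of $\mathcal C(1)$. 4. These spaces fit together smoothly: for every $t\in\mathbb{C}^*$, $\Omega_t$ is a complex submanifold (of dimension three) of the ambient manifold on which $q$ is a submersion, and for $t\in\mathbb{C}\setminus\{0,1\}$ the base $U_t$ is a neighbourhood of $q=1$. -/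

import Mathlib

open scoped LinearAlgebra.Projectivization Topology

namespace OkamotoConfluence

noncomputable section

/-! ### Complex projective space -/

/-- Complex projective space carries the quotient topology of `V \ {0}`. -/
instance projTopology {V : Type*} [AddCommGroup V] [Module ℂ V] [TopologicalSpace V] :
    TopologicalSpace (ℙ ℂ V) :=
  TopologicalSpace.coinduced (Projectivization.mk' ℂ) inferInstance

/-- The projective space `ℙ⁵`. -/
abbrev P5 : Type := ℙ ℂ (Fin 6 → ℂ)

/-- The projective space of `6 × 6` matrices; the class of `z ∧ p` (written as an antisymmetric
matrix) is the line of `ℙ⁵` through the points `[z] ≠ [p]`. -/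
abbrev PLines : Type := ℙ ℂ (Fin 6 × Fin 6 → ℂ)

/-- The wedge product `v ∧ w`, i.e. the antisymmetric matrix of `2 × 2` minors of `(v, w)`. -/
def wedge (v w : Fin 6 → ℂ) : Fin 6 × Fin 6 → ℂ :=
  fun k => v k.1 * w k.2 - v k.2 * w k.1

/-- `ℓ` is the line joining `x` to `p` (so `x ≠ p`); equivalently, `ℓ` is the image of `x` under the
linear projection with centre `p`.  This does not depend on the chosen representatives. -/
def IsLineThrough (x p : P5) (ℓ : PLines) : Prop :=
  ∃ h : wedge x.rep p.rep ≠ 0, ℓ = Projectivization.mk ℂ (wedge x.rep p.rep) h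

/-! ### The second Hirzebruch surface -/

/-- Homogeneous coordinates of the four standard charts of the second Hirzebruch surface, embedded
in `ℙ⁵` as the rational normal scroll `S(1, 3)`.  In terms of the standard coordinates `(u, v)` the
embedding is `(u, v) ↦ [u³ : u² : u : 1 : u v : v]`, and the charts are
`(u₀, v₀) = (u, v)`, `(u₁, v₁) = (u, 1/v)`, `(u₂, v₂) = (1/u, v/u²)`, `(u₃, v₃) = (1/u, u²/v)`. -/
def chartVec : Fin 4 → ℂ × ℂ → Fin 6 → ℂ
  | 0, a => ![a.1 ^ 3, a.1 ^ 2, a.1, 1, a.1 * a.2, a.2]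
  | 1, a => ![a.1 ^ 3 * a.2, a.1 ^ 2 * a.2, a.1 * a.2, a.2, a.1, 1]
  | 2, a => ![1, a.1, a.1 ^ 2, a.1 ^ 3, a.2, a.1 * a.2]
  | 3, a => ![a.2, a.1 * a.2, a.1 ^ 2 * a.2, a.1 ^ 3 * a.2, 1, a.1]

lemma chartVec_ne_zero (i : Fin 4) (a : ℂ × ℂ) : chartVec i a ≠ 0 := by
  intro h
  fin_cases i
  · simpa [chartVec] using congrFun h 3
  · simpa [chartVec] using congrFun h 5
  · simpa [chartVec] using congrFun h 0
  · simpa [chartVec] using congrFun h 4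

/-- The second Hirzebruch surface `𝔽₂`: the union of its four charts, as a subspace of `ℙ⁵`. -/
abbrev F2 : Type :=
  {x : P5 // ∃ (i : Fin 4) (a : ℂ × ℂ), x = Projectivization.mk ℂ (chartVec i a)
    (chartVec_ne_zero i a)}

/-- The `i`-th chart `ℂ² → 𝔽₂`. -/
def chart (i : Fin 4) (a : ℂ × ℂ) : F2 :=
  ⟨Projectivization.mk ℂ (chartVec i a) (chartVec_ne_zero i a), i, a, rfl⟩

/-- The transition map between the charts `0` and `1`. -/
lemma chart_one_eq (u v : ℂ) (hv : v ≠ 0) : chart 1 (u, 1 / v) = chart 0 (u, v) := by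
  apply Subtype.ext
  refine (Projectivization.mk_eq_mk_iff' ℂ _ _ _ _).2 ⟨1 / v, ?_⟩
  funext k
  fin_cases k <;> simp [chartVec] <;> field_simp

/-- The transition map between the charts `0` and `2`. -/
lemma chart_two_eq (u v : ℂ) (hu : u ≠ 0) : chart 2 (1 / u, v / u ^ 2) = chart 0 (u, v) := by
  apply Subtype.ext
  refine (Projectivization.mk_eq_mk_iff' ℂ _ _ _ _).2 ⟨1 / u ^ 3, ?_⟩
  funext k
  fin_cases k <;> simp [chartVec] <;> field_simp

/-- The transition map between the charts `0` and `3`. -/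
lemma chart_three_eq (u v : ℂ) (hu : u ≠ 0) (hv : v ≠ 0) :
    chart 3 (1 / u, u ^ 2 / v) = chart 0 (u, v) := by
  apply Subtype.ext
  refine (Projectivization.mk_eq_mk_iff' ℂ _ _ _ _).2 ⟨1 / (u * v), ?_⟩
  funext k
  fin_cases k <;> simp [chartVec] <;> field_simp

/-- The horizontal line `ℋ = {v₁ = 0} ∪ {v₃ = 0}`. -/
def lineH : Set F2 := chart 1 '' {a | a.2 = 0} ∪ chart 3 '' {a | a.2 = 0}

/-- The vertical line `𝒟_c = {u₀ = c} ∪ {u₁ = c}`, for `c ∈ ℂ`. -/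
def lineD (c : ℂ) : Set F2 := chart 0 '' {a | a.1 = c} ∪ chart 1 '' {a | a.1 = c}

/-- The vertical line `𝒟_∞ = {u₂ = 0} ∪ {u₃ = 0}`. -/
def lineDinf : Set F2 := chart 2 '' {a | a.1 = 0} ∪ chart 3 '' {a | a.1 = 0}

/-- The curve `𝒞` in `𝔽₂`, for fixed `q` and `t`. -/
def curveC (q t : ℂ) : Set F2 :=
  chart 0 '' {a | (a.1 - 1) * (a.1 - t) = (1 - q) * a.2} ∪
  chart 1 '' {a | (a.1 - 1) * (a.1 - t) * a.2 = 1 - q} ∪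
  chart 3 '' {a | (1 - a.1) * (1 - t * a.1) * a.2 = 1 - q}

/-- The Zariski topology of `ℂ²`. -/
@[reducible] def zariskiPlane : TopologicalSpace (ℂ × ℂ) :=
  TopologicalSpace.generateFrom
    {U | ∃ f : MvPolynomial (Fin 2) ℂ, U = {a | MvPolynomial.eval ![a.1, a.2] f ≠ 0}}

/-- The Zariski topology of `𝔽₂`: a set is open iff its trace on each of the four charts is. -/
@[reducible] def zariskiF2 : TopologicalSpace F2 :=
  ⨆ i : Fin 4, TopologicalSpace.coinduced (chart i) zariskiPlane

/-- `Z` is an irreducible component of `S ⊆ 𝔽₂`: a maximal Zariski-irreducible subset of `S`. -/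
def IsIrredComponent (S Z : Set F2) : Prop :=
  Maximal (fun Y : Set F2 => @IsIrreducible F2 zariskiF2 Y ∧ Y ⊆ S) Z

/-! ### Blow-ups and strict transforms

The blow-up of a projective variety at a point `p` is the closure of the graph of the linear
projection with centre `p`.  Blowing up finitely many distinct points `p i` yields the closure of
the joint graph of these projections; the blow-up of a product with a parameter space along finitely
many pairwise disjoint curves, each one the graph of a map from the parameter space, is obtained in
the same way. -/

/-- The space in which the blow-ups of `𝔽₂` at points indexed by `ι` live. -/
abbrev Ambient (ι : Type) : Type := F2 × (ι → PLines)

/-- The blow-up of `𝔽₂` at the (distinct) points `p i`. -/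
def blowupPoints {ι : Type} (p : ι → F2) : Set (Ambient ι) :=
  closure {y | ∀ i, IsLineThrough y.1 (p i) (y.2 i)}

/-- The strict transform of `S ⊆ 𝔽₂` in the blow-up at the points `p i`. -/
def strictPoints {ι : Type} (p : ι → F2) (S : Set F2) : Set (Ambient ι) :=
  closure {y | y ∈ blowupPoints p ∧ y.1 ∈ S ∧ ∀ i, y.1 ≠ p i}

/-- The blow-up of `B × 𝔽₂`, where `B ⊆ ℂ` is open, along the (pairwise disjoint) curves
`{(q, p i q) | q ∈ B}`. -/
def blowupCurves {ι : Type} (B : Set ℂ) (p : ι → ℂ → F2) : Set (ℂ × Ambient ι) :=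
  {y | y.1 ∈ B} ∩ closure {y | y.1 ∈ B ∧ ∀ i, IsLineThrough y.2.1 (p i y.1) (y.2.2 i)}

/-- The strict transform of `S ⊆ ℂ × 𝔽₂` in the blow-up of `B × 𝔽₂` along the curves
`{(q, p i q) | q ∈ B}`. -/
def strictCurves {ι : Type} (B : Set ℂ) (p : ι → ℂ → F2) (S : Set (ℂ × F2)) :
    Set (ℂ × Ambient ι) :=
  {y | y.1 ∈ B} ∩
    closure {y | y ∈ blowupCurves B p ∧ (y.1, y.2.1) ∈ S ∧ ∀ i, y.2.1 ≠ p i y.1}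

/-- The fibre over `q` of a family `X → ℂ`. -/
def fibre {ι : Type} (X : Set (ℂ × Ambient ι)) (q : ℂ) : Set (Ambient ι) :=
  {y | (q, y) ∈ X}

/-- `X → ℂ`, `(q, y) ↦ q`, is a smooth holomorphic family of surfaces: near each of its points, `X`
is a complex submanifold of the ambient space (a product of `ℂ` and projective spaces) which admits
a holomorphic parametrization by an open subset of `ℂ³` whose first coordinate is `q`.
Here `A` and `L i` are homogeneous coordinates of the parametrization, normalized by setting one of
them equal to `1`. -/
def IsSmoothFamily {ι : Type} (X : Set (ℂ × Ambient ι)) : Prop :=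
  ∀ x : X, ∃ (e : OpenPartialHomeomorph (ℂ × ℂ × ℂ) X)
    (A : ℂ × ℂ × ℂ → Fin 6 → ℂ) (L : ι → ℂ × ℂ × ℂ → Fin 6 × Fin 6 → ℂ),
    x ∈ e.target ∧
    (∀ w ∈ e.source, (e w).1.1 = w.1 ∧
      (∃ h, (e w).1.2.1.1 = Projectivization.mk ℂ (A w) h) ∧
      ∀ i, ∃ h, (e w).1.2.2 i = Projectivization.mk ℂ (L i w) h) ∧
    (∃ k, ∀ w ∈ e.source, A w k = 1) ∧
    (∀ i, ∃ k, ∀ w ∈ e.source, L i w k = 1) ∧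
    DifferentiableOn ℂ A e.source ∧
    (∀ i, DifferentiableOn ℂ (L i) e.source) ∧
    ∀ w ∈ e.source, ∀ h : ℂ × ℂ × ℂ, h.1 = 0 → fderiv ℂ A w h = 0 →
      (∀ i, fderiv ℂ (L i) w h = 0) → h = 0

/-! ### Base points -/

/-- The four places `0, 1, t, ∞`. -/
inductive Place : Type
  | zero
  | one
  | t
  | infty

/-- The signs `+, -`. -/
inductive Sgn : Type
  | plus
  | minus

/-- The eight base points `β_i^±` of the sixth Painlevé equation with spectral data `θ`. -/
def okaPoint (θ : Place → ℂ) (t : ℂ) : Place × Sgn → F2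
  | (.zero, .plus) => chart 0 (0, t * θ .zero / 2)
  | (.zero, .minus) => chart 0 (0, -(t * θ .zero / 2))
  | (.one, .plus) => chart 0 (1, (t - 1) * θ .one / 2)
  | (.one, .minus) => chart 0 (1, -((t - 1) * θ .one / 2))
  | (.t, .plus) => chart 0 (t, t * (t - 1) * θ .t / 2)
  | (.t, .minus) => chart 0 (t, -(t * (t - 1) * θ .t / 2))
  | (.infty, .plus) => chart 2 (0, (θ .infty - 2) / 2)
  | (.infty, .minus) => chart 2 (0, -(θ .infty / 2))

/-- The eight points of `𝔽₂` blown up for the modified `q`-Okamoto space with spectral data `Θ`. -/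
def qOkaPoint (q : ℂ) (Θ : Place → ℂ) (t : ℂ) : Place × Sgn → F2
  | (.zero, .plus) => chart 0 (0, t * (Θ .zero - 1) / (q - 1))
  | (.zero, .minus) => chart 0 (0, t * ((Θ .zero)⁻¹ - 1) / (q - 1))
  | (.one, .plus) => chart 0 (Θ .one, (Θ .one - 1) * (t - Θ .one) / (q - 1))
  | (.one, .minus) =>
      chart 0 ((Θ .one)⁻¹, ((Θ .one)⁻¹ - 1) * (t - (Θ .one)⁻¹) / (q - 1))
  | (.t, .plus) =>
      chart 0 (t * (Θ .t)⁻¹, -(t * ((Θ .t)⁻¹ - 1) * (t * (Θ .t)⁻¹ - 1) / (q - 1)))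
  | (.t, .minus) => chart 0 (t * Θ .t, -(t * (Θ .t - 1) * (t * Θ .t - 1) / (q - 1)))
  | (.infty, .plus) => chart 2 (0, (Θ .infty - q) / (q * (q - 1)))
  | (.infty, .minus) => chart 2 (0, ((Θ .infty)⁻¹ - 1) / (q - 1))

/-- The confluent spectral data `Θ_i(q) = 1 + (q - 1) θ_i / 2`. -/
def confTheta (θ : Place → ℂ) (q : ℂ) (i : Place) : ℂ := 1 + (q - 1) / 2 * θ i

/-- The eight curves `q ↦ β_i^±(q)` in `𝔽₂`. -/
def confPoint (θ : Place → ℂ) (t : ℂ) : Place × Sgn → ℂ → F2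
  | (.zero, .plus), _ => chart 0 (0, t * θ .zero / 2)
  | (.zero, .minus), q => chart 0 (0, (-t * θ .zero / 2) / confTheta θ q .zero)
  | (.one, .plus), q =>
      chart 0 (confTheta θ q .one, θ .one * (t - confTheta θ q .one) / 2)
  | (.one, .minus), q =>
      chart 0 (1 / confTheta θ q .one,
        (-θ .one / 2 * (t - 1 / confTheta θ q .one)) / confTheta θ q .one)
  | (.t, .plus), q =>
      chart 0 (t / confTheta θ q .t,
        (t * (t - confTheta θ q .t) * θ .t / 2) / confTheta θ q .t ^ 2)
  | (.t, .minus), q =>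
      chart 0 (t * confTheta θ q .t, -(t * θ .t / 2) * (t * confTheta θ q .t - 1))
  | (.infty, .plus), q => chart 2 (0, (θ .infty / 2 - 1) / q)
  | (.infty, .minus), q => chart 2 (0, (-θ .infty / 2) / confTheta θ q .infty)

/-! ### Okamoto spaces -/

/-- Okamoto's space of initial values `Oka_t` of the sixth Painlevé equation. -/
def Oka (θ : Place → ℂ) (t : ℂ) : Set (Ambient (Place × Sgn)) :=
  blowupPoints (okaPoint θ t) \
    (strictPoints (okaPoint θ t) (lineD 0) ∪ strictPoints (okaPoint θ t) (lineD 1) ∪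
      strictPoints (okaPoint θ t) (lineD t) ∪ strictPoints (okaPoint θ t) lineDinf ∪
      strictPoints (okaPoint θ t) lineH)

/-- The modified `q`-Okamoto space with spectral data `Θ`. -/
def qOkaMod (q : ℂ) (Θ : Place → ℂ) (t : ℂ) : Set (Ambient (Place × Sgn)) :=
  blowupPoints (qOkaPoint q Θ t) \
    (strictPoints (qOkaPoint q Θ t) lineH ∪ strictPoints (qOkaPoint q Θ t) (lineD 0) ∪
      strictPoints (qOkaPoint q Θ t) lineDinf ∪
      strictPoints (qOkaPoint q Θ t) (curveC q t))

/-- The set of those `q ∈ ℂ*` for which the eight points `β_i^±(q)` are defined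
(`Θ_i(q) ≠ 0`) and pairwise distinct. -/
def base (θ : Place → ℂ) (t : ℂ) : Set ℂ :=
  {q | q ≠ 0 ∧ (∀ i, confTheta θ q i ≠ 0) ∧ Function.Injective fun k => confPoint θ t k q}

/-- The surface `𝒞` in the product `ℂ × 𝔽₂`. -/
def surfaceC (t : ℂ) : Set (ℂ × F2) := {z | z.2 ∈ curveC z.1 t}

/-- The surface `ℂ × S` in the product `ℂ × 𝔽₂`. -/
def cylinder (S : Set F2) : Set (ℂ × F2) := {z | z.2 ∈ S}

/-- The family `Ω_t`: the blow-up along the eight curves, minus the strict transforms of the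
surfaces `ℋ`, `𝒞`, `𝒟_0` and `𝒟_∞`. -/
def Omega (θ : Place → ℂ) (t : ℂ) : Set (ℂ × Ambient (Place × Sgn)) :=
  blowupCurves (base θ t) (confPoint θ t) \
    (strictCurves (base θ t) (confPoint θ t) (cylinder lineH) ∪
      strictCurves (base θ t) (confPoint θ t) (surfaceC t) ∪
      strictCurves (base θ t) (confPoint θ t) (cylinder (lineD 0)) ∪
      strictCurves (base θ t) (confPoint θ t) (cylinder lineDinf))

/-- The genericity condition on the spectral data. -/
def IsGenericTheta (q : ℂ) (Θ : Place → ℂ) : Prop :=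
  Θ .zero ^ 2 ≠ 1 ∧ Θ .one ^ 2 ≠ 1 ∧ Θ .t ^ 2 ≠ 1 ∧ Θ .infty ^ 2 ≠ q

/-- The exceptional set `S_q = {Θ_1^±1 Θ_t^±1, Θ_0^±1 Θ_∞^±1} · q^ℤ`. -/
def exceptionalSet (q : ℂ) (Θ : Place → ℂ) : Set ℂ :=
  {s | ∃ (ε ε' k : ℤ), (ε = 1 ∨ ε = -1) ∧ (ε' = 1 ∨ ε' = -1) ∧
    (s = Θ .one ^ ε * Θ .t ^ ε' * q ^ k ∨ s = Θ .zero ^ ε * Θ .infty ^ ε' * q ^ k)}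

end

end OkamotoConfluence

namespace OkamotoConfluence

noncomputable section

open Filter

/-! ### The topology of projective space -/

/-! Substituting θ_i = 2(Θ_i - 1)/(q - 1) identifies the eight curves at q ≠ 1 with the centres of
the modified q-Okamoto space, and at q = 1 they are the centres of Okamoto's space. The content is
that restriction to a fibre commutes with the closures defining blow-ups and strict transforms: a
closure taken in the family could acquire limits from parameters q' → q that are not limits inside
the fibre.

All centres lie off ℋ, in the charts 0 and 2. There the line joining a to c is the class of a matrix
`secant` that is linear in the displacement a - c and stays nonzero for every nonzero direction,
even at a = c. Hence a limit over a centre is recorded by a direction d (`secant_of_mem_closure`),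
while off the centre the line is determined by the point (`isLineThrough_of_mem_closure`).
Conversely, such a point is reached along an arc c + s E(s) with E(0) = d inside a single fibre
(`mem_closure_lines`). This gives `fibre_blowupCurves`. For strict transforms, a linear relation
with continuous coefficients between the coordinates of the displacements passes to the limiting
directions (`dirn_of_mem_closure`); it then remains to find an arc inside the curve in the fibre
(`fibre_strictCurves_subset`).

The delicate surface is 𝒞. The centres at the places 1 and t lie on 𝒞(q) for every q, those at 0 and
∞ never do. Subtracting the equation at the centre c from the one at a leaves (a₁ + c₁ - 1 - t)(a₁ -
c₁) = (1 - q)(a₂ - c₂), so limiting directions satisfy (2c₁ - 1 - t) d₁ = (1 - q) d₂. For q ≠ 1 this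
is the tangent of the parabola 𝒞(q). At q = 1 one has c₁ = 1 or c₁ = t, and t ≠ 1 forces d₁ = 0, the
direction of 𝒟_1 or 𝒟_t. As 𝒞(1) = ℋ ∪ 𝒟_1 ∪ 𝒟_t, removing 𝒞 and ℋ at q = 1 removes exactly the
transforms of these three lines.

Smoothness comes from explicit blow-up charts (`hasParametrization_of_ne`,
`hasParametrization_of_eq`), Ω_t being open in the blow-up. The components of 𝒞(1) are found by
writing each line as two affine lines on which a Zariski-open set is empty or cofinite. -/

lemma eq_of_mem_closure {Y Z : Type*} [TopologicalSpace Y] [TopologicalSpace Z] [T2Space Z]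
    {T : Set Y} {y : Y} (hy : y ∈ closure T) {f g : Y → Z} (hf : ContinuousAt f y)
    (hg : ContinuousAt g y) (h : ∀ᶠ z in 𝓝 y, z ∈ T → f z = g z) : f y = g y := by
  have : (𝓝[T] y).NeBot := mem_closure_iff_nhdsWithin_neBot.1 hy
  have e : f =ᶠ[𝓝[T] y] g := eventually_nhdsWithin_iff.2 h
  exact tendsto_nhds_unique (hf.mono_left nhdsWithin_le_nhds)
    ((tendsto_congr' e).2 (hg.mono_left nhdsWithin_le_nhds))

section Projective

variable {κ : Type*}

lemma isQuotientMap_mk' :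
    Topology.IsQuotientMap (Projectivization.mk' ℂ : {v : κ → ℂ // v ≠ 0} → ℙ ℂ (κ → ℂ)) := by
  refine ⟨⟨rfl⟩, fun x => ⟨⟨x.rep, x.rep_nonzero⟩, ?_⟩⟩
  rw [Projectivization.mk'_eq_mk]
  exact x.mk_rep

/-- The saturation of an open set is the union of its preimages under the scalings by units.
Together with the quotient property this lets neighbourhood filters of projective space be computed
on nonzero vectors. -/
lemma isOpenMap_mk' :
    IsOpenMap (Projectivization.mk' ℂ : {v : κ → ℂ // v ≠ 0} → ℙ ℂ (κ → ℂ)) := by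
  intro U hU
  rw [← isQuotientMap_mk'.isOpen_preimage]
  have : Projectivization.mk' ℂ ⁻¹' (Projectivization.mk' ℂ '' U) =
      ⋃ a : ℂˣ, (fun v : {v : κ → ℂ // v ≠ 0} =>
        (⟨a • v.1, (smul_ne_zero_iff_ne a).2 v.2⟩ : {v : κ → ℂ // v ≠ 0})) ⁻¹' U := by
    ext v
    simp only [Set.mem_preimage, Set.mem_image, Set.mem_iUnion]
    constructor
    · rintro ⟨w, hw, h⟩
      rw [Projectivization.mk'_eq_mk, Projectivization.mk'_eq_mk,
        Projectivization.mk_eq_mk_iff] at h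
      obtain ⟨a, ha⟩ := h
      exact ⟨a, by convert hw⟩
    · rintro ⟨a, ha⟩
      refine ⟨_, ha, ?_⟩
      rw [Projectivization.mk'_eq_mk, Projectivization.mk'_eq_mk,
        Projectivization.mk_eq_mk_iff]
      exact ⟨a, rfl⟩
  rw [this]
  refine isOpen_iUnion fun a => hU.preimage ?_
  exact Continuous.subtype_mk (continuous_subtype_val.const_smul a) _

lemma nhds_mk (v : κ → ℂ) (hv : v ≠ 0) :
    𝓝 (Projectivization.mk ℂ v hv) =
      map (Projectivization.mk' ℂ) (𝓝 (⟨v, hv⟩ : {v : κ → ℂ // v ≠ 0})) :=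
  (isOpenMap_mk'.map_nhds_eq isQuotientMap_mk'.continuous.continuousAt).symm

/-- The ratio of two homogeneous coordinates. -/
def ratio (j k : κ) (x : ℙ ℂ (κ → ℂ)) : ℂ := x.rep j / x.rep k

lemma exists_rep_mk (v : κ → ℂ) (hv : v ≠ 0) :
    ∃ a : ℂ, a ≠ 0 ∧ (Projectivization.mk ℂ v hv).rep = a • v := by
  obtain ⟨a, ha⟩ := Projectivization.exists_smul_eq_mk_rep ℂ v hv
  exact ⟨a, a.ne_zero, ha.symm⟩

lemma ratio_mk (j k : κ) (v : κ → ℂ) (hv : v ≠ 0) :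
    ratio j k (Projectivization.mk ℂ v hv) = v j / v k := by
  obtain ⟨a, ha, h⟩ := exists_rep_mk v hv
  simp [ratio, h, mul_div_mul_left _ _ ha]

lemma rep_mk_ne_zero_iff (k : κ) (v : κ → ℂ) (hv : v ≠ 0) :
    (Projectivization.mk ℂ v hv).rep k ≠ 0 ↔ v k ≠ 0 := by
  obtain ⟨a, ha, h⟩ := exists_rep_mk v hv
  simp [h, ha]

lemma continuousAt_ratio (j : κ) {k : κ} {x : ℙ ℂ (κ → ℂ)} (hx : x.rep k ≠ 0) :
    ContinuousAt (ratio j k) x := by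
  induction x using Projectivization.ind with
  | h v hv =>
    rw [rep_mk_ne_zero_iff] at hx
    rw [ContinuousAt, nhds_mk, tendsto_map'_iff, ratio_mk]
    have : ratio j k ∘ Projectivization.mk' ℂ =
        fun w : {v : κ → ℂ // v ≠ 0} => w.1 j / w.1 k := by
      funext w
      exact ratio_mk _ _ _ _
    rw [this]
    have h1 : Continuous fun w : {v : κ → ℂ // v ≠ 0} => w.1 j :=
      (continuous_apply j).comp continuous_subtype_val
    have h2 : Continuous fun w : {v : κ → ℂ // v ≠ 0} => w.1 k :=
      (continuous_apply k).comp continuous_subtype_val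
    exact h1.continuousAt.div h2.continuousAt hx

lemma isOpen_rep_ne_zero (k : κ) : IsOpen {x : ℙ ℂ (κ → ℂ) | x.rep k ≠ 0} := by
  rw [← isQuotientMap_mk'.isOpen_preimage]
  have : Projectivization.mk' ℂ ⁻¹' {x : ℙ ℂ (κ → ℂ) | x.rep k ≠ 0} =
      {w : {v : κ → ℂ // v ≠ 0} | w.1 k ≠ 0} := by
    ext w
    exact rep_mk_ne_zero_iff k w.1 w.2
  rw [this]
  exact isOpen_ne_fun ((continuous_apply k).comp continuous_subtype_val) continuous_const

lemma exists_rep_ne_zero (x : ℙ ℂ (κ → ℂ)) : ∃ k, x.rep k ≠ 0 := by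
  by_contra! h
  exact x.rep_nonzero (funext h)

/-- The class of `v`, or `x₀` if `v = 0`. -/
def classOr (x₀ : ℙ ℂ (κ → ℂ)) (v : κ → ℂ) : ℙ ℂ (κ → ℂ) :=
  open Classical in if h : v ≠ 0 then Projectivization.mk ℂ v h else x₀

lemma classOr_of_ne (x₀ : ℙ ℂ (κ → ℂ)) {v : κ → ℂ} (h : v ≠ 0) :
    classOr x₀ v = Projectivization.mk ℂ v h := dif_pos h

/-- Nonzero vectors form an open set, so the default value is invisible near v. -/
lemma continuousAt_classOr (x₀ : ℙ ℂ (κ → ℂ)) {v : κ → ℂ} (h : v ≠ 0) :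
    ContinuousAt (classOr x₀) v := by
  have ho : IsOpen {v : κ → ℂ | v ≠ 0} := isOpen_ne
  have hr : Continuous ({v : κ → ℂ | v ≠ 0}.domRestrict (classOr x₀)) := by
    have : {v : κ → ℂ | v ≠ 0}.domRestrict (classOr x₀) = Projectivization.mk' ℂ := by
      funext w
      exact classOr_of_ne x₀ w.2
    rw [this]
    exact isQuotientMap_mk'.continuous
  exact (continuousOn_iff_continuous_domRestrict.2 hr).continuousAt (ho.mem_nhds h)

lemma mk_eq_of_smul {v w : κ → ℂ} (hv : v ≠ 0) (hw : w ≠ 0) (a : ℂ) (h : v = a • w) :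
    Projectivization.mk ℂ v hv = Projectivization.mk ℂ w hw :=
  (Projectivization.mk_eq_mk_iff' ℂ _ _ _ _).2 ⟨a, h.symm⟩

/-- Proportional coordinates describe the same point. -/
lemma eq_mk_of_rep_mul {x : ℙ ℂ (κ → ℂ)} {v : κ → ℂ} (hv : v ≠ 0)
    (h : ∀ i j, x.rep i * v j = x.rep j * v i) : x = Projectivization.mk ℂ v hv := by
  obtain ⟨k, hk⟩ : ∃ k, v k ≠ 0 := by
    by_contra! h'
    exact hv (funext h')
  rw [← x.mk_rep]
  refine mk_eq_of_smul _ _ (x.rep k / v k) (funext fun i => ?_)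
  have := h i k
  simp only [Pi.smul_apply, smul_eq_mul]
  field_simp
  linear_combination this

/-- The representative `rep` is a choice and is not continuous. Near a limit point the form is
therefore divided by a coordinate that does not vanish there, and the resulting ratios are
continuous. -/
lemma isClosed_linear [Fintype κ] {α : ℂ → κ → ℂ} (hα : ∀ k, Continuous fun q => α q k) :
    IsClosed {z : ℂ × ℙ ℂ (κ → ℂ) | ∑ k, α z.1 k * z.2.rep k = 0} := by
  refine isClosed_of_closure_subset fun z hz => ?_
  obtain ⟨k, hk⟩ := exists_rep_ne_zero z.2
  have key : ∑ j, α z.1 j * ratio j k z.2 = 0 := by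
    refine eq_of_mem_closure (f := fun z : ℂ × ℙ ℂ (κ → ℂ) => ∑ j, α z.1 j * ratio j k z.2)
      (g := fun _ => (0 : ℂ)) hz ?_ continuousAt_const
      (Eventually.of_forall fun w hw => ?_)
    · refine tendsto_finsetSum _ fun j _ => ?_
      exact ((hα j).comp continuous_fst).continuousAt.mul
        ((continuousAt_ratio j hk).comp continuousAt_snd)
    · have : ∑ j, α w.1 j * ratio j k w.2 = (∑ j, α w.1 j * w.2.rep j) / w.2.rep k := by
        rw [Finset.sum_div]
        exact Finset.sum_congr rfl fun j _ => by rw [ratio, mul_div_assoc]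
      rw [this, hw, zero_div]
  have h2 : ∑ j, α z.1 j * z.2.rep j = (∑ j, α z.1 j * ratio j k z.2) * z.2.rep k := by
    rw [Finset.sum_mul]
    exact Finset.sum_congr rfl fun j _ => by rw [ratio]; field_simp
  simp [h2, key]

end Projective

/-! ### The two charts covering the complement of `ℋ` -/

/-- The homogeneous coordinates of the charts `0` (`false`) and `2` (`true`). -/
def cv : Bool → ℂ × ℂ → Fin 6 → ℂ
  | false => chartVec 0
  | true => chartVec 2

/-- The number of a chart. -/
def cnum : Bool → Fin 4
  | false => 0
  | true => 2

/-- The index of the homogeneous coordinate equal to `1` in a chart. -/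
def k0 : Bool → Fin 6
  | false => 3
  | true => 0

/-- The index of the homogeneous coordinate equal to the first chart coordinate. -/
def k1 : Bool → Fin 6
  | false => 2
  | true => 1

/-- The index of the homogeneous coordinate equal to the second chart coordinate. -/
def k2 : Bool → Fin 6
  | false => 5
  | true => 4

lemma cv_eq (b : Bool) : cv b = chartVec (cnum b) := by cases b <;> rfl

lemma cv_k0 (b : Bool) (a : ℂ × ℂ) : cv b a (k0 b) = 1 := by
  cases b <;> simp [cv, k0, chartVec]

lemma cv_k1 (b : Bool) (a : ℂ × ℂ) : cv b a (k1 b) = a.1 := by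
  cases b <;> simp [cv, k1, chartVec]

lemma cv_k2 (b : Bool) (a : ℂ × ℂ) : cv b a (k2 b) = a.2 := by
  cases b <;> simp [cv, k2, chartVec]

lemma cv_ne_zero (b : Bool) (a : ℂ × ℂ) : cv b a ≠ 0 := by
  rw [cv_eq]
  exact chartVec_ne_zero _ _

/-- The chart `0` or `2`. -/
def ch (b : Bool) (a : ℂ × ℂ) : F2 := chart (cnum b) a

lemma ch_val (b : Bool) (a : ℂ × ℂ) :
    (ch b a).1 = Projectivization.mk ℂ (cv b a) (cv_ne_zero b a) := by
  cases b <;> rfl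

/-- The divided difference of the homogeneous coordinates between `c` and `a`, as a linear map
applied to the direction `d`. -/
def slope : Bool → ℂ × ℂ → ℂ × ℂ → ℂ × ℂ → Fin 6 → ℂ
  | false, c, a, d => ![d.1 * (a.1 ^ 2 + a.1 * c.1 + c.1 ^ 2), d.1 * (a.1 + c.1), d.1, 0,
      d.1 * a.2 + c.1 * d.2, d.2]
  | true, c, a, d => ![0, d.1, d.1 * (a.1 + c.1), d.1 * (a.1 ^ 2 + a.1 * c.1 + c.1 ^ 2),
      d.2, d.1 * a.2 + c.1 * d.2]

/-- The wedge product spanned by the point `c` and the direction `d`, scaled so that it does not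
vanish as `a` tends to `c`. -/
def secant (b : Bool) (c a d : ℂ × ℂ) : Fin 6 × Fin 6 → ℂ := wedge (slope b c a d) (cv b c)

/-- The displacement factors out exactly, not merely to first order, and `slope` is linear in its
last argument; this makes the limit a → c accessible. -/
lemma cv_sub (b : Bool) (c a : ℂ × ℂ) : cv b a = cv b c + slope b c a (a - c) := by
  cases b
  all_goals
    funext k
    fin_cases k <;> simp [cv, slope, chartVec] <;> ring

lemma slope_k0 (b : Bool) (c a d : ℂ × ℂ) : slope b c a d (k0 b) = 0 := by
  cases b <;> simp [slope, k0]

lemma slope_k1 (b : Bool) (c a d : ℂ × ℂ) : slope b c a d (k1 b) = d.1 := by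
  cases b <;> simp [slope, k1]

lemma slope_k2 (b : Bool) (c a d : ℂ × ℂ) : slope b c a d (k2 b) = d.2 := by
  cases b <;> simp [slope, k2]

lemma slope_smul (b : Bool) (c a d : ℂ × ℂ) (s : ℂ) :
    slope b c a (s • d) = s • slope b c a d := by
  cases b
  all_goals
    funext k
    fin_cases k <;> simp [slope] <;> ring

lemma wedge_cv (b : Bool) (c a : ℂ × ℂ) : wedge (cv b a) (cv b c) = secant b c a (a - c) := by
  funext k
  simp only [secant, wedge, cv_sub b c a, Pi.add_apply]
  ring

lemma secant_smul (b : Bool) (c a d : ℂ × ℂ) (s : ℂ) :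
    secant b c a (s • d) = s • secant b c a d := by
  funext k
  simp only [secant, wedge, slope_smul, Pi.smul_apply, smul_eq_mul]
  ring

lemma secant_fst (b : Bool) (c a d : ℂ × ℂ) : secant b c a d (k1 b, k0 b) = d.1 := by
  simp [secant, wedge, slope_k0, slope_k1, cv_k0]

lemma secant_snd (b : Bool) (c a d : ℂ × ℂ) : secant b c a d (k2 b, k0 b) = d.2 := by
  simp [secant, wedge, slope_k0, slope_k2, cv_k0]

/-- Two of the minors taken against the coordinate equal to 1 give back d, so no direction
degenerates, even for a = c. -/
lemma secant_ne_zero (b : Bool) (c a : ℂ × ℂ) {d : ℂ × ℂ} (hd : d ≠ 0) :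
    secant b c a d ≠ 0 := by
  intro h
  refine hd (Prod.ext ?_ ?_)
  · rw [← secant_fst b c a d, h]; rfl
  · rw [← secant_snd b c a d, h]; rfl

/-- The coordinates of a point in a chart. -/
def crd (b : Bool) (x : F2) : ℂ × ℂ := (ratio (k1 b) (k0 b) x.1, ratio (k2 b) (k0 b) x.1)

/-- The domain of a chart. -/
def InCh (b : Bool) (x : F2) : Prop := x.1.rep (k0 b) ≠ 0

lemma crd_ch (b : Bool) (a : ℂ × ℂ) : crd b (ch b a) = a := by
  simp [crd, ch_val, ratio_mk, cv_k0, cv_k1, cv_k2]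

lemma ch_injective (b : Bool) : Function.Injective (ch b) :=
  Function.LeftInverse.injective (crd_ch b)

lemma inCh_ch (b : Bool) (a : ℂ × ℂ) : InCh b (ch b a) := by
  rw [InCh, ch_val, rep_mk_ne_zero_iff, cv_k0]
  exact one_ne_zero

/-- The chart domain is the locus where a single homogeneous coordinate is nonzero: whichever
standard chart the point comes from, dividing by that coordinate brings it to the shape of `cv b`.
-/
lemma ch_crd {b : Bool} {x : F2} (hx : InCh b x) : ch b (crd b x) = x := by
  obtain ⟨i, a, h⟩ := x.2
  suffices h' : ∃ a', x = ch b a' by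
    obtain ⟨a', rfl⟩ := h'
    rw [crd_ch]
  rw [InCh, h, rep_mk_ne_zero_iff] at hx
  have hx' : x = chart i a := Subtype.ext h
  obtain ⟨u, v⟩ := a
  cases b
  · refine ⟨((chartVec i (u, v) 2) / (chartVec i (u, v) 3),
      (chartVec i (u, v) 5) / (chartVec i (u, v) 3)), ?_⟩
    rw [hx']
    refine Subtype.ext (mk_eq_of_smul _ _ (chartVec i (u, v) 3) (funext fun k => ?_))
    fin_cases i
    all_goals
      simp only [k0] at hx
      simp [chartVec] at hx
      try obtain ⟨hu, hv⟩ := hx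
      fin_cases k <;> simp [chartVec, cnum] <;> field_simp
  · refine ⟨((chartVec i (u, v) 1) / (chartVec i (u, v) 0),
      (chartVec i (u, v) 4) / (chartVec i (u, v) 0)), ?_⟩
    rw [hx']
    refine Subtype.ext (mk_eq_of_smul _ _ (chartVec i (u, v) 0) (funext fun k => ?_))
    fin_cases i
    all_goals
      simp only [k0] at hx
      simp [chartVec] at hx
      try obtain ⟨hu, hv⟩ := hx
      fin_cases k <;> simp [chartVec, cnum] <;> field_simp

lemma isOpen_inCh (b : Bool) : IsOpen {x : F2 | InCh b x} :=
  (isOpen_rep_ne_zero (k0 b)).preimage continuous_subtype_val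

lemma continuousAt_crd {b : Bool} {x : F2} (hx : InCh b x) : ContinuousAt (crd b) x :=
  ((continuousAt_ratio (k1 b) hx).comp continuousAt_subtype_val).prodMk
    ((continuousAt_ratio (k2 b) hx).comp continuousAt_subtype_val)

lemma differentiable_cv (b : Bool) : Differentiable ℂ (cv b) := by
  refine differentiable_pi.2 fun k => ?_
  cases b
  all_goals fin_cases k <;> simp [cv, chartVec]

lemma continuous_cv (b : Bool) : Continuous (cv b) := (differentiable_cv b).continuous

lemma continuous_ch (b : Bool) : Continuous (ch b) := by
  refine Continuous.subtype_mk ?_ _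
  have h : Continuous fun a => (⟨cv b a, cv_ne_zero b a⟩ : {v : Fin 6 → ℂ // v ≠ 0}) :=
    (continuous_cv b).subtype_mk _
  convert isQuotientMap_mk'.continuous.comp h using 2
  exact ch_val b _

lemma differentiable_slope (b : Bool) :
    Differentiable ℂ fun z : (ℂ × ℂ) × (ℂ × ℂ) × (ℂ × ℂ) => slope b z.1 z.2.1 z.2.2 := by
  refine differentiable_pi.2 fun k => ?_
  cases b
  all_goals fin_cases k <;> simp [slope] <;> fun_prop

lemma differentiable_wedge :
    Differentiable ℂ fun z : (Fin 6 → ℂ) × (Fin 6 → ℂ) => wedge z.1 z.2 := by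
  refine differentiable_pi.2 fun k => ?_
  unfold wedge
  fun_prop

lemma differentiable_secant (b : Bool) :
    Differentiable ℂ fun z : (ℂ × ℂ) × (ℂ × ℂ) × (ℂ × ℂ) => secant b z.1 z.2.1 z.2.2 :=
  differentiable_wedge.comp ((differentiable_slope b).prodMk
    ((differentiable_cv b).comp differentiable_fst))

/-! ### Lines -/

lemma wedge_smul_smul (r s : ℂ) (v w : Fin 6 → ℂ) :
    wedge (r • v) (s • w) = (r * s) • wedge v w := by
  funext k
  simp only [wedge, Pi.smul_apply, smul_eq_mul]
  ring

lemma isLineThrough_mk {v w : Fin 6 → ℂ} (hv : v ≠ 0) (hw : w ≠ 0) {ℓ : PLines} :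
    IsLineThrough (Projectivization.mk ℂ v hv) (Projectivization.mk ℂ w hw) ℓ ↔
      ∃ h : wedge v w ≠ 0, ℓ = Projectivization.mk ℂ (wedge v w) h := by
  obtain ⟨r, hr, h1⟩ := exists_rep_mk v hv
  obtain ⟨s, hs, h2⟩ := exists_rep_mk w hw
  rw [IsLineThrough]
  have h3 := wedge_smul_smul r s v w
  rw [← h1, ← h2] at h3
  have hrs : r * s ≠ 0 := mul_ne_zero hr hs
  constructor
  · rintro ⟨h, rfl⟩
    have h' : wedge v w ≠ 0 := fun h' => h (by rw [h3, h', smul_zero])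
    exact ⟨h', mk_eq_of_smul _ _ _ h3⟩
  · rintro ⟨h, rfl⟩
    have h' : wedge (Projectivization.mk ℂ v hv).rep (Projectivization.mk ℂ w hw).rep ≠ 0 := by
      rw [h3]; exact smul_ne_zero hrs h
    exact ⟨h', (mk_eq_of_smul _ _ _ h3).symm⟩

lemma wedge_eq_zero_iff {v w : Fin 6 → ℂ} (hv : v ≠ 0) (hw : w ≠ 0) :
    wedge v w = 0 ↔ Projectivization.mk ℂ v hv = Projectivization.mk ℂ w hw := by
  constructor
  · intro h
    obtain ⟨a, ha, h1⟩ := exists_rep_mk v hv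
    refine eq_mk_of_rep_mul hw fun i j => ?_
    have := congrFun h (i, j)
    simp only [wedge, Pi.zero_apply] at this
    simp only [h1, Pi.smul_apply, smul_eq_mul]
    linear_combination a * this
  · intro h
    obtain ⟨a, rfl⟩ := (Projectivization.mk_eq_mk_iff' ℂ _ _ _ _).1 h
    funext k
    simp only [wedge, Pi.smul_apply, smul_eq_mul, Pi.zero_apply]
    ring

lemma wedge_rep_ne_zero_iff {x p : P5} : wedge x.rep p.rep ≠ 0 ↔ x ≠ p := by
  rw [Ne, wedge_eq_zero_iff x.rep_nonzero p.rep_nonzero, x.mk_rep, p.mk_rep]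

lemma IsLineThrough.ne {x p : P5} {ℓ : PLines} (h : IsLineThrough x p ℓ) : x ≠ p :=
  wedge_rep_ne_zero_iff.1 h.1

/-- Two points of a common chart and the line through them. -/
lemma isLineThrough_ch {b : Bool} {a c : ℂ × ℂ} {ℓ : PLines}
    (h : IsLineThrough (ch b a).1 (ch b c).1 ℓ) :
    ∃ h : secant b c a (a - c) ≠ 0, ℓ = Projectivization.mk ℂ (secant b c a (a - c)) h := by
  rw [ch_val, ch_val, isLineThrough_mk] at h
  obtain ⟨h, e⟩ := h
  simp only [wedge_cv] at h e
  exact ⟨h, e⟩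

lemma isLineThrough_secant {b : Bool} {c d : ℂ × ℂ} {s : ℂ} (hs : s ≠ 0) (hd : d ≠ 0) :
    IsLineThrough (ch b (c + s • d)).1 (ch b c).1
      (Projectivization.mk ℂ (secant b c (c + s • d) d) (secant_ne_zero _ _ _ hd)) := by
  have e : wedge (cv b (c + s • d)) (cv b c) = s • secant b c (c + s • d) d := by
    rw [wedge_cv, add_sub_cancel_left, secant_smul]
  rw [ch_val, ch_val, isLineThrough_mk]
  have h : wedge (cv b (c + s • d)) (cv b c) ≠ 0 := by
    rw [e]
    exact smul_ne_zero hs (secant_ne_zero _ _ _ hd)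
  exact ⟨h, (mk_eq_of_smul _ _ _ e).symm⟩

/-! ### Linear equations of the curves -/

lemma exists_chart (x : F2) :
    ∃ (i : Fin 4) (u v r : ℂ), r ≠ 0 ∧ x = chart i (u, v) ∧ x.1.rep = r • chartVec i (u, v) := by
  obtain ⟨i, ⟨u, v⟩, h⟩ := x.2
  obtain ⟨r, hr, h'⟩ := exists_rep_mk _ (chartVec_ne_zero i (u, v))
  exact ⟨i, u, v, r, hr, Subtype.ext h, by rw [← h', h]⟩

lemma rep_chart (i : Fin 4) (a : ℂ × ℂ) :
    ∃ r : ℂ, r ≠ 0 ∧ (chart i a).1.rep = r • chartVec i a :=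
  exists_rep_mk _ (chartVec_ne_zero i a)

lemma chart_three_eq_one {u : ℂ} (v : ℂ) (hu : u ≠ 0) :
    chart 3 (u, v) = chart 1 (1 / u, u ^ 2 * v) := by
  refine Subtype.ext (mk_eq_of_smul _ _ u (funext fun k => ?_))
  fin_cases k <;> simp [chartVec, hu] <;> field_simp

lemma chart_two_eq_three (u : ℂ) {v : ℂ} (hv : v ≠ 0) :
    chart 2 (u, v) = chart 3 (u, 1 / v) := by
  refine Subtype.ext (mk_eq_of_smul _ _ v (funext fun k => ?_))
  fin_cases k <;> simp [chartVec] <;> field_simp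

lemma chart_two_eq_zero {u : ℂ} (v : ℂ) (hu : u ≠ 0) :
    chart 2 (u, v) = chart 0 (1 / u, v / u ^ 2) := by
  refine Subtype.ext (mk_eq_of_smul _ _ (u ^ 3) (funext fun k => ?_))
  fin_cases k <;> simp [chartVec] <;> field_simp

/-- In ℙ⁵ the curves ℋ, 𝒟_c, 𝒟_∞ and 𝒞(q) are linear sections of the scroll. This treats all charts
at once and reduces closedness to `isClosed_linear`; for ℋ and 𝒟_c it also gives Zariski closedness.
-/
lemma mem_lineH_iff {x : F2} : x ∈ lineH ↔ x.1.rep 0 = 0 ∧ x.1.rep 3 = 0 := by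
  constructor
  · rintro (⟨⟨u, v⟩, hv, rfl⟩ | ⟨⟨u, v⟩, hv, rfl⟩)
    all_goals
      obtain ⟨r, hr, h⟩ := rep_chart _ (u, v)
      simp only [Set.mem_ofPred_eq] at hv
      rw [h]
      simp [chartVec, hv]
  · obtain ⟨i, u, v, r, hr, hx, h⟩ := exists_chart x
    rw [h, hx]
    fin_cases i <;> simp [chartVec, hr]
    · intro _ hv
      exact Or.inl ⟨(u, v), hv, rfl⟩
    · intro hv _
      exact Or.inr ⟨(u, v), hv, rfl⟩

lemma mem_lineD_iff {c : ℂ} {x : F2} : x ∈ lineD c ↔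
    x.1.rep 0 = c * x.1.rep 1 ∧ x.1.rep 1 = c * x.1.rep 2 ∧ x.1.rep 2 = c * x.1.rep 3 ∧
      x.1.rep 4 = c * x.1.rep 5 := by
  constructor
  · rintro (⟨⟨u, v⟩, hv, rfl⟩ | ⟨⟨u, v⟩, hv, rfl⟩)
    all_goals
      obtain ⟨r, hr, h⟩ := rep_chart _ (u, v)
      simp only [Set.mem_ofPred_eq] at hv
      subst hv
      rw [h]
      simp [chartVec]
      refine ⟨?_, ?_, ?_, ?_⟩ <;> ring
  · obtain ⟨i, u, v, r, hr, hx, h⟩ := exists_chart x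
    rw [h, hx]
    rintro ⟨e0, e1, e2, e3⟩
    fin_cases i <;> simp [chartVec] at e0 e1 e2 e3 ⊢
    · have : u = c := mul_left_cancel₀ hr (by linear_combination e2)
      exact Or.inl ⟨(u, v), this, rfl⟩
    · have : u = c := mul_left_cancel₀ hr (by linear_combination e3)
      exact Or.inr ⟨(u, v), this, rfl⟩
    · have e : 1 = c * u := mul_left_cancel₀ hr (by linear_combination e0)
      have hu : u ≠ 0 := by rintro rfl; simp at e
      rw [chart_two_eq_zero v hu]
      refine Or.inl ⟨_, ?_, rfl⟩
      simp only [Set.mem_ofPred_eq]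
      field_simp
      linear_combination e
    · have e : 1 = c * u := mul_left_cancel₀ hr (by linear_combination e3)
      have hu : u ≠ 0 := by rintro rfl; simp at e
      rw [chart_three_eq_one v hu]
      refine Or.inr ⟨_, ?_, rfl⟩
      simp only [Set.mem_ofPred_eq]
      field_simp
      linear_combination e

lemma mem_lineDinf_iff {x : F2} : x ∈ lineDinf ↔
    x.1.rep 1 = 0 ∧ x.1.rep 2 = 0 ∧ x.1.rep 3 = 0 ∧ x.1.rep 5 = 0 := by
  constructor
  · rintro (⟨⟨u, v⟩, hv, rfl⟩ | ⟨⟨u, v⟩, hv, rfl⟩)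
    all_goals
      obtain ⟨r, hr, h⟩ := rep_chart _ (u, v)
      simp only [Set.mem_ofPred_eq] at hv
      subst hv
      rw [h]
      simp [chartVec]
  · obtain ⟨i, u, v, r, hr, hx, h⟩ := exists_chart x
    rw [h, hx]
    rintro ⟨e0, e1, e2, e3⟩
    fin_cases i <;> simp [chartVec, hr] at e0 e1 e2 e3 ⊢
    · exact Or.inl ⟨(u, v), e0, rfl⟩
    · exact Or.inr ⟨(u, v), e3, rfl⟩

/-- Both linear forms are multiples of the one affine equation. Two are needed: the first alone also
vanishes on 𝒟_0, the second alone on 𝒟_∞. -/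
lemma mem_curveC_iff {q t : ℂ} {x : F2} : x ∈ curveC q t ↔
    x.1.rep 0 - (1 + t) * x.1.rep 1 + t * x.1.rep 2 = (1 - q) * x.1.rep 4 ∧
    x.1.rep 1 - (1 + t) * x.1.rep 2 + t * x.1.rep 3 = (1 - q) * x.1.rep 5 := by
  constructor
  · rintro ((⟨⟨u, v⟩, hv, rfl⟩ | ⟨⟨u, v⟩, hv, rfl⟩) | ⟨⟨u, v⟩, hv, rfl⟩)
    all_goals
      obtain ⟨r, hr, h⟩ := rep_chart _ (u, v)
      simp only [Set.mem_ofPred_eq] at hv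
      rw [h]
      simp [chartVec]
    · exact ⟨by linear_combination r * u * hv, by linear_combination r * hv⟩
    · exact ⟨by linear_combination r * u * hv, by linear_combination r * hv⟩
    · exact ⟨by linear_combination r * hv, by linear_combination r * u * hv⟩
  · obtain ⟨i, u, v, r, hr, hx, h⟩ := exists_chart x
    rw [h, hx]
    rintro ⟨e0, e1⟩
    fin_cases i <;> simp [chartVec] at e0 e1 ⊢
    · exact Or.inl (Or.inl ⟨(u, v), mul_left_cancel₀ hr (by linear_combination e1), rfl⟩)
    · exact Or.inl (Or.inr ⟨(u, v), mul_left_cancel₀ hr (by linear_combination e1), rfl⟩)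
    · have e : 1 - (1 + t) * u + t * u ^ 2 = (1 - q) * v :=
        mul_left_cancel₀ hr (by linear_combination e0)
      by_cases hu : u = 0
      -- The curve is defined without a piece in chart 2; at u = 0 its equation forces v ≠ 0, so the
      -- point is visible in chart 3.
      · have hv : v ≠ 0 := by rintro rfl; simp [hu] at e
        rw [chart_two_eq_three u hv]
        refine Or.inr ⟨_, ?_, rfl⟩
        simp only [Set.mem_ofPred_eq]
        field_simp
        linear_combination e
      · rw [chart_two_eq_zero v hu]
        refine Or.inl (Or.inl ⟨_, ?_, rfl⟩)
        simp only [Set.mem_ofPred_eq]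
        field_simp
        linear_combination e
    · exact Or.inr ⟨(u, v), mul_left_cancel₀ hr (by linear_combination e0), rfl⟩

lemma isClosed_linear_F2 (α : ℂ → Fin 6 → ℂ) (hα : ∀ k, Continuous fun q => α q k) :
    IsClosed {z : ℂ × F2 | ∑ k, α z.1 k * z.2.1.rep k = 0} :=
  (isClosed_linear hα).preimage
    (continuous_fst.prodMk (continuous_subtype_val.comp continuous_snd))

lemma isClosed_cylinder_lineH : IsClosed (cylinder lineH) := by
  have h1 := isClosed_linear_F2 (fun _ => ![1, 0, 0, 0, 0, 0]) fun k => by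
    fin_cases k <;> simp <;> fun_prop
  have h2 := isClosed_linear_F2 (fun _ => ![0, 0, 0, 1, 0, 0]) fun k => by
    fin_cases k <;> simp <;> fun_prop
  convert h1.inter h2 using 1
  ext z
  simp [cylinder, mem_lineH_iff, Fin.sum_univ_six]

lemma isClosed_cylinder_lineD (c : ℂ) : IsClosed (cylinder (lineD c)) := by
  have h1 := isClosed_linear_F2 (fun _ => ![1, -c, 0, 0, 0, 0]) fun k => by
    fin_cases k <;> simp <;> fun_prop
  have h2 := isClosed_linear_F2 (fun _ => ![0, 1, -c, 0, 0, 0]) fun k => by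
    fin_cases k <;> simp <;> fun_prop
  have h3 := isClosed_linear_F2 (fun _ => ![0, 0, 1, -c, 0, 0]) fun k => by
    fin_cases k <;> simp <;> fun_prop
  have h4 := isClosed_linear_F2 (fun _ => ![0, 0, 0, 0, 1, -c]) fun k => by
    fin_cases k <;> simp <;> fun_prop
  convert h1.inter (h2.inter (h3.inter h4)) using 1
  ext z
  simp [cylinder, mem_lineD_iff, Fin.sum_univ_six, ← sub_eq_add_neg, sub_eq_zero]

lemma isClosed_cylinder_lineDinf : IsClosed (cylinder lineDinf) := by
  have h1 := isClosed_linear_F2 (fun _ => ![0, 1, 0, 0, 0, 0]) fun k => by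
    fin_cases k <;> simp <;> fun_prop
  have h2 := isClosed_linear_F2 (fun _ => ![0, 0, 1, 0, 0, 0]) fun k => by
    fin_cases k <;> simp <;> fun_prop
  have h3 := isClosed_linear_F2 (fun _ => ![0, 0, 0, 1, 0, 0]) fun k => by
    fin_cases k <;> simp <;> fun_prop
  have h4 := isClosed_linear_F2 (fun _ => ![0, 0, 0, 0, 0, 1]) fun k => by
    fin_cases k <;> simp <;> fun_prop
  convert h1.inter (h2.inter (h3.inter h4)) using 1
  ext z
  simp [cylinder, mem_lineDinf_iff, Fin.sum_univ_six]

lemma isClosed_surfaceC (t : ℂ) : IsClosed (surfaceC t) := by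
  have h1 := isClosed_linear_F2 (fun q => ![1, -(1 + t), t, 0, -(1 - q), 0]) fun k => by
    fin_cases k <;> simp <;> fun_prop
  have h2 := isClosed_linear_F2 (fun q => ![0, 1, -(1 + t), t, 0, -(1 - q)]) fun k => by
    fin_cases k <;> simp <;> fun_prop
  convert h1.inter h2 using 1
  ext z
  simp only [surfaceC, mem_curveC_iff, Fin.sum_univ_six, Set.mem_ofPred_eq, Set.mem_inter_iff]
  refine and_congr ?_ ?_
  all_goals
    rw [← sub_eq_zero]
    simp
    ring_nf

/-! ### Membership in the curves, read in the charts 0 and 2 -/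

lemma exists_inCh_of_notMem_lineH {x : F2} (hx : x ∉ lineH) : ∃ b, InCh b x := by
  rw [mem_lineH_iff, not_and_or] at hx
  rcases hx with h | h
  · exact ⟨true, h⟩
  · exact ⟨false, h⟩

lemma ch_notMem_lineH (b : Bool) (a : ℂ × ℂ) : ch b a ∉ lineH := by
  rw [mem_lineH_iff]
  have := inCh_ch b a
  cases b
  · exact fun h => this h.2
  · exact fun h => this h.1

lemma rep_ch (b : Bool) (a : ℂ × ℂ) : ∃ r : ℂ, r ≠ 0 ∧ (ch b a).1.rep = r • cv b a := by
  rw [ch_val]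
  exact exists_rep_mk _ _

lemma ch_false_mem_lineD_iff {c : ℂ} {a : ℂ × ℂ} : ch false a ∈ lineD c ↔ a.1 = c := by
  obtain ⟨r, hr, h⟩ := rep_ch false a
  rw [mem_lineD_iff, h]
  simp only [cv, chartVec, Pi.smul_apply, smul_eq_mul]
  simp
  constructor
  · rintro ⟨-, -, e, -⟩
    exact mul_left_cancel₀ hr (by linear_combination e)
  · rintro rfl
    refine ⟨?_, ?_, ?_, ?_⟩ <;> ring

lemma ch_true_mem_lineD_iff {c : ℂ} {a : ℂ × ℂ} : ch true a ∈ lineD c ↔ 1 = c * a.1 := by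
  obtain ⟨r, hr, h⟩ := rep_ch true a
  rw [mem_lineD_iff, h]
  simp only [cv, chartVec, Pi.smul_apply, smul_eq_mul]
  simp
  constructor
  · rintro ⟨e, -⟩
    exact mul_left_cancel₀ hr (by linear_combination e)
  · intro e
    refine ⟨?_, ?_, ?_, ?_⟩
    · linear_combination r * e
    · linear_combination r * a.1 * e
    · linear_combination r * a.1 ^ 2 * e
    · linear_combination r * a.2 * e

lemma ch_false_notMem_lineDinf (a : ℂ × ℂ) : ch false a ∉ lineDinf := by
  obtain ⟨r, hr, h⟩ := rep_ch false a
  rw [mem_lineDinf_iff, h]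
  simp [cv, chartVec, hr]

lemma ch_true_mem_lineDinf_iff {a : ℂ × ℂ} : ch true a ∈ lineDinf ↔ a.1 = 0 := by
  obtain ⟨r, hr, h⟩ := rep_ch true a
  rw [mem_lineDinf_iff, h]
  simp [cv, chartVec, hr]
  intro e
  simp [e]

lemma ch_false_mem_curveC_iff {q t : ℂ} {a : ℂ × ℂ} :
    ch false a ∈ curveC q t ↔ (a.1 - 1) * (a.1 - t) = (1 - q) * a.2 := by
  obtain ⟨r, hr, h⟩ := rep_ch false a
  rw [mem_curveC_iff, h]
  simp only [cv, chartVec, Pi.smul_apply, smul_eq_mul]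
  simp
  constructor
  · rintro ⟨-, e⟩
    exact mul_left_cancel₀ hr (by linear_combination e)
  · intro e
    exact ⟨by linear_combination r * a.1 * e, by linear_combination r * e⟩

lemma ch_true_mem_curveC_iff {q t : ℂ} {a : ℂ × ℂ} :
    ch true a ∈ curveC q t ↔ (1 - a.1) * (1 - t * a.1) = (1 - q) * a.2 := by
  obtain ⟨r, hr, h⟩ := rep_ch true a
  rw [mem_curveC_iff, h]
  simp only [cv, chartVec, Pi.smul_apply, smul_eq_mul]
  simp
  constructor
  · rintro ⟨e, -⟩
    exact mul_left_cancel₀ hr (by linear_combination e)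
  · intro e
    exact ⟨by linear_combination r * e, by linear_combination r * a.1 * e⟩

/-! ### Limits of lines through moving points -/

section Family

variable {ι : Type}

/-- The moving points `ch (b i) (c i q)`. -/
def ctr (b : ι → Bool) (c : ι → ℂ → ℂ × ℂ) (i : ι) (q : ℂ) : F2 := ch (b i) (c i q)

/-- The direction of a line through a point, read off in a chart. -/
def dirn (b : Bool) (ℓ : PLines) : ℂ × ℂ := (ℓ.rep (k1 b, k0 b), ℓ.rep (k2 b, k0 b))

variable {b : ι → Bool} {c : ι → ℂ → ℂ × ℂ}

lemma ratio_of_isLineThrough {β : Bool} {a c : ℂ × ℂ} {ℓ : PLines}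
    (h : IsLineThrough (ch β a).1 (ch β c).1 ℓ) (k : Fin 6 × Fin 6) :
    ∃ r : ℂ, (∀ j, ratio j k ℓ = r * secant β c a (a - c) j) ∧
      (ratio (k1 β, k0 β) k ℓ, ratio (k2 β, k0 β) k ℓ) = r • (a - c) := by
  obtain ⟨h, rfl⟩ := isLineThrough_ch h
  refine ⟨(secant β c a (a - c) k)⁻¹, fun j => ?_, ?_⟩
  · rw [ratio_mk]; ring
  · rw [ratio_mk, ratio_mk, secant_fst, secant_snd]
    ext <;> simp <;> ring

lemma continuousAt_snd_ratio {y : ℂ × Ambient ι} {i : ι} (j : Fin 6 × Fin 6) {k : Fin 6 × Fin 6}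
    (hk : (y.2.2 i).rep k ≠ 0) :
    ContinuousAt (fun z : ℂ × Ambient ι => ratio j k (z.2.2 i)) y :=
  ContinuousAt.comp (f := fun z : ℂ × Ambient ι => z.2.2 i) (continuousAt_ratio j hk)
    ((continuous_apply i).comp (continuous_snd.comp continuous_snd)).continuousAt

lemma continuousAt_snd_crd {y : ℂ × Ambient ι} {β : Bool} (hx : InCh β y.2.1) :
    ContinuousAt (fun z : ℂ × Ambient ι => crd β z.2.1) y :=
  ContinuousAt.comp (f := fun z : ℂ × Ambient ι => z.2.1) (continuousAt_crd hx)
    (continuous_fst.comp continuous_snd).continuousAt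

lemma eventually_inCh {y : ℂ × Ambient ι} {β : Bool} (hx : InCh β y.2.1) :
    ∀ᶠ z in 𝓝 y, InCh β z.2.1 :=
  (continuous_fst.comp continuous_snd).continuousAt.eventually ((isOpen_inCh β).mem_nhds hx)

/-- On T the line is a multiple of the secant of the displacement, and `dirn` reads that
displacement back with the same factor. The resulting identity is a closed condition, and it
survives at the centre, where the displacement itself vanishes. -/
lemma secant_of_mem_closure {T : Set (ℂ × Ambient ι)} {y : ℂ × Ambient ι} (hy : y ∈ closure T)
    {i : ι} (hT : ∀ z ∈ T, IsLineThrough z.2.1 (ctr b c i z.1) (z.2.2 i))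
    (hc : ContinuousAt (c i) y.1) (hx : InCh (b i) y.2.1) :
    (y.2.2 i).rep =
      secant (b i) (c i y.1) (crd (b i) y.2.1) (dirn (b i) (y.2.2 i)) := by
  obtain ⟨k, hk⟩ := exists_rep_ne_zero (y.2.2 i)
  have hc' : ContinuousAt (fun z : ℂ × Ambient ι => c i z.1) y :=
    ContinuousAt.comp (f := fun z : ℂ × Ambient ι => z.1) hc continuousAt_fst
  have hs : ContinuousAt (fun z : ℂ × Ambient ι => secant (b i) (c i z.1) (crd (b i) z.2.1)
      (ratio (k1 (b i), k0 (b i)) k (z.2.2 i), ratio (k2 (b i), k0 (b i)) k (z.2.2 i))) y :=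
    ContinuousAt.comp (f := fun z : ℂ × Ambient ι => (c i z.1, crd (b i) z.2.1,
      (ratio (k1 (b i), k0 (b i)) k (z.2.2 i), ratio (k2 (b i), k0 (b i)) k (z.2.2 i))))
      (differentiable_secant (b i)).continuous.continuousAt
      (hc'.prodMk ((continuousAt_snd_crd hx).prodMk
        ((continuousAt_snd_ratio _ hk).prodMk (continuousAt_snd_ratio _ hk))))
  have key : ∀ j, ratio j k (y.2.2 i) = secant (b i) (c i y.1) (crd (b i) y.2.1)
      (ratio (k1 (b i), k0 (b i)) k (y.2.2 i), ratio (k2 (b i), k0 (b i)) k (y.2.2 i)) j := by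
    intro j
    refine eq_of_mem_closure hy (continuousAt_snd_ratio j hk)
      (((continuous_apply j).continuousAt).comp hs) ?_
    filter_upwards [eventually_inCh hx] with z hz hzT
    have hl := hT z hzT
    rw [← ch_crd hz] at hl
    obtain ⟨r, h1, h2⟩ := ratio_of_isLineThrough hl k
    rw [Function.comp_apply, h1, h2, secant_smul]
    rfl
  funext j
  have e : dirn (b i) (y.2.2 i) = (y.2.2 i).rep k •
      (ratio (k1 (b i), k0 (b i)) k (y.2.2 i), ratio (k2 (b i), k0 (b i)) k (y.2.2 i)) := by
    ext <;> simp [dirn, ratio] <;> field_simp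
  rw [e, secant_smul, Pi.smul_apply, ← key j, ratio, smul_eq_mul]
  field_simp

lemma dirn_ne_zero_of_rep_eq {β : Bool} {c a : ℂ × ℂ} {ℓ : PLines}
    (h : ℓ.rep = secant β c a (dirn β ℓ)) : dirn β ℓ ≠ 0 := by
  intro h'
  refine ℓ.rep_nonzero ?_
  rw [h, h', ← zero_smul ℂ (0 : ℂ × ℂ), secant_smul, zero_smul]

lemma eq_mk_of_rep_eq {β : Bool} {c a : ℂ × ℂ} {ℓ : PLines}
    (h : ℓ.rep = secant β c a (dirn β ℓ)) :
    ℓ = Projectivization.mk ℂ (secant β c a (dirn β ℓ))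
      (secant_ne_zero _ _ _ (dirn_ne_zero_of_rep_eq h)) := by
  conv_lhs => rw [← ℓ.mk_rep]
  exact mk_eq_of_smul _ _ 1 (by rw [one_smul]; exact h)

/-- Off the centre the wedge product is nonzero and continuous in the point, so the limiting line
has to be proportional to it. The point need not lie in the chart of the centre, which is why
homogeneous coordinates replace `secant` here. -/
lemma isLineThrough_of_mem_closure {T : Set (ℂ × Ambient ι)} {y : ℂ × Ambient ι}
    (hy : y ∈ closure T) {i : ι}
    (hT : ∀ z ∈ T, IsLineThrough z.2.1 (ctr b c i z.1) (z.2.2 i))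
    (hc : ContinuousAt (c i) y.1) (hx : y.2.1 ≠ ctr b c i y.1) :
    IsLineThrough y.2.1 (ctr b c i y.1) (y.2.2 i) := by
  obtain ⟨k, hk⟩ := exists_rep_ne_zero (y.2.2 i)
  obtain ⟨m, hm⟩ := exists_rep_ne_zero y.2.1.1
  have hx' : y.2.1.1 ≠ (ctr b c i y.1).1 := fun h => hx (Subtype.ext h)
  have hw := wedge_rep_ne_zero_iff.2 hx'
  have hc' : ContinuousAt (fun z : ℂ × Ambient ι => c i z.1) y :=
    ContinuousAt.comp (f := fun z : ℂ × Ambient ι => z.1) hc continuousAt_fst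
  have hr : ContinuousAt (fun z : ℂ × Ambient ι => fun j => ratio j m z.2.1.1) y :=
    continuousAt_pi.2 fun j =>
      ContinuousAt.comp (f := fun z : ℂ × Ambient ι => z.2.1.1) (continuousAt_ratio j hm)
        (continuous_subtype_val.comp (continuous_fst.comp continuous_snd)).continuousAt
  have hv : ContinuousAt (fun z : ℂ × Ambient ι =>
      wedge (fun j => ratio j m z.2.1.1) (cv (b i) (c i z.1))) y :=
    ContinuousAt.comp (f := fun z : ℂ × Ambient ι =>
        ((fun j => ratio j m z.2.1.1), cv (b i) (c i z.1)))
      differentiable_wedge.continuous.continuousAt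
      (hr.prodMk (ContinuousAt.comp (f := fun z : ℂ × Ambient ι => c i z.1)
        (continuous_cv (b i)).continuousAt hc'))
  have hw0 : ∀ z : ℂ × Ambient ι, ∃ s : ℂ, s ≠ 0 ∧
      (ctr b c i z.1).1.rep = s • cv (b i) (c i z.1) := fun z => rep_ch _ _
  have hrat : ∀ z : ℂ × Ambient ι, (fun j => ratio j m z.2.1.1) =
      (z.2.1.1.rep m)⁻¹ • z.2.1.1.rep := fun z => by
    funext j
    simp [ratio]
    ring
  -- Proportionality is cross-multiplied, so that it is an equality of continuous functions and
  -- passes to the closure.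
  have key : ∀ j j', ratio j k (y.2.2 i) *
      wedge (fun j => ratio j m y.2.1.1) (cv (b i) (c i y.1)) j' = ratio j' k (y.2.2 i) *
      wedge (fun j => ratio j m y.2.1.1) (cv (b i) (c i y.1)) j := by
    intro j j'
    refine eq_of_mem_closure hy
      ((continuousAt_snd_ratio j hk).mul (((continuous_apply j').continuousAt).comp hv))
      ((continuousAt_snd_ratio j' hk).mul (((continuous_apply j).continuousAt).comp hv)) ?_
    refine Eventually.of_forall fun z hz => ?_
    obtain ⟨h, e⟩ := hT z hz
    obtain ⟨s, hs, hs'⟩ := hw0 z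
    simp only [Pi.mul_apply, Function.comp_apply]
    have h3 : wedge (fun j => ratio j m z.2.1.1) (cv (b i) (c i z.1)) =
        (s⁻¹ * (z.2.1.1.rep m)⁻¹) • wedge z.2.1.1.rep (ctr b c i z.1).1.rep := by
      rw [hrat z, hs', ← one_smul ℂ (cv (b i) (c i z.1)), ← mul_one (z.2.1.1.rep m)⁻¹,
        wedge_smul_smul, one_smul, ← one_smul ℂ (Projectivization.rep _), wedge_smul_smul,
        one_smul, smul_smul]
      congr 1
      field_simp
    rw [h3, e, ratio_mk, ratio_mk]
    simp only [Pi.smul_apply, smul_eq_mul]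
    ring
  obtain ⟨s, hs, hs'⟩ := hw0 y
  refine ⟨hw, eq_mk_of_rep_mul hw fun j j' => ?_⟩
  have h2 : wedge y.2.1.1.rep (ctr b c i y.1).1.rep =
      (y.2.1.1.rep m * s) • wedge (fun j => ratio j m y.2.1.1) (cv (b i) (c i y.1)) := by
    rw [hs', ← wedge_smul_smul, hrat y, smul_smul, mul_inv_cancel₀ hm, one_smul]
  have h3 := key j j'
  simp only [ratio] at h3
  rw [h2]
  simp only [Pi.smul_apply, smul_eq_mul, ratio]
  field_simp at h3
  linear_combination (y.2.1.1.rep m * s) * h3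

/-- The normalized direction is a multiple of the displacement on T, so a continuous covector g
killing the displacements kills the limiting direction. Taking for g a divided difference of the
equation of a curve confines its strict transform over a centre to the tangent direction. -/
lemma dirn_of_mem_closure {T : Set (ℂ × Ambient ι)} {y : ℂ × Ambient ι} (hy : y ∈ closure T)
    {i : ι} (hT : ∀ z ∈ T, IsLineThrough z.2.1 (ctr b c i z.1) (z.2.2 i))
    (hx : InCh (b i) y.2.1) {g : ℂ × (ℂ × ℂ) → ℂ × ℂ}
    (hg : ContinuousAt g (y.1, crd (b i) y.2.1))
    (hgT : ∀ z ∈ T, ∀ a, z.2.1 = ch (b i) a →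
      (g (z.1, a)).1 * (a - c i z.1).1 + (g (z.1, a)).2 * (a - c i z.1).2 = 0) :
    (g (y.1, crd (b i) y.2.1)).1 * (dirn (b i) (y.2.2 i)).1 +
      (g (y.1, crd (b i) y.2.1)).2 * (dirn (b i) (y.2.2 i)).2 = 0 := by
  obtain ⟨k, hk⟩ := exists_rep_ne_zero (y.2.2 i)
  have hg' : ContinuousAt (fun z : ℂ × Ambient ι => g (z.1, crd (b i) z.2.1)) y :=
    ContinuousAt.comp (f := fun z : ℂ × Ambient ι => (z.1, crd (b i) z.2.1)) hg
      (continuousAt_fst.prodMk (continuousAt_snd_crd hx))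
  have key : (g (y.1, crd (b i) y.2.1)).1 * ratio (k1 (b i), k0 (b i)) k (y.2.2 i) +
      (g (y.1, crd (b i) y.2.1)).2 * ratio (k2 (b i), k0 (b i)) k (y.2.2 i) = 0 := by
    refine eq_of_mem_closure
      (f := fun z : ℂ × Ambient ι =>
        (g (z.1, crd (b i) z.2.1)).1 * ratio (k1 (b i), k0 (b i)) k (z.2.2 i) +
        (g (z.1, crd (b i) z.2.1)).2 * ratio (k2 (b i), k0 (b i)) k (z.2.2 i))
      (g := fun _ => (0 : ℂ)) hy
      ((hg'.fst.mul (continuousAt_snd_ratio _ hk)).add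
        (hg'.snd.mul (continuousAt_snd_ratio _ hk))) continuousAt_const ?_
    filter_upwards [eventually_inCh hx] with z hz hzT
    have hl := hT z hzT
    rw [← ch_crd hz] at hl
    obtain ⟨r, -, h2⟩ := ratio_of_isLineThrough hl k
    have h3 := hgT z hzT _ (ch_crd hz).symm
    rw [Prod.ext_iff] at h2
    simp only [Prod.smul_fst, Prod.smul_snd, smul_eq_mul] at h2
    rw [h2.1, h2.2]
    linear_combination r * h3
  simp only [ratio] at key
  field_simp at key
  simpa [dirn] using key

end Family

/-! ### Approximation of points of an exceptional curve -/

lemma isLineThrough_ch_rep {β : Bool} {a : ℂ × ℂ} {p : P5} (h : wedge (cv β a) p.rep ≠ 0) :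
    IsLineThrough (ch β a).1 p (Projectivization.mk ℂ (wedge (cv β a) p.rep) h) := by
  have := (isLineThrough_mk (cv_ne_zero β a) p.rep_nonzero
    (ℓ := Projectivization.mk ℂ (wedge (cv β a) p.rep) h)).2 ⟨h, rfl⟩
  rwa [p.mk_rep, ← ch_val] at this

lemma eq_of_isLineThrough_ch {β : Bool} {a : ℂ × ℂ} {p : P5} {ℓ : PLines}
    (h : IsLineThrough (ch β a).1 p ℓ) : ∃ h : wedge (cv β a) p.rep ≠ 0,
      ℓ = Projectivization.mk ℂ (wedge (cv β a) p.rep) h := by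
  have h' := h
  rw [ch_val, ← p.mk_rep, isLineThrough_mk] at h'
  exact h'

/-- The arc c + s E(s) leaves the centre in the direction d inside S. The line from the centre to it
is the class of the secant of E(s), continuous at s = 0 with the prescribed value, and the lines to
the other centres vary continuously. A variable E is needed when S is curved. -/
lemma mem_closure_lines {ι : Type} [Finite ι] {p : ι → F2} {S : Set F2} {y : Ambient ι} {i : ι} {β : Bool}
    {c d : ℂ × ℂ} (hp : p i = ch β c) (hy : y.1 = p i) (hd : d ≠ 0)
    (hl : y.2 i = Projectivization.mk ℂ (secant β c c d) (secant_ne_zero β c c hd))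
    (hk : ∀ k, k ≠ i → IsLineThrough y.1 (p k) (y.2 k)) {E : ℂ → ℂ × ℂ}
    (hE : ContinuousAt E 0) (hE0 : E 0 = d) (hS : ∀ s, s ≠ 0 → ch β (c + s • E s) ∈ S) :
    y ∈ closure {z : Ambient ι | z.1 ∈ S ∧ ∀ k, IsLineThrough z.1 (p k) (z.2 k)} := by
  classical
  set A : ℂ → ℂ × ℂ := fun s => c + s • E s with hA
  have hA0 : A 0 = c := by simp [hA]
  have hAc : ContinuousAt A 0 := continuousAt_const.add (continuousAt_id.smul hE)
  have hy1 : y.1 = ch β c := hy.trans hp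
  set N : ℂ → Fin 6 × Fin 6 → ℂ := fun s => secant β c (A s) (E s) with hN
  have hNc : ContinuousAt N 0 :=
    ContinuousAt.comp (f := fun s => (c, A s, E s))
      (differentiable_secant β).continuous.continuousAt
      (continuousAt_const.prodMk (hAc.prodMk hE))
  have hN0 : N 0 = secant β c c d := by rw [hN]; simp only [hA0, hE0]
  set M : ι → ℂ → Fin 6 × Fin 6 → ℂ := fun k s => wedge (cv β (A s)) (p k).1.rep with hM
  have hMc : ∀ k, ContinuousAt (M k) 0 := fun k =>
    ContinuousAt.comp (f := fun s => (cv β (A s), (p k).1.rep))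
      differentiable_wedge.continuous.continuousAt
      ((ContinuousAt.comp (f := A) (continuous_cv β).continuousAt hAc).prodMk continuousAt_const)
  have hM0 : ∀ k, k ≠ i → ∃ h : M k 0 ≠ 0, y.2 k = Projectivization.mk ℂ (M k 0) h := by
    intro k hki
    have := hk k hki
    rw [hy1, ← hA0] at this
    exact eq_of_isLineThrough_ch this
  -- The default values only make the arc a total function; none is taken for s near 0.
  set γ : ℂ → Ambient ι := fun s => (ch β (A s), fun k =>
    if k = i then classOr (y.2 i) (N s) else classOr (y.2 k) (M k s)) with hγ
  have hγ0 : γ 0 = y := by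
    refine Prod.ext (by rw [hγ]; simp only [hA0, hy1]) (funext fun k => ?_)
    by_cases hki : k = i
    · subst hki
      simp only [hγ, if_true, hl, hN0]
      exact classOr_of_ne _ _
    · obtain ⟨h, e⟩ := hM0 k hki
      simp only [hγ, if_neg hki]
      rw [e, classOr_of_ne _ h]
  have hγc : ContinuousAt γ 0 := by
    refine (ContinuousAt.comp (f := A) (continuous_ch β).continuousAt hAc).prodMk
      (continuousAt_pi.2 fun k => ?_)
    by_cases hki : k = i
    · simp only [if_pos hki]
      refine ContinuousAt.comp (f := N) (continuousAt_classOr _ ?_) hNc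
      rw [hN0]
      exact secant_ne_zero β c c hd
    · simp only [if_neg hki]
      exact ContinuousAt.comp (f := M k) (continuousAt_classOr _ (hM0 k hki).1) (hMc k)
  rw [← hγ0]
  refine mem_closure_of_tendsto (hγc.tendsto.mono_left (nhdsWithin_le_nhds (s := {0}ᶜ))) ?_
  have h1 : ∀ᶠ s in 𝓝[≠] (0 : ℂ), E s ≠ 0 :=
    (hE.eventually_ne (by rwa [hE0])).filter_mono nhdsWithin_le_nhds
  have h2 : ∀ᶠ s in 𝓝[≠] (0 : ℂ), ∀ k, k ≠ i → M k s ≠ 0 := by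
    refine (eventually_all.2 fun k => ?_).filter_mono nhdsWithin_le_nhds
    by_cases hki : k = i
    · simp [hki]
    · exact ((hMc k).eventually_ne (hM0 k hki).1).mono fun s hs _ => hs
  filter_upwards [h1, h2, self_mem_nhdsWithin] with s hs1 hs2 hs0
  refine ⟨hS s hs0, fun k => ?_⟩
  by_cases hki : k = i
  · subst hki
    simp only [hγ, if_true, hp]
    rw [classOr_of_ne _ (secant_ne_zero β c (A s) hs1)]
    exact isLineThrough_secant hs0 hs1
  · simp only [hγ, if_neg hki]
    rw [classOr_of_ne _ (hs2 k hki)]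
    exact isLineThrough_ch_rep (hs2 k hki)

/-! ### Fibres of blow-ups and of strict transforms -/

section Fibre

variable {ι : Type} {B : Set ℂ} {b : ι → Bool} {c : ι → ℂ → ℂ × ℂ}

lemma IsLineThrough.ne_coe {x p : F2} {ℓ : PLines} (h : IsLineThrough x.1 p.1 ℓ) : x ≠ p :=
  fun e => h.ne (congrArg _ e)

lemma isLineThrough_of_mem_blowupCurves (hc : ∀ i, ∀ q ∈ B, ContinuousAt (c i) q)
    {y : ℂ × Ambient ι} (hy : y ∈ blowupCurves B (ctr b c)) {i : ι}
    (hx : y.2.1 ≠ ctr b c i y.1) : IsLineThrough y.2.1 (ctr b c i y.1) (y.2.2 i) :=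
  isLineThrough_of_mem_closure hy.2 (fun _ hz => hz.2 i) (hc i _ hy.1) hx

lemma rep_eq_of_mem_blowupCurves (hc : ∀ i, ∀ q ∈ B, ContinuousAt (c i) q)
    {y : ℂ × Ambient ι} (hy : y ∈ blowupCurves B (ctr b c)) {i : ι}
    (hx : InCh (b i) y.2.1) : (y.2.2 i).rep =
      secant (b i) (c i y.1) (crd (b i) y.2.1) (dirn (b i) (y.2.2 i)) :=
  secant_of_mem_closure hy.2 (fun _ hz => hz.2 i) (hc i _ hy.1) hx

lemma inCh_ctr {x : F2} {i : ι} {q : ℂ} (h : x = ctr b c i q) : InCh (b i) x := by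
  rw [h]
  exact inCh_ch _ _

lemma eq_mk_of_mem_blowupCurves (hc : ∀ i, ∀ q ∈ B, ContinuousAt (c i) q)
    {y : ℂ × Ambient ι} (hy : y ∈ blowupCurves B (ctr b c)) {i : ι}
    (hx : y.2.1 = ctr b c i y.1) : ∃ hd : dirn (b i) (y.2.2 i) ≠ 0, y.2.2 i =
      Projectivization.mk ℂ (secant (b i) (c i y.1) (c i y.1) (dirn (b i) (y.2.2 i)))
        (secant_ne_zero _ _ _ hd) := by
  have h := rep_eq_of_mem_blowupCurves hc hy (inCh_ctr hx)
  have e : crd (b i) y.2.1 = c i y.1 := by rw [hx, ctr, crd_ch]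
  rw [e] at h
  exact ⟨dirn_ne_zero_of_rep_eq h, eq_mk_of_rep_eq h⟩

lemma blowupPoints_subset_fibre {p : ι → ℂ → F2} {q : ℂ} (hq : q ∈ B) :
    blowupPoints (fun i => p i q) ⊆ fibre (blowupCurves B p) q := by
  intro y hy
  refine ⟨hq, map_mem_closure (f := fun y : Ambient ι => (q, y))
    (continuous_const.prodMk continuous_id) hy fun z hz => ?_⟩
  exact ⟨hq, hz⟩

lemma strictPoints_subset_fibre {p : ι → ℂ → F2} {q : ℂ} (hq : q ∈ B) {S : Set F2}
    {S' : Set (ℂ × F2)} (hS : ∀ x ∈ S, (q, x) ∈ S') :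
    strictPoints (fun i => p i q) S ⊆ fibre (strictCurves B p S') q := by
  intro y hy
  refine ⟨hq, map_mem_closure (f := fun y : Ambient ι => (q, y))
    (continuous_const.prodMk continuous_id) hy fun z hz => ?_⟩
  exact ⟨blowupPoints_subset_fibre hq hz.1, hS _ hz.2.1, hz.2.2⟩

lemma strictCurves_subset_blowupCurves {p : ι → ℂ → F2} {S : Set (ℂ × F2)} :
    strictCurves B p S ⊆ blowupCurves B p := fun _ hy =>
  ⟨hy.1, closure_minimal (fun _ hz => hz.1.2) isClosed_closure hy.2⟩

lemma mem_of_mem_strictCurves {p : ι → ℂ → F2} {S : Set (ℂ × F2)} (hS : IsClosed S)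
    {y : ℂ × Ambient ι} (hy : y ∈ strictCurves B p S) : (y.1, y.2.1) ∈ S := by
  have h : IsClosed {z : ℂ × Ambient ι | (z.1, z.2.1) ∈ S} :=
    hS.preimage (continuous_fst.prodMk (continuous_fst.comp continuous_snd))
  exact closure_minimal (fun _ hz => hz.2.1) h hy.2

lemma dirn_of_mem_strictCurves (hc : ∀ i, ∀ q ∈ B, ContinuousAt (c i) q) {S : Set (ℂ × F2)}
    {y : ℂ × Ambient ι} (hy : y ∈ strictCurves B (ctr b c) S) {i : ι}
    (hx : y.2.1 = ctr b c i y.1) {g : ℂ × (ℂ × ℂ) → ℂ × ℂ}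
    (hg : ContinuousAt g (y.1, c i y.1))
    (hgS : ∀ q ∈ B, ∀ a, (q, ch (b i) a) ∈ S →
      (g (q, a)).1 * (a - c i q).1 + (g (q, a)).2 * (a - c i q).2 = 0) :
    (g (y.1, c i y.1)).1 * (dirn (b i) (y.2.2 i)).1 +
      (g (y.1, c i y.1)).2 * (dirn (b i) (y.2.2 i)).2 = 0 := by
  have e : crd (b i) y.2.1 = c i y.1 := by rw [hx, ctr, crd_ch]
  rw [← e] at hg ⊢
  refine dirn_of_mem_closure (c := c) hy.2 (fun z hz => ?_) (inCh_ctr hx) hg fun z hz a ha => ?_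
  · exact isLineThrough_of_mem_blowupCurves hc hz.1 (hz.2.2 i)
  · exact hgS z.1 hz.1.1 a (by rw [← ha]; exact hz.2.1)

lemma mem_blowupPoints_of_ne (hc : ∀ i, ∀ q ∈ B, ContinuousAt (c i) q) {q : ℂ}
    {y : Ambient ι} (hy : y ∈ fibre (blowupCurves B (ctr b c)) q)
    (hx : ∀ i, y.1 ≠ ctr b c i q) : y ∈ blowupPoints fun i => ctr b c i q :=
  subset_closure fun i => isLineThrough_of_mem_blowupCurves hc hy (hx i)

lemma mem_strictPoints_of_ne (hc : ∀ i, ∀ q ∈ B, ContinuousAt (c i) q) {q : ℂ}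
    {y : Ambient ι} (hy : y ∈ fibre (blowupCurves B (ctr b c)) q)
    (hx : ∀ i, y.1 ≠ ctr b c i q) {S : Set F2} (hS : y.1 ∈ S) :
    y ∈ strictPoints (fun i => ctr b c i q) S :=
  subset_closure ⟨mem_blowupPoints_of_ne hc hy hx, hS, hx⟩

variable [Finite ι]

lemma mem_closure_of_eq_ctr (hc : ∀ i, ∀ q ∈ B, ContinuousAt (c i) q) {q : ℂ}
    (hinj : Function.Injective fun i => ctr b c i q)
    {y : Ambient ι} (hy : y ∈ fibre (blowupCurves B (ctr b c)) q) {i : ι}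
    (hx : y.1 = ctr b c i q) {S : Set F2} {E : ℂ → ℂ × ℂ} (hE : ContinuousAt E 0)
    (hE0 : E 0 = dirn (b i) (y.2 i)) (hS : ∀ s, s ≠ 0 → ch (b i) (c i q + s • E s) ∈ S) :
    y ∈ closure {z : Ambient ι |
      z.1 ∈ S ∧ ∀ k, IsLineThrough z.1 (ctr b c k q) (z.2 k)} := by
  obtain ⟨hd, hl⟩ := eq_mk_of_mem_blowupCurves hc hy hx
  refine mem_closure_lines (p := fun i => ctr b c i q) rfl hx hd hl (fun k hk => ?_) hE hE0 hS
  refine isLineThrough_of_mem_blowupCurves hc hy fun h => hk (hinj ?_)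
  exact h.symm.trans hx

lemma mem_strictPoints_of_eq (hc : ∀ i, ∀ q ∈ B, ContinuousAt (c i) q) {q : ℂ}
    (hinj : Function.Injective fun i => ctr b c i q)
    {y : Ambient ι} (hy : y ∈ fibre (blowupCurves B (ctr b c)) q) {i : ι}
    (hx : y.1 = ctr b c i q) {S : Set F2} {E : ℂ → ℂ × ℂ} (hE : ContinuousAt E 0)
    (hE0 : E 0 = dirn (b i) (y.2 i)) (hS : ∀ s, s ≠ 0 → ch (b i) (c i q + s • E s) ∈ S) :
    y ∈ strictPoints (fun i => ctr b c i q) S := by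
  have h : {z : Ambient ι | z.1 ∈ S ∧ ∀ k, IsLineThrough z.1 (ctr b c k q) (z.2 k)} ⊆
      {z | z ∈ blowupPoints (fun i => ctr b c i q) ∧ z.1 ∈ S ∧ ∀ i, z.1 ≠ ctr b c i q} :=
    fun _ hz => ⟨subset_closure hz.2, hz.1, fun k => (hz.2 k).ne_coe⟩
  exact closure_mono h (mem_closure_of_eq_ctr hc hinj hy hx hE hE0 hS)

/-- Off the centres a limit carries the lines it must carry. Over a centre it is determined by a
direction, and the straight arc in that direction stays in the fibre. -/
lemma fibre_blowupCurves (hc : ∀ i, ∀ q ∈ B, ContinuousAt (c i) q) {q : ℂ} (hq : q ∈ B)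
    (hinj : Function.Injective fun i => ctr b c i q) :
    fibre (blowupCurves B (ctr b c)) q = blowupPoints fun i => ctr b c i q := by
  refine Set.Subset.antisymm (fun y hy => ?_) (blowupPoints_subset_fibre hq)
  by_cases h : ∃ i, y.1 = ctr b c i q
  · obtain ⟨i, hi⟩ := h
    refine closure_mono (fun _ hz => hz.2) (mem_closure_of_eq_ctr (S := Set.univ) hc hinj hy hi
      (E := fun _ => dirn (b i) (y.2 i)) continuousAt_const rfl fun _ _ => trivial)
  · exact mem_blowupPoints_of_ne hc hy (not_exists.1 h)

/-- Limits over varying q might have more directions over a centre than the curve in the fibre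
allows. The arc demanded at each centre certifies that the direction is attained without moving q.
-/
lemma fibre_strictCurves_subset (hc : ∀ i, ∀ q ∈ B, ContinuousAt (c i) q) {q : ℂ}
    (hinj : Function.Injective fun i => ctr b c i q) {S : Set (ℂ × F2)} (hS : IsClosed S)
    {S' : Set F2} (hS' : ∀ x, (q, x) ∈ S → x ∈ S')
    {y : Ambient ι} (hy : y ∈ fibre (strictCurves B (ctr b c) S) q)
    (h : ∀ i, y.1 = ctr b c i q → ∃ E : ℂ → ℂ × ℂ, ContinuousAt E 0 ∧
      E 0 = dirn (b i) (y.2 i) ∧ ∀ s, s ≠ 0 → ch (b i) (c i q + s • E s) ∈ S') :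
    y ∈ strictPoints (fun i => ctr b c i q) S' := by
  have hy' : y ∈ fibre (blowupCurves B (ctr b c)) q := strictCurves_subset_blowupCurves hy
  by_cases hi : ∃ i, y.1 = ctr b c i q
  · obtain ⟨i, hi⟩ := hi
    obtain ⟨E, hE, hE0, hES⟩ := h i hi
    exact mem_strictPoints_of_eq hc hinj hy' hi hE hE0 hES
  · exact mem_strictPoints_of_ne hc hy' (not_exists.1 hi)
      (hS' _ (mem_of_mem_strictCurves hS hy))

end Fibre

/-! ### The eight base points -/

instance : Finite Place := by
  refine Finite.of_injective (β := Fin 4) (fun p => match p with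
    | .zero => 0 | .one => 1 | .t => 2 | .infty => 3) ?_
  rintro (_ | _ | _ | _) (_ | _ | _ | _) h <;> simp_all

instance : Finite Sgn := by
  refine Finite.of_injective (β := Fin 2) (fun p => match p with
    | .plus => 0 | .minus => 1) ?_
  rintro (_ | _) (_ | _) h <;> simp_all

/-- The charts containing the base points. -/
def bb : Place × Sgn → Bool
  | (.infty, _) => true
  | _ => false

/-- The coordinates of the base points. -/
def cc (θ : Place → ℂ) (t : ℂ) : Place × Sgn → ℂ → ℂ × ℂ
  | (.zero, .plus), _ => (0, t * θ .zero / 2)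
  | (.zero, .minus), q => (0, (-t * θ .zero / 2) / confTheta θ q .zero)
  | (.one, .plus), q => (confTheta θ q .one, θ .one * (t - confTheta θ q .one) / 2)
  | (.one, .minus), q => (1 / confTheta θ q .one,
        (-θ .one / 2 * (t - 1 / confTheta θ q .one)) / confTheta θ q .one)
  | (.t, .plus), q => (t / confTheta θ q .t,
        (t * (t - confTheta θ q .t) * θ .t / 2) / confTheta θ q .t ^ 2)
  | (.t, .minus), q => (t * confTheta θ q .t, -(t * θ .t / 2) * (t * confTheta θ q .t - 1))
  | (.infty, .plus), q => (0, (θ .infty / 2 - 1) / q)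
  | (.infty, .minus), q => (0, (-θ .infty / 2) / confTheta θ q .infty)

lemma confPoint_eq (θ : Place → ℂ) (t : ℂ) : confPoint θ t = ctr bb (cc θ t) := by
  funext k q
  rcases k with ⟨_ | _ | _ | _, _ | _⟩ <;> rfl

lemma confTheta_one (θ : Place → ℂ) (i : Place) : confTheta θ 1 i = 1 := by simp [confTheta]

lemma okaPoint_eq (θ : Place → ℂ) (t : ℂ) : okaPoint θ t = fun k => ctr bb (cc θ t) k 1 := by
  funext k
  rcases k with ⟨_ | _ | _ | _, _ | _⟩ <;> simp only [okaPoint, ctr, bb, cc, ch, cnum] <;>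
    congr 2 <;> (try rw [confTheta_one]) <;> ring

/-- For q ≠ 1 the definition of Θ_i(q) is inverted by θ_i = 2(Θ_i - 1)/(q - 1), after which the
coordinates agree as rational functions. -/
lemma qOkaPoint_eq (θ : Place → ℂ) (t : ℂ) {q : ℂ} (hq0 : q ≠ 0) (hq : q ≠ 1)
    (hΘ : ∀ i, confTheta θ q i ≠ 0) :
    qOkaPoint q (confTheta θ q) t = fun k => ctr bb (cc θ t) k q := by
  have hq' : q - 1 ≠ 0 := sub_ne_zero.2 hq
  have e0 : θ .zero = 2 * (confTheta θ q .zero - 1) / (q - 1) := by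
    rw [confTheta]; field_simp; ring
  have e1 : θ .one = 2 * (confTheta θ q .one - 1) / (q - 1) := by
    rw [confTheta]; field_simp; ring
  have et : θ .t = 2 * (confTheta θ q .t - 1) / (q - 1) := by
    rw [confTheta]; field_simp; ring
  have ei : θ .infty = 2 * (confTheta θ q .infty - 1) / (q - 1) := by
    rw [confTheta]; field_simp; ring
  have h0 := hΘ .zero
  have h1 := hΘ .one
  have ht := hΘ .t
  have hi := hΘ .infty
  funext k
  rcases k with ⟨_ | _ | _ | _, _ | _⟩ <;> simp only [qOkaPoint, ctr, bb, cc, ch, cnum]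
  all_goals congr 2
  all_goals
    first | rw [e0] | rw [e1] | rw [et] | rw [ei] | skip
    field_simp
    try ring

lemma differentiable_confTheta (θ : Place → ℂ) (i : Place) :
    Differentiable ℂ fun q => confTheta θ q i := by
  unfold confTheta
  fun_prop

lemma differentiableAt_cc (θ : Place → ℂ) (t : ℂ) (k : Place × Sgn) {q : ℂ} (hq : q ≠ 0)
    (hΘ : ∀ i, confTheta θ q i ≠ 0) : DifferentiableAt ℂ (cc θ t k) q := by
  have hd := fun i => (differentiable_confTheta θ i).differentiableAt (x := q)
  have h0 := hΘ .zero
  have h1 := hΘ .one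
  have ht := hΘ .t
  have hi := hΘ .infty
  have d0 := hd .zero
  have d1 := hd .one
  have dt := hd .t
  have di := hd .infty
  rcases k with ⟨_ | _ | _ | _, _ | _⟩ <;> unfold cc
  all_goals fun_prop (disch := first | assumption | exact pow_ne_zero _ ht)

lemma ch_ne_iff {β β' : Bool} {a a' : ℂ × ℂ} :
    ch β a ≠ ch β' a' ↔ wedge (cv β a) (cv β' a') ≠ 0 := by
  rw [Ne, Ne, wedge_eq_zero_iff (cv_ne_zero _ _) (cv_ne_zero _ _), ← ch_val, ← ch_val,
    Subtype.ext_iff]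

/-- Two centres differ when a wedge product, continuous in q, is nonzero, and there are finitely
many pairs. -/
lemma isOpen_base (θ : Place → ℂ) (t : ℂ) : IsOpen (base θ t) := by
  refine isOpen_iff_mem_nhds.2 fun q hq => ?_
  obtain ⟨h0, hΘ, hinj⟩ := hq
  have e1 : ∀ᶠ q' in 𝓝 q, ∀ i, confTheta θ q' i ≠ 0 := eventually_all.2 fun i =>
    (differentiable_confTheta θ i).continuous.continuousAt.eventually_ne (hΘ i)
  have e2 : ∀ᶠ q' in 𝓝 q, ∀ k k', k ≠ k' →
      wedge (cv (bb k) (cc θ t k q')) (cv (bb k') (cc θ t k' q')) ≠ 0 := by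
    refine eventually_all.2 fun k => eventually_all.2 fun k' => ?_
    by_cases hk : k = k'
    · simp [hk]
    · have hne : wedge (cv (bb k) (cc θ t k q)) (cv (bb k') (cc θ t k' q)) ≠ 0 := by
        rw [← ch_ne_iff]
        rw [confPoint_eq] at hinj
        exact fun h => hk (hinj h)
      have hk1 := (differentiableAt_cc θ t k h0 hΘ).continuousAt
      have hk2 := (differentiableAt_cc θ t k' h0 hΘ).continuousAt
      have hcont : ContinuousAt (fun q' =>
          wedge (cv (bb k) (cc θ t k q')) (cv (bb k') (cc θ t k' q'))) q :=
        ContinuousAt.comp (f := fun q' => (cv (bb k) (cc θ t k q'), cv (bb k') (cc θ t k' q')))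
          differentiable_wedge.continuous.continuousAt
          ((ContinuousAt.comp (f := cc θ t k) (continuous_cv _).continuousAt hk1).prodMk
            (ContinuousAt.comp (f := cc θ t k') (continuous_cv _).continuousAt hk2))
      exact (hcont.eventually_ne hne).mono fun _ h _ => h
  filter_upwards [e1, e2, isOpen_ne.mem_nhds h0] with q' h1 h2 h3
  refine ⟨h3, h1, fun k k' h => ?_⟩
  by_contra hk
  rw [confPoint_eq] at h
  exact ch_ne_iff.2 (h2 k k' hk) h

/-- The ruling separates the other places: over 0 the first coordinate vanishes, over 1 and t it
does not, and the points at ∞ lie on 𝒟_∞. Only the pairs ± at one place and the pairs between 1 and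
t can collide. -/
lemma injective_ctr_cc {θ : Place → ℂ} {t q : ℂ} (ht : t ≠ 0) (hΘ : ∀ i, confTheta θ q i ≠ 0)
    (h : ∀ i, cc θ t (i, .plus) q ≠ cc θ t (i, .minus) q)
    (h1 : confTheta θ q .one ≠ t / confTheta θ q .t)
    (h2 : confTheta θ q .one ≠ t * confTheta θ q .t)
    (h3 : 1 / confTheta θ q .one ≠ t / confTheta θ q .t)
    (h4 : 1 / confTheta θ q .one ≠ t * confTheta θ q .t) :
    Function.Injective fun k => ctr bb (cc θ t) k q := by
  have hne : ∀ a v, ch false a ≠ ch true (0, v) := fun a v e =>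
    ch_false_notMem_lineDinf a (by rw [e, ch_true_mem_lineDinf_iff])
  have hΘ1 := hΘ .one
  have hΘt := hΘ .t
  have g1 : 1 / confTheta θ q .one ≠ 0 := one_div_ne_zero hΘ1
  have g2 : t / confTheta θ q .t ≠ 0 := div_ne_zero ht hΘt
  have g3 : t * confTheta θ q .t ≠ 0 := mul_ne_zero ht hΘt
  rintro ⟨_ | _ | _ | _, _ | _⟩ ⟨_ | _ | _ | _, _ | _⟩ e
  all_goals
    first
    | rfl
    | exact (h _ (ch_injective _ e)).elim
    | exact (h _ (ch_injective _ e).symm).elim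
    | exact (hne _ _ e).elim
    | exact (hne _ _ e.symm).elim
    | exact (h1 (congrArg Prod.fst (ch_injective _ e))).elim
    | exact (h2 (congrArg Prod.fst (ch_injective _ e))).elim
    | exact (h3 (congrArg Prod.fst (ch_injective _ e))).elim
    | exact (h4 (congrArg Prod.fst (ch_injective _ e))).elim
    | exact (h1 (congrArg Prod.fst (ch_injective _ e)).symm).elim
    | exact (h2 (congrArg Prod.fst (ch_injective _ e)).symm).elim
    | exact (h3 (congrArg Prod.fst (ch_injective _ e)).symm).elim
    | exact (h4 (congrArg Prod.fst (ch_injective _ e)).symm).elim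
    | exact (hΘ1 (congrArg Prod.fst (ch_injective _ e))).elim
    | exact (g1 (congrArg Prod.fst (ch_injective _ e))).elim
    | exact (g2 (congrArg Prod.fst (ch_injective _ e))).elim
    | exact (g3 (congrArg Prod.fst (ch_injective _ e))).elim
    | exact (hΘ1 (congrArg Prod.fst (ch_injective _ e)).symm).elim
    | exact (g1 (congrArg Prod.fst (ch_injective _ e)).symm).elim
    | exact (g2 (congrArg Prod.fst (ch_injective _ e)).symm).elim
    | exact (g3 (congrArg Prod.fst (ch_injective _ e)).symm).elim

lemma one_mem_base {θ : Place → ℂ} {t : ℂ} (h0 : θ .zero ≠ 0) (h1 : θ .one ≠ 0)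
    (ht : θ .t ≠ 0) (hinf : θ .infty ≠ 1) (ht0 : t ≠ 0) (ht1 : t ≠ 1) : (1 : ℂ) ∈ base θ t := by
  have ht1' : t - 1 ≠ 0 := sub_ne_zero.2 ht1
  refine ⟨one_ne_zero, fun i => by rw [confTheta_one]; exact one_ne_zero, ?_⟩
  rw [confPoint_eq]
  refine injective_ctr_cc ht0 (fun i => by rw [confTheta_one]; exact one_ne_zero) ?_ ?_ ?_ ?_ ?_
  · intro i e
    have e2 := congrArg Prod.snd e
    cases i <;> simp only [cc, confTheta_one] at e2
    · exact mul_ne_zero ht0 h0 (by linear_combination e2)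
    · exact mul_ne_zero ht1' h1 (by linear_combination e2)
    · exact mul_ne_zero (mul_ne_zero ht0 ht1') ht (by linear_combination e2)
    · exact hinf (by linear_combination e2)
  all_goals
    simp only [confTheta_one, div_one, mul_one]
    exact ht1.symm

lemma base_mem_nhds {θ : Place → ℂ} {t : ℂ} (h0 : θ .zero ≠ 0) (h1 : θ .one ≠ 0)
    (ht : θ .t ≠ 0) (hinf : θ .infty ≠ 1) (ht0 : t ≠ 0) (ht1 : t ≠ 1) : base θ t ∈ 𝓝 (1 : ℂ) :=
  (isOpen_base θ t).mem_nhds (one_mem_base h0 h1 ht hinf ht0 ht1)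

/-- A collision of signs forces Θ_0 = -1, Θ_1² = 1, Θ_t² = 1 or Θ_∞² = q according to the place. A
collision between the places 1 and t forces t = Θ_1^±1 Θ_t^±1, an element of the exceptional set
with exponent 0 of q. -/
lemma mem_base_of_generic {θ : Place → ℂ} {t q : ℂ} (h0 : θ .zero ≠ 0) (ht0 : t ≠ 0)
    (hq0 : q ≠ 0) (hΘ : ∀ i, confTheta θ q i ≠ 0)
    (hg : IsGenericTheta q (confTheta θ q)) (hs : t ∉ exceptionalSet q (confTheta θ q)) :
    q ∈ base θ t := by
  have hΘ1 := hΘ .one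
  have hΘt := hΘ .t
  refine ⟨hq0, hΘ, ?_⟩
  rw [confPoint_eq]
  have hs' : ∀ ε ε' : ℤ, (ε = 1 ∨ ε = -1) → (ε' = 1 ∨ ε' = -1) →
      t ≠ confTheta θ q .one ^ ε * confTheta θ q .t ^ ε' := fun ε ε' h h' e =>
    hs ⟨ε, ε', 0, h, h', Or.inl (by rw [zpow_zero, mul_one, e])⟩
  refine injective_ctr_cc ht0 hΘ ?_ (fun e => ?_) (fun e => ?_) (fun e => ?_) (fun e => ?_)
  · intro i e
    have e1 := congrArg Prod.fst e
    have e2 := congrArg Prod.snd e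
    have hi := hΘ i
    obtain ⟨g0, g1, gt, gi⟩ := hg
    cases i <;> simp only [cc] at e1 e2
    · field_simp at e2
      refine g0 ?_
      have : confTheta θ q .zero = -1 := by linear_combination e2
      rw [this]; ring
    · field_simp at e1
      exact g1 e1
    · field_simp at e1
      exact gt e1.symm
    · field_simp at e2
      refine gi ?_
      simp only [confTheta] at e2 ⊢
      linear_combination ((q - 1) / 2) * e2
  · refine hs' 1 1 (Or.inl rfl) (Or.inl rfl) ?_
    rw [zpow_one, zpow_one, e]
    field_simp
  · refine hs' 1 (-1) (Or.inl rfl) (Or.inr rfl) ?_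
    rw [zpow_one, zpow_neg_one, e]
    field_simp
  · refine hs' (-1) 1 (Or.inr rfl) (Or.inl rfl) ?_
    rw [zpow_one, zpow_neg_one, ← one_div, e]
    field_simp
  · refine hs' (-1) (-1) (Or.inr rfl) (Or.inr rfl) ?_
    rw [zpow_neg_one, zpow_neg_one, ← one_div, e]
    field_simp

/-! ### Position of the base points relative to the curve `𝒞` -/

/-- Since Θ_1 - 1 = (q - 1) θ_1 / 2, the factor u - 1 supplies the factor 1 - q of the right side.
Nothing is divided by 1 - q, so q = 1 is included. -/
lemma cc_one_mem (θ : Place → ℂ) (t : ℂ) {q : ℂ} (hΘ : ∀ i, confTheta θ q i ≠ 0) (s : Sgn) :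
    ((cc θ t (.one, s) q).1 - 1) * ((cc θ t (.one, s) q).1 - t) =
      (1 - q) * (cc θ t (.one, s) q).2 := by
  have h := hΘ .one
  cases s <;> simp only [cc]
  · simp only [confTheta]; ring
  · field_simp
    simp only [confTheta]; ring

lemma cc_t_mem (θ : Place → ℂ) (t : ℂ) {q : ℂ} (hΘ : ∀ i, confTheta θ q i ≠ 0) (s : Sgn) :
    ((cc θ t (.t, s) q).1 - 1) * ((cc θ t (.t, s) q).1 - t) =
      (1 - q) * (cc θ t (.t, s) q).2 := by
  have h := hΘ .t
  cases s <;> simp only [cc]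
  · field_simp
    simp only [confTheta]; ring
  · simp only [confTheta]; ring

/-- Incidence would force Θ_0 = 0 for the sign + and t = 0 for the sign -. -/
lemma zero_notMem_curveC (θ : Place → ℂ) {t q : ℂ} (ht : t ≠ 0)
    (hΘ : ∀ i, confTheta θ q i ≠ 0) (s : Sgn) : ctr bb (cc θ t) (.zero, s) q ∉ curveC q t := by
  have h := hΘ .zero
  intro hx
  cases s <;> simp only [ctr, bb, ch_false_mem_curveC_iff, cc] at hx
  · refine h (mul_left_cancel₀ ht ?_)
    simp only [confTheta]
    linear_combination hx
  · field_simp at hx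
    simp only [confTheta] at hx
    exact ht (by linear_combination hx / 2)

/-- Incidence would force Θ_∞ = 0 for the sign + and 1 = 0 for the sign -. -/
lemma infty_notMem_curveC (θ : Place → ℂ) {t q : ℂ} (hq : q ≠ 0)
    (hΘ : ∀ i, confTheta θ q i ≠ 0) (s : Sgn) : ctr bb (cc θ t) (.infty, s) q ∉ curveC q t := by
  have h := hΘ .infty
  intro hx
  cases s <;> simp only [ctr, bb, ch_true_mem_curveC_iff, cc] at hx
  · field_simp at hx
    refine h ?_
    simp only [confTheta]
    linear_combination hx / 2
  · field_simp at hx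
    simp only [confTheta] at hx
    exact one_ne_zero (α := ℂ) (by linear_combination hx / 2)

/-! ### The fibres of the family -/

lemma curveC_one (t : ℂ) : curveC 1 t = lineH ∪ lineD 1 ∪ lineD t := by
  ext x
  constructor
  · rintro ((⟨⟨u, v⟩, hv, rfl⟩ | ⟨⟨u, v⟩, hv, rfl⟩) | ⟨⟨u, v⟩, hv, rfl⟩)
    all_goals simp only [Set.mem_ofPred_eq, sub_self, zero_mul] at hv
    · rcases mul_eq_zero.1 hv with h | h
      · exact Or.inl (Or.inr (Or.inl ⟨_, sub_eq_zero.1 h, rfl⟩))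
      · exact Or.inr (Or.inl ⟨_, sub_eq_zero.1 h, rfl⟩)
    · rcases mul_eq_zero.1 hv with h | h
      · rcases mul_eq_zero.1 h with h | h
        · exact Or.inl (Or.inr (Or.inr ⟨_, sub_eq_zero.1 h, rfl⟩))
        · exact Or.inr (Or.inr ⟨_, sub_eq_zero.1 h, rfl⟩)
      · exact Or.inl (Or.inl (Or.inl ⟨_, h, rfl⟩))
    · rcases mul_eq_zero.1 hv with h | h
      -- Vanishing of 1 - u or 1 - tu excludes u = 0, so these points of chart 3 already lie in
      -- chart 1.
      · have hu : u ≠ 0 := by rintro rfl; simp at h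
        rw [chart_three_eq_one v hu]
        rcases mul_eq_zero.1 h with h | h
        · refine Or.inl (Or.inr (Or.inr ⟨_, ?_, rfl⟩))
          simp only [Set.mem_ofPred_eq]
          field_simp
          linear_combination h
        · refine Or.inr (Or.inr ⟨_, ?_, rfl⟩)
          simp only [Set.mem_ofPred_eq]
          field_simp
          linear_combination h
      · exact Or.inl (Or.inl (Or.inr ⟨_, h, rfl⟩))
  · rintro ((hx | hx) | hx)
    · rcases hx with ⟨⟨u, v⟩, hv, rfl⟩ | ⟨⟨u, v⟩, hv, rfl⟩
      all_goals simp only [Set.mem_ofPred_eq] at hv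
      · exact Or.inl (Or.inr ⟨_, by simp [hv], rfl⟩)
      · exact Or.inr ⟨_, by simp [hv], rfl⟩
    · rcases hx with ⟨⟨u, v⟩, hv, rfl⟩ | ⟨⟨u, v⟩, hv, rfl⟩
      all_goals simp only [Set.mem_ofPred_eq] at hv
      · exact Or.inl (Or.inl ⟨_, by simp [hv], rfl⟩)
      · exact Or.inl (Or.inr ⟨_, by simp [hv], rfl⟩)
    · rcases hx with ⟨⟨u, v⟩, hv, rfl⟩ | ⟨⟨u, v⟩, hv, rfl⟩
      all_goals simp only [Set.mem_ofPred_eq] at hv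
      · exact Or.inl (Or.inl ⟨_, by simp [hv], rfl⟩)
      · exact Or.inl (Or.inr ⟨_, by simp [hv], rfl⟩)

section

variable {θ : Place → ℂ} {t q : ℂ} {y : Ambient (Place × Sgn)}

lemma continuousAt_cc_of_mem_base (θ : Place → ℂ) (t : ℂ) :
    ∀ k, ∀ q ∈ base θ t, ContinuousAt (cc θ t k) q := fun k _ hq =>
  (differentiableAt_cc θ t k hq.1 hq.2.1).continuousAt

lemma injective_of_mem_base (hq : q ∈ base θ t) :
    Function.Injective fun k => ctr bb (cc θ t) k q := by
  have := hq.2.2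
  rwa [confPoint_eq] at this

lemma notMem_lineH_of_eq_ctr {x : F2} {k : Place × Sgn}
    (h : x = ctr bb (cc θ t) k q) : x ∉ lineH := h ▸ ch_notMem_lineH _ _

/-- No centre lies on ℋ, so the condition on arcs is empty. -/
lemma fibre_strict_lineH :
    fibre (strictCurves (base θ t) (ctr bb (cc θ t)) (cylinder lineH)) q ⊆
      strictPoints (fun k => ctr bb (cc θ t) k q) lineH := by
  intro y hy
  have hq : q ∈ base θ t := hy.1
  refine fibre_strictCurves_subset (continuousAt_cc_of_mem_base θ t) (injective_of_mem_base hq)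
    isClosed_cylinder_lineH (fun x hx => hx) hy fun k hk => ?_
  exact (notMem_lineH_of_eq_ctr hk (mem_of_mem_strictCurves isClosed_cylinder_lineH hy)).elim

/-- Only the centres at the place 0 lie on 𝒟_0, and they do so for every q. Displacements along 𝒟_0
then have first coordinate 0, hence so has the limiting direction, and the straight arc stays in
𝒟_0. The line 𝒟_∞ is treated likewise in chart 2. -/
lemma fibre_strict_lineD_zero (ht : t ≠ 0) :
    fibre (strictCurves (base θ t) (ctr bb (cc θ t)) (cylinder (lineD 0))) q ⊆
      strictPoints (fun k => ctr bb (cc θ t) k q) (lineD 0) := by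
  intro y hy
  have hq : q ∈ base θ t := hy.1
  refine fibre_strictCurves_subset (continuousAt_cc_of_mem_base θ t) (injective_of_mem_base hq)
    (isClosed_cylinder_lineD 0) (fun x hx => hx) hy fun k hk => ?_
  have hx : y.1 ∈ lineD 0 := mem_of_mem_strictCurves (isClosed_cylinder_lineD 0) hy
  have h1 := hq.2.1 .one
  have h2 := hq.2.1 .t
  have hx0 : ∀ k, bb k = false → y.1 = ctr bb (cc θ t) k q → (cc θ t k q).1 = 0 := by
    intro k hb h
    rw [h, ctr, hb, ch_false_mem_lineD_iff] at hx
    exact hx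
  rcases k with ⟨_ | _ | _ | _, s⟩
  · have hc0 : ∀ q', (cc θ t (.zero, s) q').1 = 0 := fun q' => by cases s <;> rfl
    have hdir := dirn_of_mem_strictCurves (continuousAt_cc_of_mem_base θ t) hy hk
      (g := fun _ => (1, 0)) continuousAt_const fun q' _ a ha => by
        have := ch_false_mem_lineD_iff.1 ha
        simp [hc0, this]
    refine ⟨fun _ => dirn (bb (.zero, s)) (y.2 (.zero, s)), continuousAt_const, rfl,
      fun r _ => ch_false_mem_lineD_iff.2 ?_⟩
    simp only [one_mul, zero_mul, add_zero] at hdir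
    simp [hc0, hdir]
  · have := hx0 _ rfl hk
    cases s <;> simp_all [cc]
  · have := hx0 _ rfl hk
    cases s <;> simp_all [cc]
  · rw [hk, ctr, bb, ch_true_mem_lineD_iff] at hx
    simp at hx

lemma fibre_strict_lineDinf :
    fibre (strictCurves (base θ t) (ctr bb (cc θ t)) (cylinder lineDinf)) q ⊆
      strictPoints (fun k => ctr bb (cc θ t) k q) lineDinf := by
  intro y hy
  have hq : q ∈ base θ t := hy.1
  refine fibre_strictCurves_subset (continuousAt_cc_of_mem_base θ t) (injective_of_mem_base hq)
    isClosed_cylinder_lineDinf (fun x hx => hx) hy fun k hk => ?_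
  have hx : y.1 ∈ lineDinf := mem_of_mem_strictCurves isClosed_cylinder_lineDinf hy
  have hx0 : ∀ k, bb k = false → y.1 ≠ ctr bb (cc θ t) k q := by
    intro k hb h
    rw [h, ctr, hb] at hx
    exact ch_false_notMem_lineDinf _ hx
  rcases k with ⟨_ | _ | _ | _, s⟩
  · exact (hx0 _ rfl hk).elim
  · exact (hx0 _ rfl hk).elim
  · exact (hx0 _ rfl hk).elim
  · have hc0 : ∀ q', (cc θ t (.infty, s) q').1 = 0 := fun q' => by cases s <;> rfl
    have hdir := dirn_of_mem_strictCurves (continuousAt_cc_of_mem_base θ t) hy hk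
      (g := fun _ => (1, 0)) continuousAt_const fun q' _ a ha => by
        have := ch_true_mem_lineDinf_iff.1 ha
        simp [hc0, this]
    refine ⟨fun _ => dirn (bb (.infty, s)) (y.2 (.infty, s)), continuousAt_const, rfl,
      fun r _ => ch_true_mem_lineDinf_iff.2 ?_⟩
    simp only [one_mul, zero_mul, add_zero] at hdir
    simp [hc0, hdir]

/-- The points of the exceptional curves on the strict transform of `𝒞`. -/
lemma dirn_of_mem_strict_surfaceC (ht : t ≠ 0)
    (hy : y ∈ fibre (strictCurves (base θ t) (ctr bb (cc θ t)) (surfaceC t)) q)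
    {k : Place × Sgn} (hk : y.1 = ctr bb (cc θ t) k q) :
    (k.1 = .one ∨ k.1 = .t) ∧ bb k = false ∧
      ((cc θ t k q).1 - 1) * ((cc θ t k q).1 - t) = (1 - q) * (cc θ t k q).2 ∧
      (2 * (cc θ t k q).1 - 1 - t) * (dirn (bb k) (y.2 k)).1 =
        (1 - q) * (dirn (bb k) (y.2 k)).2 := by
  have hq : q ∈ base θ t := hy.1
  have hx : y.1 ∈ curveC q t := mem_of_mem_strictCurves (isClosed_surfaceC t) hy
  -- Incidence of the centre with 𝒞 is needed over the whole base, because its equation is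
  -- subtracted at the nearby parameters as well.
  have main : (k.1 = .one ∨ k.1 = .t) ∧ bb k = false ∧ ∀ q' ∈ base θ t,
      ((cc θ t k q').1 - 1) * ((cc θ t k q').1 - t) = (1 - q') * (cc θ t k q').2 := by
    rcases k with ⟨_ | _ | _ | _, s⟩
    · exact (zero_notMem_curveC θ ht hq.2.1 s (hk ▸ hx)).elim
    · exact ⟨Or.inl rfl, rfl, fun q' hq' => cc_one_mem θ t hq'.2.1 s⟩
    · exact ⟨Or.inr rfl, rfl, fun q' hq' => cc_t_mem θ t hq'.2.1 s⟩
    · exact (infty_notMem_curveC θ hq.1 hq.2.1 s (hk ▸ hx)).elim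
  obtain ⟨h1, h2, h3⟩ := main
  refine ⟨h1, h2, h3 q hq, ?_⟩
  have hc := continuousAt_cc_of_mem_base θ t k q hq
  have hc' : ContinuousAt (fun z : ℂ × (ℂ × ℂ) => (cc θ t k z.1).1) (q, cc θ t k q) :=
    (ContinuousAt.comp (g := cc θ t k) (f := fun z : ℂ × (ℂ × ℂ) => z.1) hc
      continuousAt_fst).fst
  -- The covector comes from dividing the difference of the equations at a and at the centre by the
  -- displacement; at a = c it becomes the tangent relation.
  have hdir := dirn_of_mem_strictCurves (continuousAt_cc_of_mem_base θ t) hy hk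
    (g := fun z => (z.2.1 + (cc θ t k z.1).1 - 1 - t, -(1 - z.1)))
    (by
      refine ContinuousAt.prodMk (((ContinuousAt.add ?_ hc').sub continuousAt_const).sub
        continuousAt_const) (continuousAt_const.sub continuousAt_fst).neg
      exact continuousAt_snd.fst) fun q' hq' a ha => by
        have e1 : (a.1 - 1) * (a.1 - t) = (1 - q') * a.2 := by
          rw [h2] at ha
          exact ch_false_mem_curveC_iff.1 ha
        have e2 := h3 q' hq'
        simp only [Prod.fst_sub, Prod.snd_sub]
        linear_combination e1 - e2
  simp only at hdir
  linear_combination hdir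

lemma fibre_strict_surfaceC (ht : t ≠ 0) (hq1 : q ≠ 1) :
    fibre (strictCurves (base θ t) (ctr bb (cc θ t)) (surfaceC t)) q ⊆
      strictPoints (fun k => ctr bb (cc θ t) k q) (curveC q t) := by
  intro y hy
  have hq : q ∈ base θ t := hy.1
  have hq' : 1 - q ≠ 0 := sub_ne_zero.2 hq1.symm
  refine fibre_strictCurves_subset (continuousAt_cc_of_mem_base θ t) (injective_of_mem_base hq)
    (isClosed_surfaceC t) (S' := curveC q t) (fun x hx => hx) hy fun k hk => ?_
  obtain ⟨-, hb, hF, hd⟩ := dirn_of_mem_strict_surfaceC ht hy hk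
  set d := dirn (bb k) (y.2 k)
  set a := cc θ t k q
  -- For q ≠ 1 the curve is the graph v = (u - 1)(u - t)/(1 - q). The second component is the
  -- increment of v between u = a₁ and u = a₁ + s d₁, divided by s.
  refine ⟨fun s => (d.1, (2 * a.1 + s * d.1 - 1 - t) * d.1 / (1 - q)),
    Continuous.continuousAt (by fun_prop), ?_, fun s _ => ?_⟩
  · refine Prod.ext rfl ?_
    simp only [zero_mul, add_zero]
    rw [hd]
    field_simp
  · rw [hb, ch_false_mem_curveC_iff]
    simp only [Prod.fst_add, Prod.snd_add, Prod.smul_fst, Prod.smul_snd, smul_eq_mul]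
    field_simp
    linear_combination hF

/-- At q = 1 the tangent relation reads (2c₁ - 1 - t) d₁ = 0 with c₁ = 1 or t. The coefficient is
±(1 - t), hence d is vertical and the straight arc runs in 𝒟_1 or 𝒟_t. Points over ℋ are set aside,
being removed with ℋ. -/
lemma fibre_strict_surfaceC_one (ht : t ≠ 0) (ht1 : t ≠ 1)
    (hy : y ∈ fibre (strictCurves (base θ t) (ctr bb (cc θ t)) (surfaceC t)) 1)
    (hH : y.1 ∉ lineH) :
    y ∈ strictPoints (fun k => ctr bb (cc θ t) k 1) (lineD 1) ∪
      strictPoints (fun k => ctr bb (cc θ t) k 1) (lineD t) := by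
  have hq : (1 : ℂ) ∈ base θ t := hy.1
  have hc := continuousAt_cc_of_mem_base θ t
  have hy' : y ∈ fibre (blowupCurves (base θ t) (ctr bb (cc θ t))) 1 :=
    strictCurves_subset_blowupCurves hy
  by_cases h : ∃ k, y.1 = ctr bb (cc θ t) k 1
  · obtain ⟨k, hk⟩ := h
    obtain ⟨hk1, hb, -, hd⟩ := dirn_of_mem_strict_surfaceC ht hy hk
    have key : ∀ c : ℂ, (cc θ t k 1).1 = c → (2 * c - 1 - t ≠ 0) →
        y ∈ strictPoints (fun k => ctr bb (cc θ t) k 1) (lineD c) := by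
      intro c hcc hne
      rw [hcc, sub_self, zero_mul] at hd
      have hd0 := (mul_eq_zero.1 hd).resolve_left hne
      refine mem_strictPoints_of_eq hc (injective_of_mem_base hq) hy' hk
        (E := fun _ => dirn (bb k) (y.2 k)) continuousAt_const rfl fun s _ => ?_
      rw [hb, ch_false_mem_lineD_iff, ← hb]
      simp [hd0, hcc]
    rcases k with ⟨k, s⟩
    rcases hk1 with rfl | rfl
    · refine Or.inl (key 1 ?_ ?_)
      · cases s <;> simp [cc, confTheta_one]
      · intro e
        exact ht1 (by linear_combination -e)
    · refine Or.inr (key t ?_ ?_)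
      · cases s <;> simp [cc, confTheta_one]
      · intro e
        exact ht1 (by linear_combination e)
  · have h' := not_exists.1 h
    have hx : ((1 : ℂ), y.1) ∈ surfaceC t :=
      mem_of_mem_strictCurves (y := ((1 : ℂ), y)) (isClosed_surfaceC t) hy
    change y.1 ∈ curveC 1 t at hx
    rw [curveC_one] at hx
    rcases hx with (hx | hx) | hx
    · exact (hH hx).elim
    · exact Or.inl (mem_strictPoints_of_ne hc hy' h' hx)
    · exact Or.inr (mem_strictPoints_of_ne hc hy' h' hx)

/-- As ℋ contains no centre, its full preimage is its strict transform. -/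
lemma mem_strictPoints_lineH (hy : y ∈ fibre (blowupCurves (base θ t) (ctr bb (cc θ t))) q)
    (hH : y.1 ∈ lineH) : y ∈ strictPoints (fun k => ctr bb (cc θ t) k q) lineH :=
  mem_strictPoints_of_ne (continuousAt_cc_of_mem_base θ t) hy
    (fun _ hk => notMem_lineH_of_eq_ctr hk hH) hH

end

/-- The strict transform of 𝒞 contains those of 𝒟_1 and 𝒟_t at q = 1 and, off ℋ, nothing more; ℋ is
removed on both sides. -/
lemma fibre_Omega_one {θ : Place → ℂ} {t : ℂ} (ht : t ≠ 0) (ht1 : t ≠ 1)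
    (hq : (1 : ℂ) ∈ base θ t) : fibre (Omega θ t) 1 = Oka θ t := by
  have hC : ∀ x ∈ lineD 1 ∪ lineD t, ((1 : ℂ), x) ∈ surfaceC t := fun x hx => by
    change x ∈ curveC 1 t
    rw [curveC_one, Set.union_assoc]
    exact Or.inr hx
  have hBl := fibre_blowupCurves (continuousAt_cc_of_mem_base θ t) hq (injective_of_mem_base hq)
  ext y
  have hBl' : (1, y) ∈ blowupCurves (base θ t) (ctr bb (cc θ t)) ↔
      y ∈ blowupPoints fun k => ctr bb (cc θ t) k 1 := by rw [← hBl]; rfl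
  simp only [Omega, Oka, confPoint_eq, okaPoint_eq, fibre, Set.mem_ofPred_eq, Set.mem_sdiff,
    hBl', Set.mem_union, not_or]
  refine and_congr_right fun hy => ⟨?_, ?_⟩
  · rintro ⟨⟨⟨hH, hS⟩, h0⟩, hi⟩
    refine ⟨⟨⟨⟨fun h => h0 (strictPoints_subset_fibre hq (fun _ hx => hx) h),
      fun h => hS (strictPoints_subset_fibre hq (fun x hx => hC x (Or.inl hx)) h)⟩,
      fun h => hS (strictPoints_subset_fibre hq (fun x hx => hC x (Or.inr hx)) h)⟩,
      fun h => hi (strictPoints_subset_fibre hq (fun _ hx => hx) h)⟩,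
      fun h => hH (strictPoints_subset_fibre hq (fun _ hx => hx) h)⟩
  · rintro ⟨⟨⟨⟨h0, h1⟩, h2⟩, hi⟩, hH⟩
    have hyH : y.1 ∉ lineH := fun h => hH (mem_strictPoints_lineH (hBl'.2 hy) h)
    refine ⟨⟨⟨fun h => hH (fibre_strict_lineH h), fun h => ?_⟩,
      fun h => h0 (fibre_strict_lineD_zero ht h)⟩, fun h => hi (fibre_strict_lineDinf h)⟩
    rcases fibre_strict_surfaceC_one ht ht1 h hyH with h | h
    · exact h1 h
    · exact h2 h

lemma fibre_Omega {θ : Place → ℂ} {t q : ℂ} (ht : t ≠ 0) (hq1 : q ≠ 1) (hq : q ∈ base θ t) :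
    fibre (Omega θ t) q = qOkaMod q (confTheta θ q) t := by
  have hBl := fibre_blowupCurves (continuousAt_cc_of_mem_base θ t) hq (injective_of_mem_base hq)
  ext y
  have hBl' : (q, y) ∈ blowupCurves (base θ t) (ctr bb (cc θ t)) ↔
      y ∈ blowupPoints fun k => ctr bb (cc θ t) k q := by rw [← hBl]; rfl
  simp only [Omega, qOkaMod, confPoint_eq, qOkaPoint_eq θ t hq.1 hq1 hq.2.1, fibre,
    Set.mem_ofPred_eq, Set.mem_sdiff, hBl', Set.mem_union, not_or]
  refine and_congr_right fun hy => ⟨?_, ?_⟩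
  · rintro ⟨⟨⟨hH, hS⟩, h0⟩, hi⟩
    exact ⟨⟨⟨fun h => hH (strictPoints_subset_fibre hq (fun _ hx => hx) h),
      fun h => h0 (strictPoints_subset_fibre hq (fun _ hx => hx) h)⟩,
      fun h => hi (strictPoints_subset_fibre hq (fun _ hx => hx) h)⟩,
      fun h => hS (strictPoints_subset_fibre hq (fun _ hx => hx) h)⟩
  · rintro ⟨⟨⟨hH, h0⟩, hi⟩, hS⟩
    exact ⟨⟨⟨fun h => hH (fibre_strict_lineH h), fun h => hS (fibre_strict_surfaceC ht hq1 h)⟩,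
      fun h => h0 (fibre_strict_lineD_zero ht h)⟩, fun h => hi (fibre_strict_lineDinf h)⟩

/-! ### Local parametrizations -/

section Param

variable {ι : Type}

/-- The family of points and lines parametrized by `a` and `N`. -/
def paramMap (ℓ₀ : ι → PLines) (β : Bool) (a : ℂ × ℂ × ℂ → ℂ × ℂ)
    (N : ι → ℂ × ℂ × ℂ → Fin 6 × Fin 6 → ℂ) (w : ℂ × ℂ × ℂ) : ℂ × Ambient ι :=
  (w.1, ch β (a w), fun i => classOr (ℓ₀ i) (N i w))

/-- `X` has a holomorphic parametrization near `x`, as in `IsSmoothFamily`. -/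
def HasParametrization (X : Set (ℂ × Ambient ι)) (x : X) : Prop :=
  ∃ (e : OpenPartialHomeomorph (ℂ × ℂ × ℂ) X)
    (A : ℂ × ℂ × ℂ → Fin 6 → ℂ) (L : ι → ℂ × ℂ × ℂ → Fin 6 × Fin 6 → ℂ),
    x ∈ e.target ∧
    (∀ w ∈ e.source, (e w).1.1 = w.1 ∧
      (∃ h, (e w).1.2.1.1 = Projectivization.mk ℂ (A w) h) ∧
      ∀ i, ∃ h, (e w).1.2.2 i = Projectivization.mk ℂ (L i w) h) ∧
    (∃ k, ∀ w ∈ e.source, A w k = 1) ∧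
    (∀ i, ∃ k, ∀ w ∈ e.source, L i w k = 1) ∧
    DifferentiableOn ℂ A e.source ∧
    (∀ i, DifferentiableOn ℂ (L i) e.source) ∧
    ∀ w ∈ e.source, ∀ h : ℂ × ℂ × ℂ, h.1 = 0 → fderiv ℂ A w h = 0 →
      (∀ i, fderiv ℂ (L i) w h = 0) → h = 0

/-- Differentiating ψ(q, f, g) = id shows that a vector killed by dq, df and dg is zero. This
supplies the immersion condition. -/
lemma eq_zero_of_left_inverse {F G : Type*} [NormedAddCommGroup F] [NormedSpace ℂ F]
    [NormedAddCommGroup G] [NormedSpace ℂ G] {f : ℂ × ℂ × ℂ → F}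
    {g : ℂ × ℂ × ℂ → G} {ψ : ℂ × F × G → ℂ × ℂ × ℂ} {w : ℂ × ℂ × ℂ}
    (hf : DifferentiableAt ℂ f w) (hg : DifferentiableAt ℂ g w)
    (hψ : DifferentiableAt ℂ ψ (w.1, f w, g w)) (h : ∀ᶠ v in 𝓝 w, ψ (v.1, f v, g v) = v)
    {v : ℂ × ℂ × ℂ} (hv : v.1 = 0) (hfv : fderiv ℂ f w v = 0) (hgv : fderiv ℂ g w v = 0) :
    v = 0 := by
  have h1 : HasFDerivAt (fun v => (v.1, f v, g v))
      ((ContinuousLinearMap.fst ℂ ℂ (ℂ × ℂ)).prod ((fderiv ℂ f w).prod (fderiv ℂ g w))) w :=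
    hasFDerivAt_fst.prodMk (hf.hasFDerivAt.prodMk hg.hasFDerivAt)
  have h2 := HasFDerivAt.comp w hψ.hasFDerivAt h1
  have h3 : HasFDerivAt (fun v : ℂ × ℂ × ℂ => v) (ContinuousLinearMap.id ℂ _) w :=
    hasFDerivAt_id w
  have h4 := h2.unique (h3.congr_of_eventuallyEq h)
  have h5 := congrArg (fun T => T v) h4
  simp only [ContinuousLinearMap.comp_apply, ContinuousLinearMap.prod_apply,
    ContinuousLinearMap.coe_fst', hv, hfv, hgv, ContinuousLinearMap.id_apply] at h5
  rw [← h5]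
  exact map_zero _

/-- The parameters are recovered by ψ from q, the chart coordinates of the point and a single line
i₀. A line is known only up to scaling of its matrix, so ψ must return the same value on all nonzero
multiples. Its continuity on O₀ gives the inverse homeomorphism, its differentiability the immersion
condition. -/
lemma exists_parametrization [Finite ι] {X Y O₁ O₀ : Set (ℂ × Ambient ι)} (hX : X = Y ∩ O₁)
    (hO₁ : IsOpen O₁) (x : X) (hO₀ : IsOpen O₀) (hx : x.1 ∈ O₀) {W : Set (ℂ × ℂ × ℂ)}
    (hW : IsOpen W) {β : Bool} {a : ℂ × ℂ × ℂ → ℂ × ℂ}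
    {N : ι → ℂ × ℂ × ℂ → Fin 6 × Fin 6 → ℂ} (ha : DifferentiableOn ℂ a W)
    (hN : ∀ i, DifferentiableOn ℂ (N i) W) (hN0 : ∀ i, ∀ w ∈ W, N i w ≠ 0)
    {ℓ₀ : ι → PLines} (hΦ : ∀ w ∈ W, paramMap ℓ₀ β a N w ∈ Y ∩ O₀) (i₀ : ι)
    {ψ : ℂ × (ℂ × ℂ) × (Fin 6 × Fin 6 → ℂ) → ℂ × ℂ × ℂ}
    (hψ : ∀ w ∈ W, ∀ s : ℂ, s ≠ 0 → ψ (w.1, a w, s • N i₀ w) = w ∧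
      DifferentiableAt ℂ ψ (w.1, a w, s • N i₀ w))
    (hΨ : ContinuousOn (fun y : ℂ × Ambient ι => ψ (y.1, crd β y.2.1, (y.2.2 i₀).rep)) O₀)
    (hr : ∀ y ∈ Y ∩ O₀, ψ (y.1, crd β y.2.1, (y.2.2 i₀).rep) ∈ W ∧
      paramMap ℓ₀ β a N (ψ (y.1, crd β y.2.1, (y.2.2 i₀).rep)) = y) :
    HasParametrization X x := by
  classical
  set Φ := paramMap ℓ₀ β a N with hΦdef
  set Ψ : ℂ × Ambient ι → ℂ × ℂ × ℂ := fun y => ψ (y.1, crd β y.2.1, (y.2.2 i₀).rep) with hΨdef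
  have hΨΦ : ∀ w ∈ W, Ψ (Φ w) = w := by
    intro w hw
    obtain ⟨s, hs, hs'⟩ := exists_rep_mk _ (hN0 i₀ w hw)
    simp only [hΨdef, hΦdef, paramMap, crd_ch, classOr_of_ne _ (hN0 i₀ w hw), hs']
    exact (hψ w hw s hs).1
  have hΦc : ContinuousOn Φ W := by
    intro w hw
    have hwN := hW.mem_nhds hw
    have hac := (ha.continuousOn.continuousAt hwN)
    refine ContinuousAt.continuousWithinAt (continuousAt_fst.prodMk
      (ContinuousAt.prodMk ?_ (continuousAt_pi.2 fun i => ?_)))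
    · exact ContinuousAt.comp (f := a) (continuous_ch β).continuousAt hac
    · exact ContinuousAt.comp (f := N i) (continuousAt_classOr _ (hN0 i w hw))
        ((hN i).continuousOn.continuousAt hwN)
  have hxY : x.1 ∈ Y ∩ O₁ := hX ▸ x.2
  have hx0 := hr x.1 ⟨hxY.1, hx⟩
  have hk : ∀ i, ∃ k, N i (Ψ x.1) k ≠ 0 := fun i => by
    by_contra! h
    exact hN0 i _ hx0.1 (funext h)
  choose k hk using hk
  -- Besides landing in O₁, the parameters are restricted so that the coordinate k i, nonzero at x,
  -- can be normalized to 1.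
  set U : Set (ℂ × ℂ × ℂ) := {w | w ∈ W ∧ Φ w ∈ O₁ ∧ ∀ i, N i w (k i) ≠ 0} with hUdef
  have hU : IsOpen U := by
    refine isOpen_iff_mem_nhds.2 fun w ⟨h1, h2, h3⟩ => ?_
    have hwN := hW.mem_nhds h1
    have e1 := (hΦc.continuousAt hwN).eventually (hO₁.mem_nhds h2)
    have e2 : ∀ᶠ v in 𝓝 w, ∀ i, N i v (k i) ≠ 0 := eventually_all.2 fun i =>
      ((continuous_apply (k i)).continuousAt.comp
        ((hN i).continuousOn.continuousAt hwN)).eventually_ne (h3 i)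
    filter_upwards [hwN, e1, e2] with v g1 g2 g3
    exact ⟨g1, g2, g3⟩
  have hUX : ∀ w ∈ U, Φ w ∈ X := fun w hw => by
    rw [hX]
    exact ⟨(hΦ w hw.1).1, hw.2.1⟩
  have hXY : ∀ y : X, y.1 ∈ Y := fun y => (hX ▸ y.2 : y.1 ∈ Y ∩ O₁).1
  let e : OpenPartialHomeomorph (ℂ × ℂ × ℂ) X :=
    { toFun := fun w => if h : w ∈ U then ⟨Φ w, hUX w h⟩ else x
      invFun := fun y => Ψ y.1
      source := U
      target := {y | y.1 ∈ O₀ ∧ Ψ y.1 ∈ U}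
      map_source' := fun w hw => by
        rw [dif_pos hw]
        refine ⟨(hΦ w hw.1).2, ?_⟩
        change Ψ (Φ w) ∈ U
        rw [hΨΦ w hw.1]
        exact hw
      map_target' := fun y hy => hy.2
      left_inv' := fun w hw => by
        rw [dif_pos hw]
        exact hΨΦ w hw.1
      right_inv' := fun y hy => by
        rw [dif_pos hy.2]
        exact Subtype.ext (hr y.1 ⟨hXY y, hy.1⟩).2
      open_source := hU
      open_target := (hΨ.isOpen_inter_preimage hO₀ hU).preimage continuous_subtype_val
      continuousOn_toFun := by
        rw [Topology.IsInducing.subtypeVal.continuousOn_iff]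
        refine (hΦc.mono fun w hw => hw.1).congr fun w hw => ?_
        simp only [Function.comp_apply]
        rw [dif_pos hw]
      continuousOn_invFun := by
        refine hΨ.comp continuous_subtype_val.continuousOn fun y hy => hy.1 }
  have heU : ∀ w ∈ U, (e w).1 = Φ w := fun w hw => by
    change ((if h : w ∈ U then ⟨Φ w, hUX w h⟩ else x : X)).1 = Φ w
    rw [dif_pos hw]
  have hAd : ∀ w ∈ U, DifferentiableAt ℂ (fun w => cv β (a w)) w := fun w hw =>
    DifferentiableAt.comp w (differentiable_cv β).differentiableAt
      (ha.differentiableAt (hW.mem_nhds hw.1))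
  have hLd : ∀ i, ∀ w ∈ U, DifferentiableAt ℂ (fun w => (N i w (k i))⁻¹ • N i w) w := by
    intro i w hw
    have hd := (hN i).differentiableAt (hW.mem_nhds hw.1)
    exact DifferentiableAt.smul ((differentiableAt_pi.1 hd (k i)).inv (hw.2.2 i)) hd
  refine ⟨e, fun w => cv β (a w), fun i w => (N i w (k i))⁻¹ • N i w, ⟨hx, ?_⟩, ?_, ⟨k0 β, ?_⟩,
    fun i => ⟨k i, ?_⟩, fun w hw => (hAd w hw).differentiableWithinAt,
    fun i w hw => (hLd i w hw).differentiableWithinAt, ?_⟩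
  · refine ⟨hx0.1, ?_, hk⟩
    rw [hx0.2]
    exact hxY.2
  · intro w hw
    have hw' : w ∈ U := hw
    rw [heU w hw']
    refine ⟨rfl, ⟨cv_ne_zero _ _, ch_val β (a w)⟩, fun i => ?_⟩
    have hne := inv_ne_zero (hw'.2.2 i)
    refine ⟨smul_ne_zero hne (hN0 i w hw'.1), ?_⟩
    simp only [hΦdef, paramMap, classOr_of_ne _ (hN0 i w hw'.1)]
    exact (mk_eq_of_smul _ _ _ rfl).symm
  · intro w _
    exact cv_k0 _ _
  · intro w hw
    exact inv_mul_cancel₀ (hw.2.2 i)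
  · intro w hw v hv hAv hLv
    have hw' : w ∈ U := hw
    have hP : ∀ z, (cv β z (k1 β), cv β z (k2 β)) = z := fun z => by rw [cv_k1, cv_k2]
    refine eq_zero_of_left_inverse
      (ψ := fun z : ℂ × (Fin 6 → ℂ) × (Fin 6 × Fin 6 → ℂ) =>
        ψ (z.1, (z.2.1 (k1 β), z.2.1 (k2 β)), z.2.2))
      (hAd w hw') (hLd i₀ w hw') ?_ ?_ hv hAv (hLv i₀)
    · have hd := (hψ w hw'.1 _ (inv_ne_zero (hw'.2.2 i₀))).2
      refine DifferentiableAt.comp (g := ψ)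
        (f := fun z : ℂ × (Fin 6 → ℂ) × (Fin 6 × Fin 6 → ℂ) =>
          (z.1, (z.2.1 (k1 β), z.2.1 (k2 β)), z.2.2)) _ ?_ (by fun_prop)
      simp only [hP]
      exact hd
    · filter_upwards [hU.mem_nhds hw'] with u hu
      simp only [hP]
      exact (hψ u hu.1 _ (inv_ne_zero (hu.2.2 i₀))).1

end Param

/-! ### Smoothness of blow-ups along curves -/

section Smooth

variable {ι : Type} {B : Set ℂ} {b : ι → Bool} {c : ι → ℂ → ℂ × ℂ}

/-- Normalized representatives are continuous and their wedge product is nonzero at distinct points,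
hence nearby. This makes 𝔽₂ Hausdorff. -/
lemma eventually_ne_P5 {x p : P5} (h : x ≠ p) : ∀ᶠ z in 𝓝 (x, p), z.1 ≠ z.2 := by
  obtain ⟨k, hk⟩ := exists_rep_ne_zero x
  obtain ⟨m, hm⟩ := exists_rep_ne_zero p
  have hs : ∀ (k : Fin 6) (x : P5), (fun j => ratio j k x) = (x.rep k)⁻¹ • x.rep := fun k x => by
    funext j
    simp [ratio]
    ring
  have hw : wedge (fun j => ratio j k x) (fun j => ratio j m p) ≠ 0 := by
    rw [hs, hs, wedge_smul_smul]
    exact smul_ne_zero (mul_ne_zero (inv_ne_zero hk) (inv_ne_zero hm))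
      (wedge_rep_ne_zero_iff.2 h)
  have hc : ContinuousAt (fun z : P5 × P5 =>
      wedge (fun j => ratio j k z.1) (fun j => ratio j m z.2)) (x, p) := by
    refine ContinuousAt.comp (f := fun z : P5 × P5 =>
      ((fun j => ratio j k z.1), (fun j => ratio j m z.2)))
      differentiable_wedge.continuous.continuousAt (ContinuousAt.prodMk ?_ ?_)
    · exact continuousAt_pi.2 fun j => ContinuousAt.comp (g := ratio j k)
        (f := fun z : P5 × P5 => z.1) (continuousAt_ratio j hk) continuousAt_fst
    · exact continuousAt_pi.2 fun j => ContinuousAt.comp (g := ratio j m)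
        (f := fun z : P5 × P5 => z.2) (continuousAt_ratio j hm) continuousAt_snd
  filter_upwards [hc.eventually_ne hw] with z hz e
  refine hz ?_
  rw [hs, hs, wedge_smul_smul, e, (wedge_eq_zero_iff z.2.rep_nonzero z.2.rep_nonzero).2 rfl,
    smul_zero]

instance : T2Space F2 := by
  have h : IsClosed (Set.diagonal F2) := by
    rw [← isOpen_compl_iff, isOpen_iff_mem_nhds]
    rintro ⟨x, p⟩ hxp
    have hxp' : x.1 ≠ p.1 := fun h => hxp (Subtype.ext h)
    have hc : Continuous fun z : F2 × F2 => (z.1.1, z.2.1) :=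
      (continuous_subtype_val.comp continuous_fst).prodMk
        (continuous_subtype_val.comp continuous_snd)
    filter_upwards [(hc.tendsto (x, p)).eventually (eventually_ne_P5 hxp')] with z hz e
    exact hz (congrArg Subtype.val (e : z.1 = z.2))
  exact t2_iff_isClosed_diagonal.2 h

lemma continuousAt_ctr (hc : ∀ i, ∀ q ∈ B, ContinuousAt (c i) q) (i : ι) {q : ℂ} (hq : q ∈ B) :
    ContinuousAt (ctr b c i) q :=
  ContinuousAt.comp (f := c i) (continuous_ch (b i)).continuousAt (hc i q hq)

lemma eventually_ne_ctr (hc : ∀ i, ∀ q ∈ B, ContinuousAt (c i) q) (i : ι)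
    {Z : Type*} [TopologicalSpace Z] {z : Z} {f : Z → ℂ} {g : Z → F2} (hf : ContinuousAt f z)
    (hg : ContinuousAt g z) (hz : f z ∈ B) (h : g z ≠ ctr b c i (f z)) :
    ∀ᶠ w in 𝓝 z, g w ≠ ctr b c i (f w) :=
  (hg.prodMk (ContinuousAt.comp (f := f) (continuousAt_ctr hc i hz) hf)).eventually
    (isClosed_diagonal.isOpen_compl.mem_nhds h)

lemma continuousAt_snd_fst (y : ℂ × Ambient ι) :
    ContinuousAt (fun y : ℂ × Ambient ι => y.2.1) y :=
  (continuous_fst.comp continuous_snd).continuousAt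

lemma mem_blowupCurves_of_lines {y : ℂ × Ambient ι} (hq : y.1 ∈ B)
    (h : ∀ i, IsLineThrough y.2.1 (ctr b c i y.1) (y.2.2 i)) : y ∈ blowupCurves B (ctr b c) :=
  ⟨hq, subset_closure ⟨hq, h⟩⟩

lemma isLineThrough_classOr {β : Bool} {a : ℂ × ℂ} {i : ι} {q : ℂ} (ℓ : PLines)
    (h : ch β a ≠ ctr b c i q) : IsLineThrough (ch β a).1 (ctr b c i q).1
      (classOr ℓ (wedge (cv β a) (cv (b i) (c i q)))) := by
  have hw : wedge (cv β a) (cv (b i) (c i q)) ≠ 0 := by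
    rw [Ne, wedge_eq_zero_iff (cv_ne_zero _ _) (cv_ne_zero _ _), ← ch_val, ← ch_val]
    exact fun e => h (Subtype.ext e)
  rw [ctr, ch_val, ch_val, isLineThrough_mk]
  exact ⟨hw, classOr_of_ne _ hw⟩

lemma wedge_ne_zero_of_ne {β : Bool} {a : ℂ × ℂ} {i : ι} {q : ℂ}
    (h : ch β a ≠ ctr b c i q) : wedge (cv β a) (cv (b i) (c i q)) ≠ 0 := by
  rw [Ne, wedge_eq_zero_iff (cv_ne_zero _ _) (cv_ne_zero _ _), ← ch_val, ← ch_val]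
  exact fun e => h (Subtype.ext e)

lemma IsLineThrough.unique {x p : P5} {ℓ ℓ' : PLines} (h : IsLineThrough x p ℓ)
    (h' : IsLineThrough x p ℓ') : ℓ = ℓ' := by
  obtain ⟨_, rfl⟩ := h
  obtain ⟨_, rfl⟩ := h'
  rfl

/-- Off the centres, q and the chart coordinates of the point are parameters and every line is
determined. The choice of i₀ is immaterial, since ψ ignores the line. -/
lemma hasParametrization_of_ne [Finite ι] [Nonempty ι] (hB : IsOpen B)
    (hd : ∀ i, ∀ q ∈ B, DifferentiableAt ℂ (c i) q) {X O₁ : Set (ℂ × Ambient ι)}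
    (hX : X = blowupCurves B (ctr b c) ∩ O₁) (hO₁ : IsOpen O₁) (x : X) {β : Bool}
    (hβ : InCh β x.1.2.1) (hne : ∀ i, x.1.2.1 ≠ ctr b c i x.1.1) :
    HasParametrization X x := by
  have hc : ∀ i, ∀ q ∈ B, ContinuousAt (c i) q := fun i q hq => (hd i q hq).continuousAt
  set O₀ : Set (ℂ × Ambient ι) :=
    {y | y.1 ∈ B ∧ InCh β y.2.1 ∧ ∀ i, y.2.1 ≠ ctr b c i y.1} with hO₀
  set W : Set (ℂ × ℂ × ℂ) := {w | w.1 ∈ B ∧ ∀ i, ch β w.2 ≠ ctr b c i w.1} with hWdef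
  have hO₀o : IsOpen O₀ := by
    refine isOpen_iff_mem_nhds.2 fun y ⟨h1, h2, h3⟩ => ?_
    filter_upwards [continuousAt_fst.eventually (hB.mem_nhds h1), eventually_inCh h2,
      eventually_all.2 fun i => eventually_ne_ctr hc i continuousAt_fst
        (continuousAt_snd_fst y) h1 (h3 i)] with z g1 g2 g3
    exact ⟨g1, g2, g3⟩
  have hWo : IsOpen W := by
    refine isOpen_iff_mem_nhds.2 fun w ⟨h1, h2⟩ => ?_
    filter_upwards [continuousAt_fst.eventually (hB.mem_nhds h1),
      eventually_all.2 fun i => eventually_ne_ctr hc i continuousAt_fst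
        ((continuous_ch β).comp continuous_snd).continuousAt h1 (h2 i)] with z g1 g2
    exact ⟨g1, g2⟩
  refine exists_parametrization (ℓ₀ := x.1.2.2) (β := β) (a := fun w => w.2)
    (N := fun i w => wedge (cv β w.2) (cv (b i) (c i w.1))) (W := W) (O₀ := O₀)
    (ψ := fun z => (z.1, z.2.1)) hX hO₁ x hO₀o ⟨(hX.subset x.2).1.1, hβ, hne⟩ hWo
    differentiable_snd.differentiableOn (fun i w hw => ?_)
    (fun i w hw => wedge_ne_zero_of_ne (hw.2 i)) (fun w hw => ⟨?_, ?_⟩) (Classical.arbitrary ι)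
    (fun w _ s _ => ⟨rfl, by fun_prop⟩) ?_ (fun y hy => ⟨?_, ?_⟩)
  · refine DifferentiableAt.differentiableWithinAt (DifferentiableAt.comp w
      (f := fun w : ℂ × ℂ × ℂ => (cv β w.2, cv (b i) (c i w.1)))
      differentiable_wedge.differentiableAt (DifferentiableAt.prodMk ?_ ?_))
    · exact ((differentiable_cv β).comp differentiable_snd).differentiableAt
    · exact DifferentiableAt.comp w (f := fun w : ℂ × ℂ × ℂ => c i w.1)
        (differentiable_cv _).differentiableAt
        (DifferentiableAt.comp w (f := fun w : ℂ × ℂ × ℂ => w.1) (hd i _ hw.1)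
          differentiableAt_fst)
  · exact mem_blowupCurves_of_lines hw.1 fun i => isLineThrough_classOr _ (hw.2 i)
  · exact ⟨hw.1, inCh_ch _ _, hw.2⟩
  · intro y hy
    exact (continuousAt_fst.prodMk (continuousAt_snd_crd hy.2.1)).continuousWithinAt
  · refine ⟨hy.2.1, fun i => ?_⟩
    simp only [ch_crd hy.2.2.1]
    exact hy.2.2.2 i
  · refine Prod.ext rfl (Prod.ext (ch_crd hy.2.2.1) (funext fun i => ?_))
    have h1 := isLineThrough_of_mem_blowupCurves hc hy.1 (hy.2.2.2 i)
    have h2 : ch β (crd β y.2.1) ≠ ctr b c i y.1 := by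
      rw [ch_crd hy.2.2.1]
      exact hy.2.2.2 i
    have h3 := isLineThrough_classOr (x.1.2.2 i) h2
    rw [ch_crd hy.2.2.1] at h3
    exact h3.unique h1

/-- The coordinate of a vector used to normalize a direction. -/
def piv (e : Bool) (d : ℂ × ℂ) : ℂ := cond e d.2 d.1

/-- The other coordinate of a vector. -/
def opp (e : Bool) (d : ℂ × ℂ) : ℂ := cond e d.1 d.2

/-- The normalized direction with a given slope. -/
def dvec (e : Bool) (m : ℂ) : ℂ × ℂ := cond e (m, 1) (1, m)

lemma piv_dvec (e : Bool) (m : ℂ) : piv e (dvec e m) = 1 := by cases e <;> rfl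

lemma opp_dvec (e : Bool) (m : ℂ) : opp e (dvec e m) = m := by cases e <;> rfl

lemma piv_smul (e : Bool) (s : ℂ) (d : ℂ × ℂ) : piv e (s • d) = s * piv e d := by
  cases e <;> rfl

lemma opp_smul (e : Bool) (s : ℂ) (d : ℂ × ℂ) : opp e (s • d) = s * opp e d := by
  cases e <;> rfl

lemma dvec_ne_zero (e : Bool) (m : ℂ) : dvec e m ≠ 0 := fun h => by
  have := piv_dvec e m
  rw [h] at this
  cases e <;> simp [piv] at this

lemma eq_piv_smul_dvec {e : Bool} {d : ℂ × ℂ} (h : piv e d ≠ 0) :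
    d = piv e d • dvec e (opp e d / piv e d) := by
  cases e <;> simp only [piv, cond_true, cond_false] at h <;>
    ext <;> simp [piv, opp, dvec] <;> field_simp

lemma exists_piv_ne_zero {d : ℂ × ℂ} (h : d ≠ 0) : ∃ e, piv e d ≠ 0 := by
  by_contra! h'
  exact h (Prod.ext (h' false) (h' true))

lemma differentiable_piv (e : Bool) : Differentiable ℂ (piv e) := by
  cases e
  · exact differentiable_fst
  · exact differentiable_snd

lemma differentiable_opp (e : Bool) : Differentiable ℂ (opp e) := by
  cases e
  · exact differentiable_snd
  · exact differentiable_fst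

lemma differentiable_dvec (e : Bool) : Differentiable ℂ (dvec e) := by
  cases e
  · exact (differentiable_const 1).prodMk differentiable_id
  · exact differentiable_id.prodMk (differentiable_const 1)

/-- The direction of a matrix representing a line, read off in a chart. -/
def vdirn (β : Bool) (L : Fin 6 × Fin 6 → ℂ) : ℂ × ℂ := (L (k1 β, k0 β), L (k2 β, k0 β))

lemma vdirn_secant (β : Bool) (c a d : ℂ × ℂ) : vdirn β (secant β c a d) = d :=
  Prod.ext (secant_fst β c a d) (secant_snd β c a d)

lemma vdirn_smul (β : Bool) (s : ℂ) (L : Fin 6 × Fin 6 → ℂ) :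
    vdirn β (s • L) = s • vdirn β L := rfl

lemma differentiable_vdirn (β : Bool) : Differentiable ℂ (vdirn β) := by
  unfold vdirn
  fun_prop

lemma continuousAt_opp_div_piv {e β : Bool} {y : ℂ × Ambient ι} {i : ι}
    (h : piv e (dirn β (y.2.2 i)) ≠ 0) : ContinuousAt (fun z : ℂ × Ambient ι =>
      opp e (dirn β (z.2.2 i)) / piv e (dirn β (z.2.2 i))) y := by
  cases e
  · exact continuousAt_snd_ratio (k2 β, k0 β) h
  · exact continuousAt_snd_ratio (k1 β, k0 β) h

lemma eventually_piv_ne_zero {e β : Bool} {y : ℂ × Ambient ι} {i : ι}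
    (h : piv e (dirn β (y.2.2 i)) ≠ 0) :
    ∀ᶠ z : ℂ × Ambient ι in 𝓝 y, piv e (dirn β (z.2.2 i)) ≠ 0 := by
  have hc : ContinuousAt (fun z : ℂ × Ambient ι => z.2.2 i) y :=
    ((continuous_apply i).comp (continuous_snd.comp continuous_snd)).continuousAt
  cases e
  · exact hc.eventually ((isOpen_rep_ne_zero (k1 β, k0 β)).mem_nhds h)
  · exact hc.eventually ((isOpen_rep_ne_zero (k2 β, k0 β)).mem_nhds h)

/-- On a blow-up, the displacement from a centre has the direction of the line. -/
lemma sub_eq_piv_smul_dvec (hc : ∀ i, ∀ q ∈ B, ContinuousAt (c i) q) {y : ℂ × Ambient ι}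
    (hy : y ∈ blowupCurves B (ctr b c)) {i : ι} (hx : InCh (b i) y.2.1) {e : Bool}
    (he : piv e (dirn (b i) (y.2.2 i)) ≠ 0) :
    crd (b i) y.2.1 - c i y.1 = piv e (crd (b i) y.2.1 - c i y.1) •
      dvec e (opp e (dirn (b i) (y.2.2 i)) / piv e (dirn (b i) (y.2.2 i))) := by
  by_cases h : y.2.1 = ctr b c i y.1
  · have h0 : crd (b i) y.2.1 - c i y.1 = 0 := by rw [h, ctr, crd_ch, sub_self]
    rw [h0]
    cases e <;> simp [piv]
  · have hl := isLineThrough_of_mem_blowupCurves hc hy h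
    rw [← ch_crd hx] at hl
    obtain ⟨k, hk⟩ := exists_rep_ne_zero (y.2.2 i)
    obtain ⟨r, -, h2⟩ := ratio_of_isLineThrough hl k
    have h3 : dirn (b i) (y.2.2 i) =
        ((y.2.2 i).rep k * r) • (crd (b i) y.2.1 - c i y.1) := by
      rw [mul_smul, ← h2]
      ext <;> simp [dirn, ratio] <;> field_simp
    rw [h3, piv_smul] at he
    rw [h3, piv_smul, opp_smul, mul_div_mul_left _ _ (left_ne_zero_of_mul he)]
    exact eq_piv_smul_dvec (right_ne_zero_of_mul he)

lemma mem_blowupCurves_of_eq_ctr [Finite ι] {y : ℂ × Ambient ι} (hq : y.1 ∈ B) {i : ι}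
    (hx : y.2.1 = ctr b c i y.1) {d : ℂ × ℂ} (hd : d ≠ 0)
    (hl : y.2.2 i = Projectivization.mk ℂ (secant (b i) (c i y.1) (c i y.1) d)
      (secant_ne_zero _ _ _ hd))
    (hk : ∀ k, k ≠ i → IsLineThrough y.2.1 (ctr b c k y.1) (y.2.2 k)) :
    y ∈ blowupCurves B (ctr b c) := by
  refine blowupPoints_subset_fibre (p := ctr b c) hq (closure_mono (fun _ hz => hz.2)
    (mem_closure_lines (p := fun k => ctr b c k y.1) (S := Set.univ) (E := fun _ => d)
      rfl hx hd hl hk continuousAt_const rfl fun _ _ => trivial))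

/-- This is the standard affine chart of a blow-up: parameters (q, s, m), the point c(q) + s · `dvec
e m`, and exceptional surface s = 0. The flag e selects the coordinate of the direction that is
normalized to 1. For i₀ the line is given by `secant`, since the wedge product vanishes at s = 0. -/
lemma hasParametrization_of_eq [Finite ι] (hB : IsOpen B)
    (hd : ∀ i, ∀ q ∈ B, DifferentiableAt ℂ (c i) q)
    (hinj : ∀ q ∈ B, Function.Injective fun i => ctr b c i q) {X O₁ : Set (ℂ × Ambient ι)}
    (hX : X = blowupCurves B (ctr b c) ∩ O₁) (hO₁ : IsOpen O₁) (x : X) {i₀ : ι}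
    (hi₀ : x.1.2.1 = ctr b c i₀ x.1.1) : HasParametrization X x := by
  classical
  have hc : ∀ i, ∀ q ∈ B, ContinuousAt (c i) q := fun i q hq => (hd i q hq).continuousAt
  have hxY : x.1 ∈ blowupCurves B (ctr b c) := (hX.subset x.2).1
  have hxne : ∀ i, i ≠ i₀ → x.1.2.1 ≠ ctr b c i x.1.1 := fun i hi h =>
    hi (hinj _ hxY.1 (h.symm.trans hi₀))
  obtain ⟨hd0, -⟩ := eq_mk_of_mem_blowupCurves hc hxY hi₀
  obtain ⟨e, he⟩ := exists_piv_ne_zero hd0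
  set β := b i₀ with hβ
  set a : ℂ × ℂ × ℂ → ℂ × ℂ := fun w => c i₀ w.1 + w.2.1 • dvec e w.2.2 with ha
  set N : ι → ℂ × ℂ × ℂ → Fin 6 × Fin 6 → ℂ := fun i w =>
    if i = i₀ then secant β (c i₀ w.1) (a w) (dvec e w.2.2)
    else wedge (cv β (a w)) (cv (b i) (c i w.1)) with hN
  have hN₀ : ∀ w, N i₀ w = secant β (c i₀ w.1) (a w) (dvec e w.2.2) := fun w => if_pos rfl
  have hN₁ : ∀ i, i ≠ i₀ → ∀ w, N i w = wedge (cv β (a w)) (cv (b i) (c i w.1)) :=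
    fun i hi w => if_neg hi
  set O₀ : Set (ℂ × Ambient ι) := {y | y.1 ∈ B ∧ InCh β y.2.1 ∧
    piv e (dirn β (y.2.2 i₀)) ≠ 0 ∧ ∀ i, i ≠ i₀ → y.2.1 ≠ ctr b c i y.1} with hO₀
  set W : Set (ℂ × ℂ × ℂ) :=
    {w | w.1 ∈ B ∧ ∀ i, i ≠ i₀ → ch β (a w) ≠ ctr b c i w.1} with hWdef
  have hcd : ∀ i, ∀ w : ℂ × ℂ × ℂ, w.1 ∈ B →
      DifferentiableAt ℂ (fun w : ℂ × ℂ × ℂ => c i w.1) w := fun i w hw =>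
    DifferentiableAt.comp w (f := fun w : ℂ × ℂ × ℂ => w.1) (hd i _ hw) differentiableAt_fst
  have hdv : Differentiable ℂ fun w : ℂ × ℂ × ℂ => dvec e w.2.2 :=
    (differentiable_dvec e).comp (differentiable_snd.comp differentiable_snd)
  have hsd : Differentiable ℂ fun w : ℂ × ℂ × ℂ => w.2.1 := by fun_prop
  have had : ∀ w : ℂ × ℂ × ℂ, w.1 ∈ B → DifferentiableAt ℂ a w := fun w hw =>
    (hcd i₀ w hw).add (hsd.differentiableAt.smul hdv.differentiableAt)
  have hO₀o : IsOpen O₀ := by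
    refine isOpen_iff_mem_nhds.2 fun y ⟨h1, h2, h3, h4⟩ => ?_
    have ev : ∀ᶠ z : ℂ × Ambient ι in 𝓝 y, ∀ i, i ≠ i₀ → z.2.1 ≠ ctr b c i z.1 := by
      refine eventually_all.2 fun i => ?_
      by_cases hi : i = i₀
      · simp [hi]
      · exact (eventually_ne_ctr hc i continuousAt_fst (continuousAt_snd_fst y) h1
          (h4 i hi)).mono fun _ h _ => h
    filter_upwards [continuousAt_fst.eventually (hB.mem_nhds h1), eventually_inCh h2,
      eventually_piv_ne_zero h3, ev] with z g1 g2 g3 g4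
    exact ⟨g1, g2, g3, g4⟩
  have hWo : IsOpen W := by
    refine isOpen_iff_mem_nhds.2 fun w ⟨h1, h2⟩ => ?_
    have hcw : ContinuousAt (fun w => ch β (a w)) w :=
      ContinuousAt.comp (f := a) (continuous_ch β).continuousAt (had w h1).continuousAt
    have ev : ∀ᶠ v in 𝓝 w, ∀ i, i ≠ i₀ → ch β (a v) ≠ ctr b c i v.1 := by
      refine eventually_all.2 fun i => ?_
      by_cases hi : i = i₀
      · simp [hi]
      · exact (eventually_ne_ctr hc i continuousAt_fst hcw h1 (h2 i hi)).mono fun _ h _ => h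
    filter_upwards [continuousAt_fst.eventually (hB.mem_nhds h1), ev] with z g1 g2
    exact ⟨g1, g2⟩
  have hmem : ∀ w ∈ W, paramMap x.1.2.2 β a N w ∈ blowupCurves B (ctr b c) := by
    intro w hw
    have hk : ∀ k, k ≠ i₀ → IsLineThrough (paramMap x.1.2.2 β a N w).2.1
        (ctr b c k (paramMap x.1.2.2 β a N w).1) ((paramMap x.1.2.2 β a N w).2.2 k) := by
      intro k hk
      simp only [paramMap, hN₁ k hk]
      exact isLineThrough_classOr _ (hw.2 k hk)
    -- On the exceptional surface the point does not determine the line, and membership comes from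
    -- approximation along an arc within the fibre.
    by_cases hs : w.2.1 = 0
    · have ha0 : a w = c i₀ w.1 := by simp [ha, hs]
      refine mem_blowupCurves_of_eq_ctr hw.1 (i := i₀) ?_ (dvec_ne_zero e w.2.2) ?_ hk
      · simp only [paramMap, ha0]
        rfl
      · simp only [paramMap, hN₀, ha0]
        exact classOr_of_ne _ _
    · refine mem_blowupCurves_of_lines hw.1 fun k => ?_
      by_cases hki : k = i₀
      · subst hki
        simp only [paramMap, hN₀, classOr_of_ne _ (secant_ne_zero _ _ _ (dvec_ne_zero e w.2.2))]
        exact isLineThrough_secant hs (dvec_ne_zero e w.2.2)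
      · exact hk k hki
  -- Here s is the pivot coordinate of the displacement from the moving centre, and m is a ratio of
  -- direction coordinates, hence independent of the scaling of the line.
  refine exists_parametrization (ℓ₀ := x.1.2.2) (β := β) (a := a) (N := N) (W := W) (O₀ := O₀)
    (ψ := fun z => (z.1, piv e (z.2.1 - c i₀ z.1),
      opp e (vdirn β z.2.2) / piv e (vdirn β z.2.2)))
    hX hO₁ x hO₀o ⟨hxY.1, inCh_ctr hi₀, he, hxne⟩ hWo
    (fun w hw => (had w hw.1).differentiableWithinAt) (fun i w hw => ?_)
    (fun i w hw => ?_) (fun w hw => ⟨hmem w hw, ?_⟩) i₀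
    (fun w hw s hs => ⟨?_, ?_⟩) ?_ ?_
  · refine DifferentiableAt.differentiableWithinAt ?_
    by_cases hi : i = i₀
    · subst hi
      have : N i = fun w => secant β (c i w.1) (a w) (dvec e w.2.2) := funext hN₀
      rw [this]
      exact DifferentiableAt.comp w
        (f := fun w : ℂ × ℂ × ℂ => (c i w.1, a w, dvec e w.2.2))
        (differentiable_secant β).differentiableAt
        ((hcd i w hw.1).prodMk ((had w hw.1).prodMk hdv.differentiableAt))
    · have : N i = fun w => wedge (cv β (a w)) (cv (b i) (c i w.1)) := funext (hN₁ i hi)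
      rw [this]
      exact DifferentiableAt.comp w
        (f := fun w : ℂ × ℂ × ℂ => (cv β (a w), cv (b i) (c i w.1)))
        differentiable_wedge.differentiableAt
        ((DifferentiableAt.comp w (f := a) (differentiable_cv _).differentiableAt
          (had w hw.1)).prodMk (DifferentiableAt.comp w (f := fun w : ℂ × ℂ × ℂ => c i w.1)
          (differentiable_cv _).differentiableAt (hcd i w hw.1)))
  · by_cases hi : i = i₀
    · subst hi
      rw [hN₀]
      exact secant_ne_zero _ _ _ (dvec_ne_zero _ _)
    · rw [hN₁ i hi]
      exact wedge_ne_zero_of_ne (hw.2 i hi)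
  · refine ⟨hw.1, inCh_ch _ _, ?_, hw.2⟩
    have hne := secant_ne_zero β (c i₀ w.1) (a w) (dvec_ne_zero e w.2.2)
    obtain ⟨s, hs, hs'⟩ := exists_rep_mk _ hne
    have h2 : dirn β (classOr (x.1.2.2 i₀) (N i₀ w)) = s • dvec e w.2.2 := by
      rw [hN₀, classOr_of_ne _ hne]
      change vdirn β (Projectivization.rep _) = _
      rw [hs', vdirn_smul, vdirn_secant]
    change piv e (dirn β (classOr (x.1.2.2 i₀) (N i₀ w))) ≠ 0
    rw [h2, piv_smul, piv_dvec, mul_one]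
    exact hs
  · simp only [hN₀, vdirn_smul, vdirn_secant, piv_smul, opp_smul, piv_dvec, opp_dvec]
    refine Prod.ext rfl (Prod.ext ?_ ?_)
    · simp only [ha, add_sub_cancel_left, piv_smul, piv_dvec, mul_one]
    · simp only [mul_one]
      field_simp
  · have hv : DifferentiableAt ℂ (fun z : ℂ × (ℂ × ℂ) × (Fin 6 × Fin 6 → ℂ) => vdirn β z.2.2)
        (w.1, a w, s • N i₀ w) :=
      ((differentiable_vdirn β).comp (differentiable_snd.comp differentiable_snd)).differentiableAt
    have hcz : DifferentiableAt ℂ (fun z : ℂ × (ℂ × ℂ) × (Fin 6 × Fin 6 → ℂ) => c i₀ z.1)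
        (w.1, a w, s • N i₀ w) :=
      DifferentiableAt.comp (g := c i₀) (f := fun z : ℂ × (ℂ × ℂ) × (Fin 6 × Fin 6 → ℂ) => z.1)
        _ (hd i₀ _ hw.1) differentiableAt_fst
    have hsub : DifferentiableAt ℂ
        (fun z : ℂ × (ℂ × ℂ) × (Fin 6 × Fin 6 → ℂ) => z.2.1 - c i₀ z.1)
        (w.1, a w, s • N i₀ w) := DifferentiableAt.sub (by fun_prop) hcz
    have hp : DifferentiableAt ℂ
        (fun z : ℂ × (ℂ × ℂ) × (Fin 6 × Fin 6 → ℂ) => piv e (vdirn β z.2.2))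
        (w.1, a w, s • N i₀ w) :=
      DifferentiableAt.comp _ (differentiable_piv e).differentiableAt hv
    have ho : DifferentiableAt ℂ
        (fun z : ℂ × (ℂ × ℂ) × (Fin 6 × Fin 6 → ℂ) => opp e (vdirn β z.2.2))
        (w.1, a w, s • N i₀ w) :=
      DifferentiableAt.comp _ (differentiable_opp e).differentiableAt hv
    have hp0 : piv e (vdirn β (s • N i₀ w)) ≠ 0 := by
      simp only [hN₀, vdirn_smul, vdirn_secant, piv_smul, piv_dvec, mul_one]
      exact hs
    refine differentiableAt_fst.prodMk (DifferentiableAt.prodMk ?_ ?_)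
    · exact DifferentiableAt.comp _ (differentiable_piv e).differentiableAt hsub
    · simp only [div_eq_mul_inv]
      exact ho.mul (hp.inv hp0)
  · intro y hy
    have hcy : ContinuousAt (fun y : ℂ × Ambient ι => c i₀ y.1) y :=
      ContinuousAt.comp (f := fun y : ℂ × Ambient ι => y.1) (hc i₀ _ hy.1) continuousAt_fst
    refine ContinuousAt.continuousWithinAt (continuousAt_fst.prodMk
      (ContinuousAt.prodMk ?_ (continuousAt_opp_div_piv hy.2.2.1)))
    exact ContinuousAt.comp (f := fun y : ℂ × Ambient ι => crd β y.2.1 - c i₀ y.1)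
      (differentiable_piv e).continuous.continuousAt ((continuousAt_snd_crd hy.2.1).sub hcy)
  · rintro y ⟨hy, h1, h2, h3, h4⟩
    have hsub := sub_eq_piv_smul_dvec hc hy h2 h3
    have haw : a (y.1, piv e (crd β y.2.1 - c i₀ y.1),
        opp e (vdirn β (y.2.2 i₀).rep) / piv e (vdirn β (y.2.2 i₀).rep)) = crd β y.2.1 := by
      change c i₀ y.1 + _ = _
      refine (congrArg (c i₀ y.1 + ·) hsub.symm).trans ?_
      exact add_sub_cancel _ _
    have hch : ch β (a (y.1, piv e (crd β y.2.1 - c i₀ y.1),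
        opp e (vdirn β (y.2.2 i₀).rep) / piv e (vdirn β (y.2.2 i₀).rep))) = y.2.1 := by
      rw [haw, ch_crd h2]
    refine ⟨⟨h1, fun i hi => ?_⟩, Prod.ext rfl (Prod.ext hch (funext fun i => ?_))⟩
    · rw [hch]
      exact h4 i hi
    · by_cases hi : i = i₀
      · subst hi
        have hne := secant_ne_zero β (c i y.1) (crd β y.2.1)
          (dvec_ne_zero e (opp e (dirn β (y.2.2 i)) / piv e (dirn β (y.2.2 i))))
        have hrep := rep_eq_of_mem_blowupCurves hc hy h2
        simp only [paramMap, hN₀, haw]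
        refine (classOr_of_ne _ hne).trans ?_
        refine Eq.trans ?_ (eq_mk_of_rep_eq hrep).symm
        refine (mk_eq_of_smul _ _ (piv e (dirn β (y.2.2 i))) ?_).symm
        rw [← secant_smul, ← eq_piv_smul_dvec h3]
      · have hl := isLineThrough_of_mem_blowupCurves hc hy (h4 i hi)
        have h5 : ch β (crd β y.2.1) ≠ ctr b c i y.1 := by
          rw [ch_crd h2]
          exact h4 i hi
        have h6 := isLineThrough_classOr (x.1.2.2 i) h5
        rw [ch_crd h2] at h6
        simp only [paramMap, hN₁ i hi, haw]
        exact h6.unique hl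

/-- An open part of a blow-up, lying over the two charts, is smooth over the base. -/
theorem isSmoothFamily_of_isOpen [Finite ι] [Nonempty ι] (hB : IsOpen B)
    (hd : ∀ i, ∀ q ∈ B, DifferentiableAt ℂ (c i) q)
    (hinj : ∀ q ∈ B, Function.Injective fun i => ctr b c i q) {X O₁ : Set (ℂ × Ambient ι)}
    (hX : X = blowupCurves B (ctr b c) ∩ O₁) (hO₁ : IsOpen O₁)
    (hH : ∀ y ∈ X, y.2.1 ∉ lineH) : IsSmoothFamily X := by
  intro x
  by_cases h : ∃ i, x.1.2.1 = ctr b c i x.1.1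
  · obtain ⟨i, hi⟩ := h
    exact hasParametrization_of_eq hB hd hinj hX hO₁ x hi
  · obtain ⟨β, hβ⟩ := exists_inCh_of_notMem_lineH (hH _ x.2)
    exact hasParametrization_of_ne hB hd hX hO₁ x hβ (not_exists.1 h)

end Smooth

/-- Strict transforms are closed relative to the base, so Ω_t is open in the blow-up. The preimage
of ℋ lies in its strict transform, so Ω_t avoids it and the charts 0 and 2 suffice. -/
lemma isSmoothFamily_Omega (θ : Place → ℂ) (t : ℂ) : IsSmoothFamily (Omega θ t) := by
  have hcl : ∀ S : Set (ℂ × F2), ∃ F : Set (ℂ × Ambient (Place × Sgn)), IsClosed F ∧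
      strictCurves (base θ t) (ctr bb (cc θ t)) S = {y | y.1 ∈ base θ t} ∩ F := fun S =>
    ⟨_, isClosed_closure, rfl⟩
  obtain ⟨F1, hF1, e1⟩ := hcl (cylinder lineH)
  obtain ⟨F2, hF2, e2⟩ := hcl (surfaceC t)
  obtain ⟨F3, hF3, e3⟩ := hcl (cylinder (lineD 0))
  obtain ⟨F4, hF4, e4⟩ := hcl (cylinder lineDinf)
  have : Nonempty (Place × Sgn) := ⟨(.zero, .plus)⟩
  refine isSmoothFamily_of_isOpen (b := bb) (c := cc θ t) (O₁ := (F1 ∪ F2 ∪ F3 ∪ F4)ᶜ)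
    (isOpen_base θ t) (fun k q hq => differentiableAt_cc θ t k hq.1 hq.2.1)
    (fun q hq => injective_of_mem_base hq) ?_
    (((hF1.union hF2).union hF3).union hF4).isOpen_compl fun y hy hH => ?_
  · ext y
    simp only [Omega, confPoint_eq, e1, e2, e3, e4, Set.mem_sdiff, Set.mem_inter_iff,
      Set.mem_compl_iff, Set.mem_union, Set.mem_ofPred_eq]
    refine and_congr_right fun hy => ?_
    have hy1 : y.1 ∈ base θ t := hy.1
    simp only [hy1, true_and]
  · rw [Omega, confPoint_eq] at hy
    exact hy.2 (Or.inl (Or.inl (Or.inl (strictPoints_subset_fibre hy.1.1 (fun _ hx => hx)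
      (mem_strictPoints_lineH (q := y.1) (y := y.2) hy.1 hH)))))

/-! ### Irreducible components of `𝒞(1)` -/

/-- An irreducible subset of a finite union of closed sets lies in one of them; three irreducible
closed sets without inclusions are therefore the maximal ones. -/
lemma setOf_maximal_irreducible_union {Y : Type*} [TopologicalSpace Y] {A B C : Set Y}
    (hA : IsIrreducible A) (hB : IsIrreducible B) (hC : IsIrreducible C) (hA' : IsClosed A)
    (hB' : IsClosed B) (hC' : IsClosed C) (hAB : ¬A ⊆ B) (hAC : ¬A ⊆ C) (hBA : ¬B ⊆ A)
    (hBC : ¬B ⊆ C) (hCA : ¬C ⊆ A) (hCB : ¬C ⊆ B) :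
    {Z | Maximal (fun Y : Set Y => IsIrreducible Y ∧ Y ⊆ A ∪ B ∪ C) Z} = {A, B, C} := by
  have key : ∀ Z : Set Y, IsIrreducible Z → Z ⊆ A ∪ B ∪ C → Z ⊆ A ∨ Z ⊆ B ∨ Z ⊆ C := by
    intro Z hZ hs
    have h := isPreirreducible_iff_isClosed_union_isClosed.1 hZ.2
    rcases h _ _ (hA'.union hB') hC' hs with h1 | h1
    · rcases h _ _ hA' hB' h1 with h2 | h2
      · exact Or.inl h2
      · exact Or.inr (Or.inl h2)
    · exact Or.inr (Or.inr h1)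
  have sA : A ⊆ A ∪ B ∪ C := fun _ h => Or.inl (Or.inl h)
  have sB : B ⊆ A ∪ B ∪ C := fun _ h => Or.inl (Or.inr h)
  have sC : C ⊆ A ∪ B ∪ C := fun _ h => Or.inr h
  ext Z
  simp only [Set.mem_ofPred_eq, Set.mem_insert_iff, Set.mem_singleton_iff]
  constructor
  · intro hZ
    rcases key Z hZ.1.1 hZ.1.2 with h | h | h
    · exact Or.inl (h.antisymm (hZ.2 ⟨hA, sA⟩ h))
    · exact Or.inr (Or.inl (h.antisymm (hZ.2 ⟨hB, sB⟩ h)))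
    · exact Or.inr (Or.inr (h.antisymm (hZ.2 ⟨hC, sC⟩ h)))
  · rintro (rfl | rfl | rfl)
    · refine ⟨⟨hA, sA⟩, fun W hW hle => ?_⟩
      rcases key W hW.1 hW.2 with h | h | h
      · exact h
      · exact (hAB (hle.trans h)).elim
      · exact (hAC (hle.trans h)).elim
    · refine ⟨⟨hB, sB⟩, fun W hW hle => ?_⟩
      rcases key W hW.1 hW.2 with h | h | h
      · exact (hBA (hle.trans h)).elim
      · exact h
      · exact (hBC (hle.trans h)).elim
    · refine ⟨⟨hC, sC⟩, fun W hW hle => ?_⟩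
      rcases key W hW.1 hW.2 with h | h | h
      · exact (hCA (hle.trans h)).elim
      · exact (hCB (hle.trans h)).elim
      · exact h

/-- A union of two affine lines glued along their punctured parts is irreducible. -/
lemma isIrreducible_of_two_lines {Y : Type*} [TopologicalSpace Y] {γ₁ γ₂ : ℂ → Y}
    (h₁ : ∀ U, IsOpen U → γ₁ ⁻¹' U = ∅ ∨ (γ₁ ⁻¹' U)ᶜ.Finite)
    (h₂ : ∀ U, IsOpen U → γ₂ ⁻¹' U = ∅ ∨ (γ₂ ⁻¹' U)ᶜ.Finite)
    (h : ∀ s, s ≠ 0 → γ₂ s = γ₁ (1 / s)) : IsIrreducible (Set.range γ₁ ∪ Set.range γ₂) := by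
  have key : ∀ U, IsOpen U → ((Set.range γ₁ ∪ Set.range γ₂) ∩ U).Nonempty →
      (γ₁ ⁻¹' U)ᶜ.Finite := by
    rintro U hU ⟨_, ⟨s, rfl⟩ | ⟨s, rfl⟩, hs⟩
    · refine (h₁ U hU).resolve_left fun h0 => ?_
      have : s ∈ γ₁ ⁻¹' U := hs
      rw [h0] at this
      exact this
    · have hf : (γ₂ ⁻¹' U)ᶜ.Finite := (h₂ U hU).resolve_left fun h0 => by
        have : s ∈ γ₂ ⁻¹' U := hs
        rw [h0] at this
        exact this
      obtain ⟨r, hr⟩ := (hf.union (Set.finite_singleton 0)).exists_notMem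
      rw [Set.mem_union, not_or, Set.notMem_compl_iff] at hr
      refine (h₁ U hU).resolve_left fun h0 => ?_
      have : 1 / r ∈ γ₁ ⁻¹' U := by
        change γ₁ (1 / r) ∈ U
        rw [← h r hr.2]
        exact hr.1
      rw [h0] at this
      exact this
  refine ⟨⟨γ₁ 0, Or.inl ⟨0, rfl⟩⟩, fun U V hU hV hSU hSV => ?_⟩
  obtain ⟨r, hr⟩ := ((key U hU hSU).union (key V hV hSV)).exists_notMem
  rw [Set.mem_union, not_or, Set.notMem_compl_iff, Set.notMem_compl_iff] at hr
  exact ⟨γ₁ r, Or.inl ⟨r, rfl⟩, hr.1, hr.2⟩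

-- Along a polynomial curve a polynomial in two variables becomes one in a single variable, so it
-- vanishes identically or at finitely many parameters. The alternative is stable under finite
-- intersections and arbitrary unions, so it passes from the generating sets to all open sets.
open Polynomial in
lemma preimage_eq_empty_or_finite_compl (p₁ p₂ : ℂ[X]) {U : Set (ℂ × ℂ)}
    (hU : IsOpen[zariskiPlane] U) :
    (fun s => (p₁.eval s, p₂.eval s)) ⁻¹' U = ∅ ∨
      ((fun s => (p₁.eval s, p₂.eval s)) ⁻¹' U)ᶜ.Finite := by
  induction hU with
  | basic V hV =>
    obtain ⟨f, rfl⟩ := hV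
    have he : ∀ s : ℂ, MvPolynomial.eval ![p₁.eval s, p₂.eval s] f =
        (MvPolynomial.aeval ![p₁, p₂] f).eval s := by
      intro s
      rw [← Polynomial.coe_evalRingHom, MvPolynomial.aeval_def, MvPolynomial.hom_eval₂,
        MvPolynomial.eval, MvPolynomial.coe_eval₂Hom]
      congr 1
      · ext z; simp
      · funext i; fin_cases i <;> simp
    by_cases h0 : MvPolynomial.aeval ![p₁, p₂] f = 0
    · left
      ext s
      simp [he, h0]
    · right
      refine ((MvPolynomial.aeval ![p₁, p₂] f).roots.toFinset.finite_toSet).subset fun s hs => ?_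
      simpa [he, h0] using hs
  | univ => right; simp
  | inter V V' _ _ h h' =>
    rcases h with h | h
    · left
      rw [Set.preimage_inter, h, Set.empty_inter]
    · rcases h' with h' | h'
      · left
        rw [Set.preimage_inter, h', Set.inter_empty]
      · right
        rw [Set.preimage_inter, Set.compl_inter]
        exact h.union h'
  | sUnion 𝒮 _ h =>
    by_cases hS : ∃ V ∈ 𝒮, ((fun s => (p₁.eval s, p₂.eval s)) ⁻¹' V)ᶜ.Finite
    · obtain ⟨V, hV, hf⟩ := hS
      right
      exact hf.subset (Set.compl_subset_compl.2
        (Set.preimage_mono (Set.subset_sUnion_of_mem hV)))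
    · left
      push Not at hS
      rw [Set.sUnion_eq_biUnion, Set.preimage_iUnion₂]
      simp only [Set.iUnion_eq_empty]
      exact fun V hV => (h V hV).resolve_right (hS V hV)

lemma isOpen_zariskiF2_iff {U : Set F2} :
    IsOpen[zariskiF2] U ↔ ∀ i, IsOpen[zariskiPlane] (chart i ⁻¹' U) := by
  rw [isOpen_iSup_iff]
  rfl

open Polynomial in
lemma chart_preimage_eq_empty_or_finite_compl (i : Fin 4) (p₁ p₂ : ℂ[X]) (U : Set F2)
    (hU : IsOpen[zariskiF2] U) :
    (fun s => chart i (p₁.eval s, p₂.eval s)) ⁻¹' U = ∅ ∨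
      ((fun s => chart i (p₁.eval s, p₂.eval s)) ⁻¹' U)ᶜ.Finite :=
  preimage_eq_empty_or_finite_compl p₁ p₂ (isOpen_zariskiF2_iff.1 hU i)

lemma lineH_eq : lineH =
    Set.range (fun s : ℂ => chart 1 (s, 0)) ∪ Set.range fun s : ℂ => chart 3 (s, 0) := by
  unfold lineH
  congr 1
  all_goals
    ext x
    constructor
    · rintro ⟨⟨u, v⟩, hv, rfl⟩
      simp only [Set.mem_ofPred_eq] at hv
      exact ⟨u, by rw [hv]⟩
    · rintro ⟨s, rfl⟩
      exact ⟨(s, 0), rfl, rfl⟩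

lemma lineD_eq (c : ℂ) : lineD c =
    Set.range (fun s : ℂ => chart 0 (c, s)) ∪ Set.range fun s : ℂ => chart 1 (c, s) := by
  unfold lineD
  congr 1
  all_goals
    ext x
    constructor
    · rintro ⟨⟨u, v⟩, hv, rfl⟩
      simp only [Set.mem_ofPred_eq] at hv
      exact ⟨v, by rw [hv]⟩
    · rintro ⟨s, rfl⟩
      exact ⟨(c, s), rfl, rfl⟩

open Polynomial in
lemma isIrreducible_lineH : @IsIrreducible F2 zariskiF2 lineH := by
  rw [lineH_eq]
  refine @isIrreducible_of_two_lines F2 zariskiF2 _ _ (fun U hU => ?_) (fun U hU => ?_)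
    fun s hs => ?_
  · simpa using chart_preimage_eq_empty_or_finite_compl 1 X 0 U hU
  · simpa using chart_preimage_eq_empty_or_finite_compl 3 X 0 U hU
  · simpa using chart_three_eq_one 0 hs

open Polynomial in
lemma isIrreducible_lineD (c : ℂ) : @IsIrreducible F2 zariskiF2 (lineD c) := by
  rw [lineD_eq]
  refine @isIrreducible_of_two_lines F2 zariskiF2 _ _ (fun U hU => ?_) (fun U hU => ?_)
    fun s hs => ?_
  · simpa using chart_preimage_eq_empty_or_finite_compl 0 (C c) X U hU
  · simpa using chart_preimage_eq_empty_or_finite_compl 1 (C c) X U hU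
  · have := chart_one_eq c (1 / s) (one_div_ne_zero hs)
    rwa [one_div_one_div] at this

/-! ### Zariski closedness of ℋ and 𝒟_c -/

lemma exists_chartVec_eq_eval (i : Fin 4) (k : Fin 6) : ∃ f : MvPolynomial (Fin 2) ℂ,
    ∀ a : ℂ × ℂ, MvPolynomial.eval ![a.1, a.2] f = chartVec i a k := by
  let P : Fin 4 → Fin 6 → MvPolynomial (Fin 2) ℂ := fun i => match i with
    | 0 => ![.X 0 ^ 3, .X 0 ^ 2, .X 0, 1, .X 0 * .X 1, .X 1]
    | 1 => ![.X 0 ^ 3 * .X 1, .X 0 ^ 2 * .X 1, .X 0 * .X 1, .X 1, .X 0, 1]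
    | 2 => ![1, .X 0, .X 0 ^ 2, .X 0 ^ 3, .X 1, .X 0 * .X 1]
    | 3 => ![.X 1, .X 0 * .X 1, .X 0 ^ 2 * .X 1, .X 0 ^ 3 * .X 1, 1, .X 0]
  refine ⟨P i k, fun a => ?_⟩
  fin_cases i
  all_goals fin_cases k <;> simp [P, chartVec]

/-- In each chart the homogeneous coordinates are, up to a nonzero factor, polynomials in the chart
coordinates, so the complement is a basic open set there. -/
lemma isClosed_zariski_linear (α : Fin 6 → ℂ) :
    IsClosed[zariskiF2] {x : F2 | ∑ k, α k * x.1.rep k = 0} := by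
  refine (@isOpen_compl_iff _ _ zariskiF2).1 (isOpen_zariskiF2_iff.2 fun i => ?_)
  choose f hf using exists_chartVec_eq_eval i
  refine TopologicalSpace.isOpen_generateFrom_of_mem ⟨∑ k, MvPolynomial.C (α k) * f k, ?_⟩
  ext a
  obtain ⟨r, hr, h⟩ := rep_chart i a
  have e : ∑ k, α k * (chart i a).1.rep k = r * ∑ k, α k * chartVec i a k := by
    rw [h, Finset.mul_sum]
    exact Finset.sum_congr rfl fun k _ => by simp; ring
  simp only [Set.mem_preimage, Set.mem_compl_iff, Set.mem_ofPred_eq, e, map_sum, map_mul,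
    MvPolynomial.eval_C, hf, mul_eq_zero, hr, false_or, ne_eq]

lemma isClosed_zariski_lineH : IsClosed[zariskiF2] lineH := by
  have h1 := isClosed_zariski_linear ![1, 0, 0, 0, 0, 0]
  have h2 := isClosed_zariski_linear ![0, 0, 0, 1, 0, 0]
  convert @IsClosed.inter _ _ _ zariskiF2 h1 h2 using 1
  ext x
  simp [mem_lineH_iff, Fin.sum_univ_six]

lemma isClosed_zariski_lineD (c : ℂ) : IsClosed[zariskiF2] (lineD c) := by
  have h1 := isClosed_zariski_linear ![1, -c, 0, 0, 0, 0]
  have h2 := isClosed_zariski_linear ![0, 1, -c, 0, 0, 0]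
  have h3 := isClosed_zariski_linear ![0, 0, 1, -c, 0, 0]
  have h4 := isClosed_zariski_linear ![0, 0, 0, 0, 1, -c]
  convert @IsClosed.inter _ _ _ zariskiF2 h1 (@IsClosed.inter _ _ _ zariskiF2 h2
    (@IsClosed.inter _ _ _ zariskiF2 h3 h4)) using 1
  ext x
  simp [mem_lineD_iff, Fin.sum_univ_six, ← sub_eq_add_neg, sub_eq_zero]

/-! ### The three lines as the components of 𝒞(1) -/

lemma not_lineD_subset_lineH (c : ℂ) : ¬lineD c ⊆ lineH := fun h =>
  ch_notMem_lineH false (c, 0) (h (ch_false_mem_lineD_iff.2 rfl))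

lemma not_lineH_subset_lineD (c : ℂ) : ¬lineH ⊆ lineD c := fun h => by
  have h1 : chart 1 (c + 1, 0) ∈ lineD c := h (Or.inl ⟨_, rfl, rfl⟩)
  obtain ⟨r, hr, e⟩ := rep_chart 1 (c + 1, 0)
  rw [mem_lineD_iff, e] at h1
  have h2 := h1.2.2.2
  simp [chartVec] at h2
  exact hr (by linear_combination h2)

lemma not_lineD_subset_lineD {c d : ℂ} (h : c ≠ d) : ¬lineD c ⊆ lineD d := fun hs =>
  by
  have h1 : ch false (c, 0) ∈ lineD c := ch_false_mem_lineD_iff.2 rfl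
  exact h (ch_false_mem_lineD_iff.1 (hs h1))

lemma setOf_isIrredComponent {t : ℂ} (ht : t ≠ 1) :
    {Z | IsIrredComponent (lineH ∪ lineD 1 ∪ lineD t) Z} = {lineH, lineD 1, lineD t} :=
  @setOf_maximal_irreducible_union F2 zariskiF2 _ _ _ isIrreducible_lineH
    (isIrreducible_lineD 1) (isIrreducible_lineD t) isClosed_zariski_lineH
    (isClosed_zariski_lineD 1) (isClosed_zariski_lineD t) (not_lineH_subset_lineD 1)
    (not_lineH_subset_lineD t) (not_lineD_subset_lineH 1) (not_lineD_subset_lineD ht.symm)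
    (not_lineD_subset_lineH t) (not_lineD_subset_lineD ht)

lemma ncard_components {t : ℂ} (ht : t ≠ 1) :
    ({lineH, lineD 1, lineD t} : Set (Set F2)).ncard = 3 := by
  refine Set.ncard_eq_three.2 ⟨lineH, lineD 1, lineD t, fun h => ?_, fun h => ?_, fun h => ?_, rfl⟩
  · exact not_lineH_subset_lineD 1 h.subset
  · exact not_lineH_subset_lineD t h.subset
  · exact not_lineD_subset_lineD ht.symm h.subset

end

end OkamotoConfluence

/-! ### The theorem -/

theorem mainTheorem5 (θ : OkamotoConfluence.Place → ℂ)
    (h0 : θ .zero ≠ 0) (h1 : θ .one ≠ 0) (ht : θ .t ≠ 0) (hinf : θ .infty ≠ 1) :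
    -- the fibre at `q = 1`
    (∀ t : ℂ, t ≠ 0 → t ≠ 1 →
      OkamotoConfluence.fibre (OkamotoConfluence.Omega θ t) 1 = OkamotoConfluence.Oka θ t) ∧
    -- the fibre at a generic `q = q₀`
    (∀ t q₀ : ℂ, t ≠ 0 → q₀ ≠ 0 → q₀ ≠ 1 →
      (∀ i, OkamotoConfluence.confTheta θ q₀ i ≠ 0) →
      OkamotoConfluence.IsGenericTheta q₀ (OkamotoConfluence.confTheta θ q₀) →
      t ∉ OkamotoConfluence.exceptionalSet q₀ (OkamotoConfluence.confTheta θ q₀) →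
      OkamotoConfluence.fibre (OkamotoConfluence.Omega θ t) q₀ =
        OkamotoConfluence.qOkaMod q₀ (OkamotoConfluence.confTheta θ q₀) t) ∧
    -- the degeneration of the surface `𝒞` at `q = 1`
    (∀ t : ℂ, t ≠ 0 → t ≠ 1 →
      {x | ((1 : ℂ), x) ∈ OkamotoConfluence.surfaceC t} =
        OkamotoConfluence.lineH ∪ OkamotoConfluence.lineD 1 ∪ OkamotoConfluence.lineD t ∧
      {Z | OkamotoConfluence.IsIrredComponent
          {x | ((1 : ℂ), x) ∈ OkamotoConfluence.surfaceC t} Z} =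
        {OkamotoConfluence.lineH, OkamotoConfluence.lineD 1, OkamotoConfluence.lineD t} ∧
      ({OkamotoConfluence.lineH, OkamotoConfluence.lineD 1, OkamotoConfluence.lineD t} :
        Set (Set OkamotoConfluence.F2)).ncard = 3) ∧
    -- the fibres fit together smoothly, over a neighbourhood of `q = 1` if `t ≠ 0, 1`
    (∀ t : ℂ, t ≠ 0 → OkamotoConfluence.IsSmoothFamily (OkamotoConfluence.Omega θ t)) ∧
    (∀ t : ℂ, t ≠ 0 → t ≠ 1 → OkamotoConfluence.base θ t ∈ 𝓝 (1 : ℂ)) := by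
  have hC : ∀ t : ℂ, {x | ((1 : ℂ), x) ∈ OkamotoConfluence.surfaceC t} =
      OkamotoConfluence.lineH ∪ OkamotoConfluence.lineD 1 ∪ OkamotoConfluence.lineD t :=
    OkamotoConfluence.curveC_one
  refine ⟨fun t ht0 ht1 => ?_, fun t q₀ ht0 hq0 hq1 hΘ hg hs => ?_, fun t ht0 ht1 => ?_,
    fun t _ => OkamotoConfluence.isSmoothFamily_Omega θ t,
    fun t ht0 ht1 => OkamotoConfluence.base_mem_nhds h0 h1 ht hinf ht0 ht1⟩
  · exact OkamotoConfluence.fibre_Omega_one ht0 ht1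
      (OkamotoConfluence.one_mem_base h0 h1 ht hinf ht0 ht1)
  · exact OkamotoConfluence.fibre_Omega ht0 hq1
      (OkamotoConfluence.mem_base_of_generic h0 ht0 hq0 hΘ hg hs)
  · rw [hC t]
    exact ⟨rfl, OkamotoConfluence.setOf_isIrredComponent ht1,
      OkamotoConfluence.ncard_components ht1⟩
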